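/- **Setting.** Let $\sigma=(\sigma^1,\sigma^2)\in\mathbb{R}^2$ and let $\mathbb{R}^2_\theta$ be the set of formal power series in $\theta$ with coefficients in $C^\infty(\mathbb{R}^2,\mathbb{C})$, with the Moyal–Weyl product $f\star g=\exp\big(i\pi\theta(\partial_{\sigma^1}\partial_{\rho^2}-\partial_{\sigma^2}\partial_{\rho^1})\big)f(\sigma)g(\rho)|_{\rho=\sigma}$; it is extended to vectors and matrices, and ${}^\dagger$ is the Hermitian conjugate ($\theta$ is real). Put $\theta^{12}=-\theta^{21}=\theta$, $\epsilon^{12}=\epsilon_{12}=1=-\epsilon^{21}=-\epsilon_{21}$, $[f,g]_\star=f\star g-g\star f$, $\{f,g\}_\star=f\star g+g\star f$. For a potential $\hat A=(\hat A_1,\hat A_2)$ with entries in $M_n(\mathbb{R}^2_\theta)$ let $\hat F_{\mu\nu}=\partial_\mu\hat A_\nu-\partial_\nu\hat A_\mu-i[\hat A_\mu,\hat A_\nu]_\star$, $\hat F=\hat F_{12}$, $D_\mu\hat\phi=\partial_\mu\hat\phi-i\hat A_\mu\star\hat\phi$ for $\hat\phi\in(\mathbb{R}^2_\theta)^n$ and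 $D_\mu\hat\Psi=\partial_\mu\hat\Psi-i[\hat A_\mu,\hat\Psi]_\star$ for $\hat\Psi\in M_n(\mathbb{R}^2_\theta)$. The Seiberg–Witten (SW) map whose ambiguity term is given by the operator $-3\hat F-iD_1D_2$ sends smooth $A_\kappa,\phi,\Psi$ to the solutions $\hat A_\kappa,\hat\phi,\hat\Psi$, with these values at $\theta=0$, of $$\partial_\theta\hat A_\kappa=-\tfrac{\pi}{2}\epsilon^{\mu\nu}\{\hat A_\mu,\partial_\nu\hat A_\kappa+\hat F_{\nu\kappa}\}_\star,$$ $$\partial_\theta\hat\phi=-\tfrac{\pi}{2}\epsilon^{\mu\nu}\big(\hat A_\mu\star(\partial_\nu\hat\phi+D_\nu\hat\phi)+\hat C_{\mu\nu}(\hat\phi)\big),\qquad \partial_\theta\hat\Psi=-\tfrac{\pi}{2}\epsilon^{\mu\nu}\big(\{\hat A_\mu,\partial_\nu\hat\Psi+D_\nu\hat\Psi\}_\star+\hat C_{\mu\nu}(\hat\Psi)\big),$$ where $\hat C_{\mu\nu}(\hat\phi)=\epsilon_{\mu\nu}(-3\hat F\star\hat\phi-iD_1D_2\hat\phi)$ and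 $\hat C_{\mu\nu}(\hat\Psi)=\epsilon_{\mu\nu}(-3[\hat F,\hat\Psi]_\star-iD_1D_2\hat\Psi)$. Let $n\ge1$ and $m\ne0$ be integers, $U_{kl}=e^{2\pi ikm/n}\delta_{kl}$, $V_{kl}=\delta_{k+1,l}$ for $k<n$ and $V_{nl}=\delta_{1l}$, $\Omega_1=e^{im\sigma^2/n}U$, $\Omega_2=V$. Let $e_1,e_2$ be the standard basis of $\mathbb{R}^2$. - $\mathcal{E}_{n,m}$ is the set of smooth $\phi:\mathbb{R}^2\to\mathbb{C}^n$ with $\phi(\sigma+2\pi e_\alpha)=\Omega_\alpha\phi$, and $\mathrm{End}(\mathcal{E}_{n,m})$ is the set of smooth $\Psi:\mathbb{R}^2\to M_n(\mathbb{C})$ with $\Psi(\sigma+2\pi e_\alpha)=\Omega_\alpha\Psi\Omega_\alpha^{-1}$. $\mathcal{E}^\theta_{n,m}\subset(\mathbb{R}^2_\theta)^n$ and $\mathrm{End}(\mathcal{E}^\theta_{n,m})\subset M_n(\mathbb{R}^2_\theta)$ are defined by the same conditions with all products replaced by $\star$. - $A_1=0$, $A_2=\frac mn\frac{\sigma^1}{2\pi}\mathbf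 1$; $A^\theta_1=0$, $A^\theta_2=\frac1{2\pi}\frac{m\sigma^1}{n-m\theta}\mathbf 1$. - A pair $(\hat{\mathcal{E}},\hat A)$ is the SW quantization of $(\mathcal{E}_{n,m},A)$ if $\hat A$ is the SW image of $A$; the SW images $\hat\Omega_\alpha$ of $\Omega_\alpha$ (as adjoint fields) satisfy $\hat\Omega_1(\sigma+2\pi e_2)\star\hat\Omega_2=\hat\Omega_2(\sigma+2\pi e_1)\star\hat\Omega_1$ and $\hat A_\mu(\sigma+2\pi e_\alpha)=\hat\Omega_\alpha\star\hat A_\mu\star\hat\Omega_\alpha^\dagger+i\hat\Omega_\alpha\star\partial_\mu\hat\Omega_\alpha^\dagger$; and $\hat{\mathcal{E}}=\{\hat\phi\in(\mathbb{R}^2_\theta)^n:\hat\phi(\sigma+2\pi e_\alpha)=\hat\Omega_\alpha\star\hat\phi\}$. - For Schwartz functions $\tilde\phi_1,\dots,\tilde\phi_{|m|}:\mathbb{R}\to\mathbb{C}$, with $\mathsf A=\frac mn\big(\frac{\sigma^2}{2\pi}+k+ns\big)+j$, $\mathsf B=i\sigma^1$ and $E(\mathsf A,\mathsf B)=\frac{1}{1-[\mathsf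 A,\mathsf B]_\star}\sum_{l\ge0}\frac1{l!}\mathsf A^l\star\mathsf B^l$, put for $k=1,\dots,n$ $$\phi_k=\sum_{s\in\mathbb{Z}}\sum_{j=1}^{|m|}e^{\mathsf A\mathsf B}\,\tilde\phi_j(\tfrac nm\mathsf A),\qquad \phi^\theta_k=\sum_{s\in\mathbb{Z}}\sum_{j=1}^{|m|}E(\mathsf A,\mathsf B)\star\tilde\phi_j(\tfrac nm\mathsf A),$$ the series being taken pointwise in each order of $\theta$. - For integers $a,b$ with $an-bm=1$, put $Z_1=e^{i\sigma^1/n}V^b$, $Z_2=e^{i\sigma^2/n}U^{-b}$, $Z^\theta_1=e^{i\sigma^1/(n-m\theta)}V^b$, $Z^\theta_2=e^{i\sigma^2/n}U^{-b}$. **Theorem.** 1. $(\mathcal{E}_{n,m},A)$ has exactly one SW quantization, namely $(\mathcal{E}^\theta_{n,m},A^\theta)$. 2. With $\hat A=A^\theta$, every smooth $\phi:\mathbb{R}^2\to\mathbb{C}^n$ and every smooth $\Psi:\mathbb{R}^2\to M_n(\mathbb{C})$ has exactly one SW image $\hat\phi$, $\hat\Psi$. If $\phi\in\mathcal{E}_{n,m}$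 then $\hat\phi\in\mathcal{E}^\theta_{n,m}$, and if $\Psi\in\mathrm{End}(\mathcal{E}_{n,m})$ then $\hat\Psi\in\mathrm{End}(\mathcal{E}^\theta_{n,m})$. 3. For all Schwartz functions $\tilde\phi_j$, the series defining $\phi$, $E(\mathsf A,\mathsf B)$ and $\phi^\theta$ converge absolutely, $\phi\in\mathcal{E}_{n,m}$, $\phi^\theta\in\mathcal{E}^\theta_{n,m}$, and $\hat\phi=\phi^\theta$. 4. For all integers $a,b$ with $an-bm=1$, $Z^\theta_1$ and $Z^\theta_2$ are $\star$-unitary, and for all $p,q\in\mathbb{Z}$ one has $Z_1^pZ_2^q\in\mathrm{End}(\mathcal{E}_{n,m})$, $(Z^\theta_1)^p\star(Z^\theta_2)^q\in\mathrm{End}(\mathcal{E}^\theta_{n,m})$ ($\star$-powers), and $\widehat{Z_1^pZ_2^q}=(Z^\theta_1)^p\star(Z^\theta_2)^q$. -/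

import Mathlib

open scoped ContDiff

noncomputable section

namespace NCTorus

/-- The plane `ℝ²`; the coordinates `σ¹, σ²` of `p` are `p 0, p 1`. -/
abbrev Plane : Type := Fin 2 → ℝ

/-- Formal power series in `θ` whose coefficients are complex functions on the plane.
`PowerSeries.X` is `θ`; the ring product of this type is the undeformed one. -/
abbrev Formal : Type := PowerSeries (Plane → ℂ)

/-- All coefficients are smooth: the series is an element of `ℝ²_θ`. -/
def IsSmooth (f : Formal) : Prop := ∀ N : ℕ, ContDiff ℝ ∞ (PowerSeries.coeff N f)

/-- Apply an operator on functions to each coefficient. -/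
def mapCoeff (T : (Plane → ℂ) → (Plane → ℂ)) (f : Formal) : Formal :=
  PowerSeries.mk fun N => T (PowerSeries.coeff N f)

/-- `∂/∂σ^μ` on functions. -/
def pd (μ : Fin 2) (f : Plane → ℂ) : Plane → ℂ := fun p => fderiv ℝ f p (Pi.single μ 1)

/-- `p` moved by `2π` in the direction `μ`. -/
def translate (μ : Fin 2) (p : Plane) : Plane := p + Pi.single μ (2 * Real.pi)

/-- `∂/∂σ^μ` on formal series. -/
def fpd (μ : Fin 2) : Formal → Formal := mapCoeff (pd μ)

/-- `f(σ) ↦ f(σ + 2π e_μ)` on formal series. -/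
def shift (μ : Fin 2) : Formal → Formal := mapCoeff fun f p => f (translate μ p)

/-- `∂/∂θ` on formal series. -/
def dθ (f : Formal) : Formal := PowerSeries.derivative (Plane → ℂ) f

/-- Coefficientwise complex conjugation (`θ` is real). -/
def fconj (f : Formal) : Formal := PowerSeries.map (starRingEnd (Plane → ℂ)) f

/-- The antisymmetric symbol: `θ^{μν} = θ ε^{μν}`, `ε^{12} = 1 = -ε^{21}`. -/
def eps : Matrix (Fin 2) (Fin 2) ℂ := !![0, 1; -1, 0]

/-- The `r`-th power of the bidifferential operator `ε^{μν} ∂_μ ⊗ ∂_ν`, followed by the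
pointwise product. -/
def bidiff : ℕ → (Plane → ℂ) → (Plane → ℂ) → (Plane → ℂ)
  | 0, f, g => f * g
  | r + 1, f, g => ∑ μ : Fin 2, ∑ ν : Fin 2, eps μ ν • bidiff r (pd μ f) (pd ν g)

/-- The Moyal-Weyl product `f ⋆ g = exp(iπ θ^{μν} ∂_μ ⊗ ∂_ν) (f ⊗ g)` restricted to the
diagonal. -/
def moyal (f g : Formal) : Formal :=
  PowerSeries.mk fun N => ∑ q ∈ Finset.HasAntidiagonal.antidiagonal N,
    ((Complex.I * (Real.pi : ℂ)) ^ q.1 / (q.1.factorial : ℂ)) •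
      ∑ t ∈ Finset.HasAntidiagonal.antidiagonal q.2,
        bidiff q.1 (PowerSeries.coeff t.1 f) (PowerSeries.coeff t.2 g)

/-- Formal sections of the trivial rank `n` bundle. -/
abbrev Vec (n : ℕ) : Type := Fin n → Formal

/-- Formal endomorphisms of the trivial rank `n` bundle. -/
abbrev Mat (n : ℕ) : Type := Matrix (Fin n) (Fin n) Formal

variable {n : ℕ}

/-- Matrix product with respect to `⋆`. -/
def mstar (P Q : Mat n) : Mat n := Matrix.of fun k l => ∑ j, moyal (P k j) (Q j l)

/-- Action of a matrix on a vector with respect to `⋆`. -/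
def vstar (P : Mat n) (φ : Vec n) : Vec n := fun k => ∑ l, moyal (P k l) (φ l)

/-- `{P, Q}_⋆`. -/
def anticomm (P Q : Mat n) : Mat n := mstar P Q + mstar Q P

/-- `[P, Q]_⋆`. -/
def comm (P Q : Mat n) : Mat n := mstar P Q - mstar Q P

/-- Hermitian conjugate. -/
def dagger (P : Mat n) : Mat n := Matrix.of fun k l => fconj (P l k)

/-- A matrix valued function as a formal endomorphism independent of `θ`. -/
def constMat (P : Plane → Matrix (Fin n) (Fin n) ℂ) : Mat n :=
  Matrix.of fun k l => PowerSeries.C (fun p => P p k l)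

/-! Seiberg-Witten equations on the plane -/

/-- Noncommutative field strength `F_{μν}`. -/
def fieldStrength (A : Fin 2 → Mat n) (μ ν : Fin 2) : Mat n :=
  (A ν).map (fpd μ) - (A μ).map (fpd ν) - Complex.I • mstar (A μ) (A ν)
    + Complex.I • mstar (A ν) (A μ)

/-- Covariant derivative in the fundamental: `∂_μ φ - i A_μ ⋆ φ`. -/
def covF (A : Fin 2 → Mat n) (μ : Fin 2) (φ : Vec n) : Vec n :=
  (fun k => fpd μ (φ k)) - Complex.I • vstar (A μ) φ

/-- Covariant derivative in the adjoint: `∂_μ Ψ - i [A_μ, Ψ]_⋆`. -/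
def covA (A : Fin 2 → Mat n) (μ : Fin 2) (Ψ : Mat n) : Mat n :=
  Ψ.map (fpd μ) - Complex.I • comm (A μ) Ψ

/-- The antisymmetric ambiguity `C_{12} = -C_{21}` given by the operator
`-3 F_{12} - i D_1 D_2`, in the fundamental. -/
def ambF (A : Fin 2 → Mat n) (φ : Vec n) (μ ν : Fin 2) : Vec n :=
  eps μ ν • (-((3 : ℂ) • vstar (fieldStrength A 0 1) φ)
    - Complex.I • covF A 0 (covF A 1 φ))

/-- The same operator in the adjoint, where `F_{12}` acts by its `⋆`-commutator. -/
def ambA (A : Fin 2 → Mat n) (Ψ : Mat n) (μ ν : Fin 2) : Mat n :=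
  eps μ ν • (-((3 : ℂ) • comm (fieldStrength A 0 1) Ψ)
    - Complex.I • covA A 0 (covA A 1 Ψ))

/-- `Â` is a Seiberg-Witten quantization of the gauge potential `A`: it solves
`δ^θ Â_κ = -(π/2) δθ^{μν} {Â_μ, ∂_ν Â_κ + F̂_{νκ}}_⋆` and equals `A` at `θ = 0`. -/
def IsSWPotential (A : Fin 2 → Plane → Matrix (Fin n) (Fin n) ℂ) (Ah : Fin 2 → Mat n) : Prop :=
  (∀ κ k l, IsSmooth (Ah κ k l)) ∧
  (∀ κ k l, PowerSeries.constantCoeff (Ah κ k l) = fun p => A κ p k l) ∧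
  ∀ κ, (Ah κ).map dθ = (-((Real.pi : ℂ) / 2)) • ∑ μ : Fin 2, ∑ ν : Fin 2,
    eps μ ν • anticomm (Ah μ) ((Ah κ).map (fpd ν) + fieldStrength Ah ν κ)

/-- `φh` is the Seiberg-Witten quantization of the section `φ`, for the ambiguity `ambF`:
`δ^θ φ̂ = -(π/2) δθ^{μν} (Â_μ ⋆ ∂_ν φ̂ + Â_μ ⋆ D_ν φ̂ + Ĉ_{μν})`, `φ̂ = φ` at `θ = 0`. -/
def IsSWFund (Ah : Fin 2 → Mat n) (φ : Fin n → Plane → ℂ) (φh : Vec n) : Prop :=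
  (∀ k, IsSmooth (φh k)) ∧
  (∀ k, PowerSeries.constantCoeff (φh k) = φ k) ∧
  (fun k => dθ (φh k)) = (-((Real.pi : ℂ) / 2)) • ∑ μ : Fin 2, ∑ ν : Fin 2,
    eps μ ν • (vstar (Ah μ) (fun k => fpd ν (φh k)) + vstar (Ah μ) (covF Ah ν φh)
      + ambF Ah φh μ ν)

/-- `Ψh` is the Seiberg-Witten quantization of the endomorphism `Ψ`, for the ambiguity `ambA`:
`δ^θ Ψ̂ = -(π/2) δθ^{μν} ({Â_μ, ∂_ν Ψ̂ + D_ν Ψ̂}_⋆ + Ĉ_{μν})`, `Ψ̂ = Ψ` at `θ = 0`. -/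
def IsSWAdj (Ah : Fin 2 → Mat n) (Ψ : Plane → Matrix (Fin n) (Fin n) ℂ) (Ψh : Mat n) : Prop :=
  (∀ k l, IsSmooth (Ψh k l)) ∧
  (∀ k l, PowerSeries.constantCoeff (Ψh k l) = fun p => Ψ p k l) ∧
  Ψh.map dθ = (-((Real.pi : ℂ) / 2)) • ∑ μ : Fin 2, ∑ ν : Fin 2,
    eps μ ν • (anticomm (Ah μ) (Ψh.map (fpd ν) + covA Ah ν Ψh) + ambA Ah Ψh μ ν)

/-! Twisted periodicity -/

/-- Sections of the trivial bundle on the noncommutative plane with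
`φ(σ + 2π e_α) = Ω_α ⋆ φ`. -/
def twistedSections (Ω : Fin 2 → Mat n) : Set (Vec n) :=
  {φ | (∀ k, IsSmooth (φ k)) ∧ ∀ α, (fun k => shift α (φ k)) = vstar (Ω α) φ}

/-- Endomorphisms with `Ψ(σ + 2π e_α) = Ω_α ⋆ Ψ ⋆ Ω_α^†` (for unitary `Ω_α`, the dagger is
the inverse). -/
def twistedEnd (Ω : Fin 2 → Mat n) : Set (Mat n) :=
  {Ψ | (∀ k l, IsSmooth (Ψ k l)) ∧
    ∀ α, Ψ.map (shift α) = mstar (mstar (Ω α) Ψ) (dagger (Ω α))}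

/-- `Ω_1(σ² + 2π) ⋆ Ω_2 = Ω_2(σ¹ + 2π) ⋆ Ω_1`. -/
def Cocycle (Ω : Fin 2 → Mat n) : Prop :=
  mstar ((Ω 0).map (shift 1)) (Ω 1) = mstar ((Ω 1).map (shift 0)) (Ω 0)

/-- `D_μ|_{σ + 2π e_α} = Ω_α ⋆ D_μ|_σ Ω_α^†`, spelled out for the gauge potential. -/
def TwistedConnection (Ω A : Fin 2 → Mat n) : Prop :=
  ∀ α μ, (A μ).map (shift α) = mstar (mstar (Ω α) (A μ)) (dagger (Ω α))
    + Complex.I • mstar (Ω α) ((dagger (Ω α)).map (fpd μ))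

/-- `(Eh, Ah)` is the quantization, induced by the Seiberg-Witten map of the plane, of the
bundle with connection on the torus given by the transition functions `Ω` and the potential `A`:
potential and transition functions are quantized, satisfy the noncommutative cocycle and
periodicity conditions, and `Eh` consists of the sections twisted by the quantized
transition functions. -/
def IsInducedQuantization (Ω A : Fin 2 → Plane → Matrix (Fin n) (Fin n) ℂ)
    (Eh : Set (Vec n)) (Ah : Fin 2 → Mat n) : Prop :=
  IsSWPotential A Ah ∧
  ∃ Ωh : Fin 2 → Mat n, (∀ α, IsSWAdj Ah (Ω α) (Ωh α)) ∧ Cocycle Ωh ∧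
    TwistedConnection Ωh Ah ∧ Eh = twistedSections Ωh

/-! The bundles of rank `n` and charge `m` -/

variable (n) (m : ℤ)

/-- Clock matrix; the index `k : Fin n` stands for `k + 1 ∈ {1, …, n}`. -/
def clock : Matrix (Fin n) (Fin n) ℂ :=
  Matrix.diagonal fun k =>
    Complex.exp (2 * (Real.pi : ℂ) * Complex.I * ((k : ℕ) + 1 : ℂ) * (m : ℂ) / (n : ℂ))

/-- Shift matrix. -/
def shiftMat : Matrix (Fin n) (Fin n) ℂ :=
  Matrix.of fun k l => if (l : ℕ) = ((k : ℕ) + 1) % n then 1 else 0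

/-- Transition functions `Ω_1 = e^{imσ²/n} U`, `Ω_2 = V`. -/
def Ωcl : Fin 2 → Plane → Matrix (Fin n) (Fin n) ℂ :=
  ![fun p => Complex.exp (Complex.I * (m : ℂ) * (p 1 : ℂ) / (n : ℂ)) • clock n m,
    fun _ => shiftMat n]

/-- The classical potential `A_1 = 0`, `A_2 = (m/n) σ¹/(2π)`. -/
def Acl : Fin 2 → Plane → Matrix (Fin n) (Fin n) ℂ :=
  ![fun _ => 0,
    fun p => ((m : ℂ) / (n : ℂ) * ((p 0 : ℂ) / (2 * (Real.pi : ℂ)))) • 1]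

/-- The module `𝓔_{n,m}` of smooth sections. -/
def Ecl : Set (Fin n → Plane → ℂ) :=
  {φ | (∀ k, ContDiff ℝ ∞ (φ k)) ∧
    ∀ α p k, φ k (translate α p) = ∑ l, Ωcl n m α p k l * φ l p}

/-- `End(𝓔_{n,m})`. -/
def Endcl : Set (Plane → Matrix (Fin n) (Fin n) ℂ) :=
  {Ψ | (∀ k l, ContDiff ℝ ∞ fun p => Ψ p k l) ∧
    ∀ α p, Ψ (translate α p) = Ωcl n m α p * Ψ p * (Ωcl n m α p)⁻¹}

/-- The transition functions as endomorphisms of the trivial bundle over `ℝ²_θ`. -/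
def Ωθ : Fin 2 → Mat n := fun α => constMat (Ωcl n m α)

/-- The formal series `1 / (n - m θ)`. -/
def invNM : Formal :=
  PowerSeries.map (algebraMap ℂ (Plane → ℂ))
    (PowerSeries.C (n : ℂ) - PowerSeries.C (m : ℂ) * PowerSeries.X)⁻¹

/-- The quantum potential `A^θ_1 = 0`, `A^θ_2 = (1/2π) m σ¹ / (n - m θ)`. -/
def Aθ : Fin 2 → Mat n :=
  ![0,
    Matrix.diagonal fun _ =>
      PowerSeries.C (fun p : Plane => (m : ℂ) * (p 0 : ℂ) / (2 * (Real.pi : ℂ))) * invNM n m]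

/-- The module `𝓔^θ_{n,m}`. -/
def Eθ : Set (Vec n) := twistedSections (Ωθ n m)

/-- `End(𝓔^θ_{n,m})`. -/
def Endθ : Set (Mat n) := twistedEnd (Ωθ n m)

/-! Explicit sections -/

/-- `A = (m/n)(σ²/2π + k + n s) + j`, with `k ∈ {1, …, n}` and `j ∈ {1, …, |m|}` represented by
elements of `Fin`. -/
def coordA (k : Fin n) (j : Fin m.natAbs) (s : ℤ) (p : Plane) : ℝ :=
  (m : ℝ) / (n : ℝ) * (p 1 / (2 * Real.pi) + ((k : ℕ) + 1 : ℝ) + (n : ℝ) * (s : ℝ))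
    + ((j : ℕ) + 1 : ℝ)

/-- `B = i σ¹`. -/
def coordB (p : Plane) : ℂ := Complex.I * (p 0 : ℂ)

/-- The function `σ ↦ φ̃_j((n/m) A)`. -/
def profile (φt : Fin m.natAbs → SchwartzMap ℝ ℂ) (k : Fin n) (j : Fin m.natAbs) (s : ℤ)
    (p : Plane) : ℂ :=
  φt j ((n : ℝ) / (m : ℝ) * coordA n m k j s p)

/-- The `s`-th term `∑_j e^{AB} φ̃_j((n/m) A)` of the classical section. -/
def classicalTerm (φt : Fin m.natAbs → SchwartzMap ℝ ℂ) (k : Fin n) (s : ℤ) (p : Plane) : ℂ :=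
  ∑ j, Complex.exp ((coordA n m k j s p : ℂ) * coordB p) * profile n m φt k j s p

/-- The classical section with profile `φ̃`. -/
def classicalSection (φt : Fin m.natAbs → SchwartzMap ℝ ℂ) : Fin n → Plane → ℂ :=
  fun k p => ∑' s : ℤ, classicalTerm n m φt k s p

/-- The `l`-th term `A^l ⋆ B^l / l!` of the normal ordered exponential of functions `A, B`. -/
def orderedTerm (A B : Plane → ℂ) (l : ℕ) : Formal :=
  (1 / (l.factorial : ℂ)) • moyal (PowerSeries.C (A ^ l)) (PowerSeries.C (B ^ l))

/-- `E(A,B) = (1 - [A,B]_⋆)⁻¹ ∑_l A^l ⋆ B^l / l!`. The sum over `l` is taken in each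
order of `θ`, at each point. -/
def normalOrdered (A B : Plane → ℂ) : Formal :=
  PowerSeries.invOfUnit
      (1 - (moyal (PowerSeries.C A) (PowerSeries.C B) - moyal (PowerSeries.C B) (PowerSeries.C A)))
      1
    * PowerSeries.mk fun N p => ∑' l : ℕ, PowerSeries.coeff N (orderedTerm A B l) p

/-- The `s`-th term `∑_j E(A,B) ⋆ φ̃_j((n/m) A)` of the quantum section. -/
def quantumTerm (φt : Fin m.natAbs → SchwartzMap ℝ ℂ) (k : Fin n) (s : ℤ) : Formal :=
  ∑ j, moyal (normalOrdered (fun p => (coordA n m k j s p : ℂ)) coordB)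
    (PowerSeries.C (profile n m φt k j s))

/-- The quantum section `φ^θ` with profile `φ̃`; the sum over `s` is taken in each order of `θ`,
at each point. -/
def quantumSection (φt : Fin m.natAbs → SchwartzMap ℝ ℂ) : Vec n :=
  fun k => PowerSeries.mk fun N p => ∑' s : ℤ, PowerSeries.coeff N (quantumTerm n m φt k s) p

/-- All series in the definitions of the classical and quantum sections converge (absolutely, in
each order of `θ`, at each point). -/
def SectionSeriesConverge (φt : Fin m.natAbs → SchwartzMap ℝ ℂ) : Prop :=
  (∀ k p, Summable fun s : ℤ => classicalTerm n m φt k s p) ∧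
  (∀ k j s N p, Summable fun l : ℕ =>
    PowerSeries.coeff N (orderedTerm (fun x => (coordA n m k j s x : ℂ)) coordB l) p) ∧
  (∀ k N p, Summable fun s : ℤ => PowerSeries.coeff N (quantumTerm n m φt k s) p)

/-! Generators of the endomorphism algebras -/

/-- Exponential of a formal series: `e^g = e^{g_0} ∑_l (g - g_0)^l / l!`, `g_0 = g|_{θ=0}`. -/
def formalExp (g : Formal) : Formal :=
  PowerSeries.C (fun p => Complex.exp (PowerSeries.constantCoeff g p)) *
    PowerSeries.mk fun N => ∑ l ∈ Finset.range (N + 1), (1 / (l.factorial : ℂ)) •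
      PowerSeries.coeff N ((g - PowerSeries.C (PowerSeries.constantCoeff g)) ^ l)

/-- `Z_1 = e^{iσ¹/n} V^b`, `Z_2 = e^{iσ²/n} U^{-b}`. -/
def Zcl (b : ℤ) : Fin 2 → Plane → Matrix (Fin n) (Fin n) ℂ :=
  ![fun p => Complex.exp (Complex.I * (p 0 : ℂ) / (n : ℂ)) • shiftMat n ^ b,
    fun p => Complex.exp (Complex.I * (p 1 : ℂ) / (n : ℂ)) • clock n m ^ (-b)]

/-- `Z^θ_1 = e^{iσ¹/(n - mθ)} V^b`, `Z^θ_2 = e^{iσ²/n} U^{-b}`. -/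
def Zθ (b : ℤ) : Fin 2 → Mat n :=
  ![formalExp (PowerSeries.C (fun p : Plane => Complex.I * (p 0 : ℂ)) * invNM n m) •
      constMat (fun _ => shiftMat n ^ b),
    constMat (Zcl n m b 1)]

variable {n}

/-- Natural powers with respect to `⋆`. -/
def starPow (Z : Mat n) : ℕ → Mat n
  | 0 => 1
  | k + 1 => mstar (starPow Z k) Z

/-- Integer powers with respect to `⋆` of a `⋆`-unitary element: `Z^{-1} = Z^†`. -/
def starZPow (Z : Mat n) : ℤ → Mat n
  | Int.ofNat k => starPow Z k
  | Int.negSucc k => starPow (dagger Z) (k + 1)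

/-- `Z ⋆ Z^† = 1 = Z^† ⋆ Z`. -/
def IsStarUnitary (Z : Mat n) : Prop := mstar Z (dagger Z) = 1 ∧ mstar (dagger Z) Z = 1

end NCTorus

end

open NCTorus

noncomputable section

namespace NCTorus

/-! ### Partial derivatives of functions on the plane -/

/-! Write ν = 1/(n - mθ). The only nonzero entry of `Aθ` is a = (m/2π) σ¹ ν. It is affine in σ¹, so
⋆-products with it stop at first order in the bidifferential operator, and its field strength is the
constant (m/2π) ν. In this background the Seiberg-Witten equations for fields decouple into scalar
entries and, after multiplication by n - mθ, become one linear evolution equation `SWEq`: (n - mθ)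
∂_θ f = m σ¹ ∂₁f + κ f + iπn ∂₁∂₂f, with κ = 2m for sections and κ = 0 for endomorphisms
(`isSWFund_iff`, `isSWAdj_iff`). Since n(N+1) ≠ 0, the coefficient of order N+1 is determined by
that of order N. This gives existence and uniqueness (`exists_swEq`, `SWEq.unique`), and an identity
of formal series follows once both sides solve the same equation and agree at θ = 0.

The ambiguity term makes the coefficient of ∂₁∂₂ equal to iπn, exactly the value for which right
⋆-multiplication by a function of σ² preserves the equation (`SWEq.moyal_yFun_right`): the
θ-derivative of the Moyal kernel cancels the cross term of ∂₁∂₂. Left multiplication by e^{iγσ²}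
instead adds a drift 2πnγ ∂₁ (`SWEq.moyal_yFun_left`), and translation of σ¹ by 2π adds 2πm ∂₁
(`SWEq.shift`). For γ = m/n the drifts agree, so both sides of each twisted periodicity condition
coincide (`mem_Eθ_of_isSWFund`, `mem_Endθ_of_isSWAdj`).

The equation for the potential is nonlinear, but its right side up to order N involves only orders
up to N, whence `isSWPotential_unique`. The transition functions depend on σ² alone and are their
own quantizations; cocycle and connection conditions are then computed directly.

For the explicit sections, the ordered sum in E(A,B) has coefficient (m/2n)^N e^z L_N(-z) at θ^N,
where z = AB and L_N is a Laguerre polynomial. A Laguerre recurrence shows that it solves `SWEq`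
with κ = m, and the prefactor 1/(1 - [A,B]) = nν raises κ to 2m (`swEq_normalOrdered`). The profile
is a function of σ² multiplied from the right, hence harmless, and Schwartz decay allows termwise
differentiation of the sum over s. For the monomials, ⋆-powers of the first generator depend on σ¹
only and solve the transport equation (`isXFlow_formalExp`); those of the second are functions of σ²
on the right. Classical periodicity rests on the clock and shift relation and an - bm = 1. -/

theorem pd_add (μ : Fin 2) {f g : Plane → ℂ} (hf : Differentiable ℝ f) (hg : Differentiable ℝ g) :
    pd μ (f + g) = pd μ f + pd μ g := by
  funext p
  simp [pd, fderiv_add (hf p) (hg p)]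

/-- No differentiability is needed: scaling by a nonzero constant does not affect differentiability,
and for c = 0 both sides vanish. -/
theorem pd_const_smul (μ : Fin 2) (c : ℂ) (f : Plane → ℂ) : pd μ (c • f) = c • pd μ f := by
  funext p
  rcases eq_or_ne c 0 with rfl | hc
  · simp [pd]
  · simp [pd, fderiv_const_smul_field]

theorem pd_zero (μ : Fin 2) : pd μ 0 = 0 := by
  simpa using pd_const_smul μ 0 0

theorem pd_const (μ : Fin 2) (c : ℂ) : pd μ (fun _ => c) = 0 := by
  funext p
  simp [pd]

theorem pd_mul (μ : Fin 2) {f g : Plane → ℂ} (hf : Differentiable ℝ f) (hg : Differentiable ℝ g) :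
    pd μ (f * g) = pd μ f * g + f * pd μ g := by
  funext p
  simp only [pd, fderiv_mul (hf p) (hg p), Pi.add_apply, Pi.mul_apply]
  simp
  ring

theorem pd_sum (μ : Fin 2) {ι : Type*} (s : Finset ι) {f : ι → Plane → ℂ}
    (hf : ∀ i ∈ s, Differentiable ℝ (f i)) : pd μ (∑ i ∈ s, f i) = ∑ i ∈ s, pd μ (f i) := by
  funext p
  have h : fderiv ℝ (∑ i ∈ s, f i) p = ∑ i ∈ s, fderiv ℝ (f i) p :=
    fderiv_sum fun i hi => hf i hi p
  simp [pd, h]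

theorem pd_cexp (μ : Fin 2) {f : Plane → ℂ} (hf : Differentiable ℝ f) :
    pd μ (fun p => Complex.exp (f p)) = fun p => Complex.exp (f p) * pd μ f p := by
  funext p
  have h := (hf p).hasFDerivAt.cexp.fderiv
  simp [pd, h]

theorem pd_comp_coord (μ ν : Fin 2) {G : ℝ → ℂ} (hG : Differentiable ℝ G) :
    pd μ (fun p => G (p ν)) = fun p => if μ = ν then deriv G (p ν) else 0 := by
  funext p
  have h1 : HasFDerivAt (fun p : Plane => p ν)
      (ContinuousLinearMap.proj (R := ℝ) (φ := fun _ : Fin 2 => ℝ) ν) p := hasFDerivAt_apply ν p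
  have h2 := HasFDerivAt.comp p (hG (p ν)).hasFDerivAt h1
  have h3 : fderiv ℝ (fun p : Plane => G (p ν)) p = _ := h2.fderiv
  simp only [pd, h3, ContinuousLinearMap.comp_apply, ContinuousLinearMap.proj_apply,
    fderiv_eq_smul_deriv]
  by_cases h : μ = ν
  · subst h; simp
  · simp [h, Ne.symm h]

theorem pd_contDiff (μ : Fin 2) {f : Plane → ℂ} (hf : ContDiff ℝ ∞ f) :
    ContDiff ℝ ∞ (pd μ f) := by
  have h : ContDiff ℝ ∞ (fderiv ℝ f) := hf.fderiv_right (by simp)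
  exact h.clm_apply contDiff_const

theorem differentiable_of_contDiff {f : Plane → ℂ} (hf : ContDiff ℝ ∞ f) :
    Differentiable ℝ f := hf.differentiable (by simp)

theorem pd_comm (μ ν : Fin 2) {f : Plane → ℂ} (hf : ContDiff ℝ ∞ f) :
    pd μ (pd ν f) = pd ν (pd μ f) := by
  funext p
  have h : ContDiff ℝ ∞ (fderiv ℝ f) := hf.fderiv_right (by simp)
  have hd : DifferentiableAt ℝ (fderiv ℝ f) p := h.differentiable (by simp) p
  have key : ∀ α β : Fin 2, pd α (pd β f) p
      = fderiv ℝ (fderiv ℝ f) p (Pi.single α 1) (Pi.single β 1) := by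
    intro α β
    have : fderiv ℝ (pd β f) p = _ :=
      (hd.hasFDerivAt.clm_apply (hasFDerivAt_const (Pi.single β (1 : ℝ) : Plane) p)).fderiv
    simp [pd, this] 
  rw [key, key]
  have hs : IsSymmSndFDerivAt ℝ f p :=
    (hf.contDiffAt).isSymmSndFDerivAt (by
      rw [minSmoothness_of_isRCLikeNormedField]; exact WithTop.coe_le_coe.2 le_top)
  exact hs _ _

theorem contDiff_translate (μ : Fin 2) : ContDiff ℝ ∞ (translate μ) := by
  unfold translate; fun_prop

theorem pd_translate (μ ν : Fin 2) (f : Plane → ℂ) :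
    pd μ (fun p => f (translate ν p)) = fun p => pd μ f (translate ν p) := by
  funext p
  simp only [pd, translate]
  rw [fderiv_comp_add_right]

theorem translate_apply (μ ν : Fin 2) (p : Plane) :
    translate μ p ν = p ν + if ν = μ then 2 * Real.pi else 0 := by
  simp [translate, Pi.single_apply]

/-! ### Coefficientwise operators on formal series -/

/-- The coordinate `σ^1` as a function. -/
def coordX : Plane → ℂ := fun p => (p 0 : ℂ)

theorem contDiff_coordX : ContDiff ℝ ∞ coordX :=
  Complex.ofRealCLM.contDiff.comp (contDiff_apply ℝ ℝ (0 : Fin 2))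

theorem pd_zero_coordX : pd 0 coordX = 1 := by
  have := pd_comp_coord 0 0 (G := fun t : ℝ => (t : ℂ)) Complex.ofRealCLM.differentiable
  unfold coordX
  rw [this]
  funext p
  have h : deriv (fun t : ℝ => (t : ℂ)) (p 0) = 1 := (Complex.ofRealCLM.hasDerivAt).deriv
  simp [h]

theorem pd_one_coordX : pd 1 coordX = 0 := by
  have := pd_comp_coord 1 0 (G := fun t : ℝ => (t : ℂ)) Complex.ofRealCLM.differentiable
  unfold coordX
  rw [this]
  funext p
  simp

@[simp] theorem coeff_fpd (μ : Fin 2) (f : Formal) (N : ℕ) :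
    PowerSeries.coeff N (fpd μ f) = pd μ (PowerSeries.coeff N f) := by
  simp [fpd, mapCoeff]

@[simp] theorem coeff_shift (μ : Fin 2) (f : Formal) (N : ℕ) :
    PowerSeries.coeff N (shift μ f) = fun p => PowerSeries.coeff N f (translate μ p) := by
  simp [shift, mapCoeff]

@[simp] theorem coeff_dθ (f : Formal) (N : ℕ) :
    PowerSeries.coeff N (dθ f) = ((N : ℂ) + 1) • PowerSeries.coeff (N + 1) f := by
  funext p
  simp [dθ, PowerSeries.coeff_derivative, mul_comm]

@[simp] theorem coeff_fconj (f : Formal) (N : ℕ) (p : Plane) :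
    PowerSeries.coeff N (fconj f) p = (starRingEnd ℂ) (PowerSeries.coeff N f p) := by
  simp [fconj]

@[simp] theorem coeff_const_smul (c : ℂ) (f : Formal) (N : ℕ) :
    PowerSeries.coeff N (c • f) = c • PowerSeries.coeff N f := by
  rfl

theorem IsSmooth.add {f g : Formal} (hf : IsSmooth f) (hg : IsSmooth g) : IsSmooth (f + g) :=
  fun N => by rw [map_add]; exact (hf N).add (hg N)

theorem IsSmooth.sub {f g : Formal} (hf : IsSmooth f) (hg : IsSmooth g) : IsSmooth (f - g) :=
  fun N => by rw [map_sub]; exact (hf N).sub (hg N)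

theorem IsSmooth.const_smul {f : Formal} (c : ℂ) (hf : IsSmooth f) : IsSmooth (c • f) :=
  fun N => by rw [coeff_const_smul]; exact (hf N).const_smul c

theorem isSmooth_zero : IsSmooth 0 := fun N => by rw [map_zero]; exact contDiff_const

theorem IsSmooth.sum {ι : Type*} {s : Finset ι} {f : ι → Formal} (hf : ∀ i ∈ s, IsSmooth (f i)) :
    IsSmooth (∑ i ∈ s, f i) := fun N => by
  rw [map_sum]
  have h := ContDiff.sum (fun i hi => hf i hi N)
  convert h using 1
  funext p
  simp

theorem IsSmooth.mul {f g : Formal} (hf : IsSmooth f) (hg : IsSmooth g) : IsSmooth (f * g) :=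
  fun N => by
  rw [PowerSeries.coeff_mul]
  have h : ContDiff ℝ ∞ fun p => ∑ q ∈ Finset.HasAntidiagonal.antidiagonal N,
      PowerSeries.coeff q.1 f p * PowerSeries.coeff q.2 g p :=
    ContDiff.sum fun q _ => (hf q.1).mul (hg q.2)
  refine (congrArg (ContDiff ℝ ∞) ?_).mp h
  funext p
  simp

theorem isSmooth_C {f : Plane → ℂ} (hf : ContDiff ℝ ∞ f) : IsSmooth (PowerSeries.C f) := fun N => by
  rw [PowerSeries.coeff_C]
  split_ifs
  · exact hf
  · exact contDiff_const

theorem isSmooth_one : IsSmooth 1 := by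
  have := isSmooth_C (f := 1) contDiff_const
  rwa [map_one] at this

theorem isSmooth_X : IsSmooth PowerSeries.X := fun N => by
  rw [PowerSeries.coeff_X]
  split_ifs
  · exact contDiff_const
  · exact contDiff_const

theorem IsSmooth.pow {f : Formal} (hf : IsSmooth f) (k : ℕ) : IsSmooth (f ^ k) := by
  induction k with
  | zero => rw [pow_zero]; exact isSmooth_one
  | succ k ih => rw [pow_succ]; exact ih.mul hf

theorem IsSmooth.fpd {f : Formal} (hf : IsSmooth f) (μ : Fin 2) : IsSmooth (fpd μ f) :=
  fun N => by rw [coeff_fpd]; exact pd_contDiff μ (hf N)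

theorem IsSmooth.dθ {f : Formal} (hf : IsSmooth f) : IsSmooth (dθ f) :=
  fun N => by rw [coeff_dθ]; exact (hf (N + 1)).const_smul ((N : ℂ) + 1)

theorem IsSmooth.fconj {f : Formal} (hf : IsSmooth f) : IsSmooth (fconj f) :=
  fun N => by
  convert Complex.conjCLE.contDiff.comp (hf N) using 1
  funext p
  simp

theorem IsSmooth.differentiable {f : Formal} (hf : IsSmooth f) (N : ℕ) :
    Differentiable ℝ (PowerSeries.coeff N f) := differentiable_of_contDiff (hf N)

theorem fpd_add (μ : Fin 2) {f g : Formal} (hf : IsSmooth f) (hg : IsSmooth g) :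
    fpd μ (f + g) = fpd μ f + fpd μ g := by
  ext1 N
  simp [pd_add μ (hf.differentiable N) (hg.differentiable N)]

theorem fpd_const_smul (μ : Fin 2) (c : ℂ) (f : Formal) : fpd μ (c • f) = c • fpd μ f := by
  ext1 N
  simp [pd_const_smul]

theorem fpd_zero (μ : Fin 2) : fpd μ 0 = 0 := by
  simpa using fpd_const_smul μ 0 0

theorem fpd_sub (μ : Fin 2) {f g : Formal} (hf : IsSmooth f) (hg : IsSmooth g) :
    fpd μ (f - g) = fpd μ f - fpd μ g := by
  have h := fpd_add μ hf (hg.const_smul (-1))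
  rw [fpd_const_smul] at h
  simpa [sub_eq_add_neg] using h

theorem fpd_mul (μ : Fin 2) {f g : Formal} (hf : IsSmooth f) (hg : IsSmooth g) :
    fpd μ (f * g) = fpd μ f * g + f * fpd μ g := by
  ext1 N
  rw [coeff_fpd, map_add, PowerSeries.coeff_mul, PowerSeries.coeff_mul, PowerSeries.coeff_mul,
    pd_sum, ← Finset.sum_add_distrib]
  · refine Finset.sum_congr rfl fun q _ => ?_
    rw [pd_mul μ (hf.differentiable _) (hg.differentiable _), coeff_fpd, coeff_fpd]
  · exact fun q _ => (hf.differentiable _).mul (hg.differentiable _)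

theorem fpd_sum (μ : Fin 2) {ι : Type*} (s : Finset ι) {f : ι → Formal}
    (hf : ∀ i ∈ s, IsSmooth (f i)) : fpd μ (∑ i ∈ s, f i) = ∑ i ∈ s, fpd μ (f i) := by
  ext1 N
  rw [coeff_fpd, map_sum, map_sum, pd_sum μ s fun i hi => (hf i hi).differentiable N]
  simp

theorem fpd_C (μ : Fin 2) (f : Plane → ℂ) : fpd μ (PowerSeries.C f) = PowerSeries.C (pd μ f) := by
  ext1 N
  rw [coeff_fpd, PowerSeries.coeff_C, PowerSeries.coeff_C]
  split_ifs
  · rfl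
  · exact pd_zero μ

theorem fpd_X (μ : Fin 2) : fpd μ PowerSeries.X = 0 := by
  ext1 N
  rw [coeff_fpd, PowerSeries.coeff_X, map_zero]
  split_ifs
  · exact pd_const μ 1
  · exact pd_zero μ

theorem fpd_comm (μ ν : Fin 2) {f : Formal} (hf : IsSmooth f) :
    fpd μ (fpd ν f) = fpd ν (fpd μ f) := by
  ext1 N
  simp [pd_comm μ ν (hf N)]

theorem dθ_add (f g : Formal) : dθ (f + g) = dθ f + dθ g := by simp [dθ]

theorem dθ_sub (f g : Formal) : dθ (f - g) = dθ f - dθ g := by simp [dθ]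

theorem dθ_mul (f g : Formal) : dθ (f * g) = dθ f * g + f * dθ g := by
  rw [dθ, Derivation.leibniz, smul_eq_mul, smul_eq_mul, dθ, dθ]
  ring

theorem dθ_const_smul (c : ℂ) (f : Formal) : dθ (c • f) = c • dθ f := by
  ext1 N
  rw [coeff_dθ, coeff_const_smul, coeff_const_smul, coeff_dθ, smul_comm]

theorem dθ_C (f : Plane → ℂ) : dθ (PowerSeries.C f) = 0 := by
  ext1 N
  simp

theorem dθ_X : dθ (PowerSeries.X) = 1 := by
  simp [dθ]

theorem dθ_sum {ι : Type*} (s : Finset ι) (f : ι → Formal) :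
    dθ (∑ i ∈ s, f i) = ∑ i ∈ s, dθ (f i) := by simp [dθ]

/-- Formal series which do not depend on the point of the plane. -/
def scalarSeries (c : PowerSeries ℂ) : Formal := PowerSeries.map (algebraMap ℂ (Plane → ℂ)) c

theorem isSmooth_scalarSeries (c : PowerSeries ℂ) : IsSmooth (scalarSeries c) := fun N => by
  rw [scalarSeries, PowerSeries.coeff_map]
  exact contDiff_const

theorem fpd_scalarSeries (μ : Fin 2) (c : PowerSeries ℂ) : fpd μ (scalarSeries c) = 0 := by
  ext1 N
  rw [coeff_fpd, scalarSeries, PowerSeries.coeff_map]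
  exact pd_const μ _

theorem C_const_mul (c : ℂ) (f : Formal) : PowerSeries.C (fun _ => c) * f = c • f := by
  ext1 N
  rw [PowerSeries.coeff_C_mul]
  rfl

end NCTorus

namespace NCTorus

/-! ### The Moyal product of special functions -/

theorem bidiff_succ (r : ℕ) (f g : Plane → ℂ) :
    bidiff (r + 1) f g = bidiff r (pd 0 f) (pd 1 g) - bidiff r (pd 1 f) (pd 0 g) := by
  simp [bidiff, Fin.sum_univ_two, eps, sub_eq_add_neg]

theorem bidiff_zero_left (r : ℕ) (g : Plane → ℂ) : bidiff r 0 g = 0 := by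
  induction r generalizing g with
  | zero => simp [bidiff]
  | succ r ih => simp [bidiff_succ, pd_zero, ih]

theorem bidiff_zero_right (r : ℕ) (f : Plane → ℂ) : bidiff r f 0 = 0 := by
  induction r generalizing f with
  | zero => simp [bidiff]
  | succ r ih => simp [bidiff_succ, pd_zero, ih]

theorem coeff_moyal (f g : Formal) (N : ℕ) :
    PowerSeries.coeff N (moyal f g) = ∑ q ∈ Finset.HasAntidiagonal.antidiagonal N,
      ((Complex.I * (Real.pi : ℂ)) ^ q.1 / (q.1.factorial : ℂ)) •
        ∑ t ∈ Finset.HasAntidiagonal.antidiagonal q.2,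
          bidiff q.1 (PowerSeries.coeff t.1 f) (PowerSeries.coeff t.2 g) := by
  simp [moyal]

theorem moyal_zero_left (g : Formal) : moyal 0 g = 0 := by
  ext1 N
  simp [coeff_moyal, bidiff_zero_left]

theorem moyal_zero_right (f : Formal) : moyal f 0 = 0 := by
  ext1 N
  simp [coeff_moyal, bidiff_zero_right]

/-- The product is triangular in θ: its order i involves only orders at most i of the factors. This
drives the induction that determines the potential. -/
theorem moyal_congr {f f' g g' : Formal} {N : ℕ}
    (hf : ∀ i ≤ N, PowerSeries.coeff i f = PowerSeries.coeff i f')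
    (hg : ∀ i ≤ N, PowerSeries.coeff i g = PowerSeries.coeff i g') :
    ∀ i ≤ N, PowerSeries.coeff i (moyal f g) = PowerSeries.coeff i (moyal f' g') := by
  intro i hi
  rw [coeff_moyal, coeff_moyal]
  refine Finset.sum_congr rfl fun q hq => ?_
  congr 1
  refine Finset.sum_congr rfl fun t ht => ?_
  rw [Finset.HasAntidiagonal.mem_antidiagonal] at hq ht
  rw [hf t.1 (by omega), hg t.2 (by omega)]

theorem moyal_C_right_coeff (f : Formal) (g : Plane → ℂ) (N : ℕ) :
    PowerSeries.coeff N (moyal f (PowerSeries.C g)) =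
      ∑ q ∈ Finset.HasAntidiagonal.antidiagonal N,
        ((Complex.I * (Real.pi : ℂ)) ^ q.1 / (q.1.factorial : ℂ)) •
          bidiff q.1 (PowerSeries.coeff q.2 f) g := by
  rw [coeff_moyal]
  refine Finset.sum_congr rfl fun q _ => ?_
  congr 1
  rw [Finset.sum_eq_single (q.2, 0)]
  · simp
  · rintro ⟨a, b⟩ h hne
    rw [Finset.HasAntidiagonal.mem_antidiagonal] at h
    have : b ≠ 0 := by rintro rfl; simp at h; simp [h] at hne
    simp [PowerSeries.coeff_C, this, bidiff_zero_right]
  · simp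

theorem moyal_C_left_coeff (f : Plane → ℂ) (g : Formal) (N : ℕ) :
    PowerSeries.coeff N (moyal (PowerSeries.C f) g) =
      ∑ q ∈ Finset.HasAntidiagonal.antidiagonal N,
        ((Complex.I * (Real.pi : ℂ)) ^ q.1 / (q.1.factorial : ℂ)) •
          bidiff q.1 f (PowerSeries.coeff q.2 g) := by
  rw [coeff_moyal]
  refine Finset.sum_congr rfl fun q _ => ?_
  congr 1
  rw [Finset.sum_eq_single (0, q.2)]
  · simp
  · rintro ⟨a, b⟩ h hne
    rw [Finset.HasAntidiagonal.mem_antidiagonal] at h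
    have : a ≠ 0 := by rintro rfl; simp at h; simp [h] at hne
    simp [PowerSeries.coeff_C, this, bidiff_zero_left]
  · simp

/-- The Moyal product when all bidifferential terms of order at least two vanish. -/
theorem moyal_eq_of_bidiff_eq_zero {f g : Formal}
    (h : ∀ r i j, bidiff (r + 2) (PowerSeries.coeff i f) (PowerSeries.coeff j g) = 0) :
    moyal f g = f * g + (Complex.I * (Real.pi : ℂ)) •
      (PowerSeries.X * (fpd 0 f * fpd 1 g - fpd 1 f * fpd 0 g)) := by
  have h0 : ∀ N, ∑ t ∈ Finset.HasAntidiagonal.antidiagonal N,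
      bidiff 0 (PowerSeries.coeff t.1 f) (PowerSeries.coeff t.2 g)
        = PowerSeries.coeff N (f * g) := fun N => by
    rw [PowerSeries.coeff_mul]; rfl
  ext1 N
  rw [coeff_moyal]
  cases N with
  | zero =>
    simp [bidiff]
  | succ N =>
    rw [Finset.Nat.sum_antidiagonal_succ,
      Finset.sum_eq_single (s := Finset.HasAntidiagonal.antidiagonal N) (0, N)]
    · simp only [h0, pow_zero, Nat.factorial_zero, Nat.cast_one, div_one, one_smul, zero_add,
        pow_one, Nat.factorial_one, map_add, coeff_const_smul, PowerSeries.coeff_succ_X_mul]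
      congr 2
      rw [map_sub, PowerSeries.coeff_mul, PowerSeries.coeff_mul, ← Finset.sum_sub_distrib]
      refine Finset.sum_congr rfl fun t _ => ?_
      rw [bidiff_succ]
      simp [bidiff]
    · rintro ⟨a, b⟩ _ hne
      cases a with
      | zero =>
        rename_i hab
        rw [Finset.HasAntidiagonal.mem_antidiagonal] at hab
        simp at hab
        simp [hab] at hne
      | succ a => simp [h]
    · simp

/-- Every term of order at least two puts two or more derivatives on `f`, and all of its second
derivatives vanish, as does its σ²-derivative. -/
theorem bidiff_eq_zero_of_affine_left {f : Plane → ℂ} (h1 : pd 1 f = 0) (h00 : pd 0 (pd 0 f) = 0)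
    (h10 : pd 1 (pd 0 f) = 0) (r : ℕ) (g : Plane → ℂ) : bidiff (r + 2) f g = 0 := by
  simp [bidiff_succ, h1, h00, h10, bidiff_zero_left, pd_zero]

theorem bidiff_eq_zero_of_affine_right {f : Plane → ℂ} (h1 : pd 1 f = 0) (h00 : pd 0 (pd 0 f) = 0)
    (h10 : pd 1 (pd 0 f) = 0) (r : ℕ) (g : Plane → ℂ) : bidiff (r + 2) g f = 0 := by
  simp [bidiff_succ, h1, h00, h10, bidiff_zero_right, pd_zero]

/-- A formal series whose Moyal products have terms of order at most one: a function of `σ^1`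
that is affine. -/
structure IsAffine (f : Formal) : Prop where
  one : fpd 1 f = 0
  zero_zero : fpd 0 (fpd 0 f) = 0
  one_zero : fpd 1 (fpd 0 f) = 0

theorem IsAffine.bidiff_left {f : Formal} (hf : IsAffine f) (r i : ℕ) (g : Plane → ℂ) :
    bidiff (r + 2) (PowerSeries.coeff i f) g = 0 := by
  apply bidiff_eq_zero_of_affine_left
  · simpa using congrArg (PowerSeries.coeff i) hf.one
  · simpa using congrArg (PowerSeries.coeff i) hf.zero_zero
  · simpa using congrArg (PowerSeries.coeff i) hf.one_zero

theorem IsAffine.bidiff_right {f : Formal} (hf : IsAffine f) (r i : ℕ) (g : Plane → ℂ) :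
    bidiff (r + 2) g (PowerSeries.coeff i f) = 0 := by
  apply bidiff_eq_zero_of_affine_right
  · simpa using congrArg (PowerSeries.coeff i) hf.one
  · simpa using congrArg (PowerSeries.coeff i) hf.zero_zero
  · simpa using congrArg (PowerSeries.coeff i) hf.one_zero

theorem IsAffine.moyal_left {f : Formal} (hf : IsAffine f) (g : Formal) :
    moyal f g = f * g + (Complex.I * (Real.pi : ℂ)) • (PowerSeries.X * (fpd 0 f * fpd 1 g)) := by
  rw [moyal_eq_of_bidiff_eq_zero fun r i j => hf.bidiff_left r i _, hf.one]
  simp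

theorem IsAffine.moyal_right {f : Formal} (hf : IsAffine f) (g : Formal) :
    moyal g f = g * f - (Complex.I * (Real.pi : ℂ)) • (PowerSeries.X * (fpd 1 g * fpd 0 f)) := by
  rw [moyal_eq_of_bidiff_eq_zero fun r i j => hf.bidiff_right r j _, hf.one]
  simp [sub_eq_add_neg]

theorem isAffine_of_fpd_eq_zero {f : Formal} (h : ∀ μ, fpd μ f = 0) : IsAffine f :=
  ⟨h 1, by rw [h 0, fpd_zero], by rw [h 0, fpd_zero]⟩

theorem moyal_of_fpd_eq_zero_left {f : Formal} (h : ∀ μ, fpd μ f = 0) (g : Formal) :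
    moyal f g = f * g := by
  rw [(isAffine_of_fpd_eq_zero h).moyal_left, h 0]
  simp

theorem moyal_of_fpd_eq_zero_right {f : Formal} (h : ∀ μ, fpd μ f = 0) (g : Formal) :
    moyal g f = g * f := by
  rw [(isAffine_of_fpd_eq_zero h).moyal_right, h 0]
  simp

theorem bidiff_eq_zero_of_pd_one_eq_zero {f g : Plane → ℂ} (hf : pd 1 f = 0) (hg : pd 1 g = 0)
    (r : ℕ) : bidiff (r + 1) f g = 0 := by
  simp [bidiff_succ, hf, hg, bidiff_zero_left, bidiff_zero_right]

/-- On functions of `σ^1` the Moyal product is the pointwise product. -/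
theorem moyal_of_fpd_one_eq_zero {f g : Formal} (hf : fpd 1 f = 0) (hg : fpd 1 g = 0) :
    moyal f g = f * g := by
  have h : ∀ r i j, bidiff (r + 1) (PowerSeries.coeff i f) (PowerSeries.coeff j g) = 0 :=
    fun r i j => bidiff_eq_zero_of_pd_one_eq_zero
      (by simpa using congrArg (PowerSeries.coeff i) hf)
      (by simpa using congrArg (PowerSeries.coeff j) hg) r
  rw [moyal_eq_of_bidiff_eq_zero fun r i j => h (r + 1) i j, hf, hg]
  simp

theorem bidiff_eq_zero_of_pd_zero_eq_zero {f g : Plane → ℂ} (hf : pd 0 f = 0) (hg : pd 0 g = 0)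
    (r : ℕ) : bidiff (r + 1) f g = 0 := by
  simp [bidiff_succ, hf, hg, bidiff_zero_left, bidiff_zero_right]

/-- On functions of `σ^2` the Moyal product is the pointwise product. -/
theorem moyal_of_fpd_zero_eq_zero {f g : Formal} (hf : fpd 0 f = 0) (hg : fpd 0 g = 0) :
    moyal f g = f * g := by
  have h : ∀ r i j, bidiff (r + 1) (PowerSeries.coeff i f) (PowerSeries.coeff j g) = 0 :=
    fun r i j => bidiff_eq_zero_of_pd_zero_eq_zero
      (by simpa using congrArg (PowerSeries.coeff i) hf)
      (by simpa using congrArg (PowerSeries.coeff j) hg) r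
  rw [moyal_eq_of_bidiff_eq_zero fun r i j => h (r + 1) i j, hf, hg]
  simp

/-! ### Moyal products with functions of `σ^2` -/

/-- A smooth function of `σ^2` only. -/
def IsYFun (g : Plane → ℂ) : Prop := ContDiff ℝ ∞ g ∧ pd 0 g = 0

theorem IsYFun.pd_one {g : Plane → ℂ} (hg : IsYFun g) : IsYFun (pd 1 g) :=
  ⟨pd_contDiff 1 hg.1, by rw [pd_comm 0 1 hg.1, hg.2, pd_zero]⟩

theorem IsYFun.iterate {g : Plane → ℂ} (hg : IsYFun g) (r : ℕ) : IsYFun ((pd 1)^[r] g) := by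
  induction r with
  | zero => exact hg
  | succ r ih => rw [Function.iterate_succ_apply']; exact ih.pd_one

theorem contDiff_iterate_pd (μ : Fin 2) {f : Plane → ℂ} (hf : ContDiff ℝ ∞ f) (r : ℕ) :
    ContDiff ℝ ∞ ((pd μ)^[r] f) := by
  induction r with
  | zero => exact hf
  | succ r ih => rw [Function.iterate_succ_apply']; exact pd_contDiff μ ih

theorem iterate_pd_const_smul (μ : Fin 2) (c : ℂ) (f : Plane → ℂ) (r : ℕ) :
    (pd μ)^[r] (c • f) = c • (pd μ)^[r] f := by
  induction r with
  | zero => rfl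
  | succ r ih => rw [Function.iterate_succ_apply', ih, pd_const_smul, Function.iterate_succ_apply']

theorem iterate_pd_zero (μ : Fin 2) (r : ℕ) : (pd μ)^[r] 0 = 0 := by
  simpa using iterate_pd_const_smul μ 0 0 r

theorem iterate_pd_add (μ : Fin 2) {f g : Plane → ℂ} (hf : ContDiff ℝ ∞ f) (hg : ContDiff ℝ ∞ g)
    (r : ℕ) : (pd μ)^[r] (f + g) = (pd μ)^[r] f + (pd μ)^[r] g := by
  induction r with
  | zero => rfl
  | succ r ih =>
    simp only [Function.iterate_succ_apply']
    rw [ih, pd_add μ (differentiable_of_contDiff (contDiff_iterate_pd μ hf r))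
      (differentiable_of_contDiff (contDiff_iterate_pd μ hg r))]

theorem iterate_pd_comm {f : Plane → ℂ} (hf : ContDiff ℝ ∞ f) (μ ν : Fin 2) (r : ℕ) :
    pd ν ((pd μ)^[r] f) = (pd μ)^[r] (pd ν f) := by
  induction r with
  | zero => rfl
  | succ r ih =>
    rw [Function.iterate_succ_apply', pd_comm ν μ (contDiff_iterate_pd μ hf r), ih,
      Function.iterate_succ_apply']

/-- This is the commutator [∂^k, x] = k ∂^{k-1}, with k = r + 1. -/
theorem iterate_pd_coordX_mul {f : Plane → ℂ} (hf : ContDiff ℝ ∞ f) (r : ℕ) :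
    (pd 0)^[r + 1] (coordX * f)
      = coordX * (pd 0)^[r + 1] f + ((r : ℂ) + 1) • (pd 0)^[r] f := by
  induction r with
  | zero =>
    simp only [zero_add, Function.iterate_one, Function.iterate_zero_apply]
    rw [pd_mul 0 (differentiable_of_contDiff contDiff_coordX) (differentiable_of_contDiff hf),
      pd_zero_coordX]
    simp [add_comm]
  | succ r ih =>
    have h1 := contDiff_iterate_pd 0 hf (r + 1)
    have h2 := contDiff_iterate_pd 0 hf r
    rw [Function.iterate_succ_apply', ih, pd_add, pd_const_smul, pd_mul, pd_zero_coordX,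
      ← Function.iterate_succ_apply' (pd 0) (r + 1) f, ← Function.iterate_succ_apply' (pd 0) r f]
    · push_cast
      rw [one_mul, add_smul ((r : ℂ) + 1), one_smul]
      abel
    · exact differentiable_of_contDiff contDiff_coordX
    · exact differentiable_of_contDiff h1
    · exact differentiable_of_contDiff (contDiff_coordX.mul h1)
    · exact (differentiable_of_contDiff h2).const_smul _

/-- A σ¹-derivative of `g` is zero, so of the 2^r terms only the one with all σ¹-derivatives on `f`
survives. -/
theorem bidiff_yFun_right {g : Plane → ℂ} (hg : IsYFun g) (r : ℕ) (f : Plane → ℂ) :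
    bidiff r f g = (pd 0)^[r] f * (pd 1)^[r] g := by
  induction r generalizing f g with
  | zero => rfl
  | succ r ih =>
    rw [bidiff_succ, hg.2, bidiff_zero_right, sub_zero, ih hg.pd_one]
    rfl

/-- The surviving term now uses ε^{21} = -1 at each of the r steps. Left and right multiplication
thus differ only in the sign of τ in `yStar`. -/
theorem bidiff_yFun_left {g : Plane → ℂ} (hg : IsYFun g) (r : ℕ) (f : Plane → ℂ) :
    bidiff r g f = (-1 : ℂ) ^ r • ((pd 0)^[r] f * (pd 1)^[r] g) := by
  induction r generalizing f g with
  | zero => simp [bidiff, mul_comm]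
  | succ r ih =>
    rw [bidiff_succ, hg.2, bidiff_zero_left, zero_sub, ih hg.pd_one, pow_succ]
    simp

/-- `exp(τ θ ∂_1 ⊗ ∂_2)` applied to `f ⊗ g`, followed by the product. -/
def yStar (τ : ℂ) (g : Plane → ℂ) (f : Formal) : Formal :=
  PowerSeries.mk fun N => ∑ q ∈ Finset.HasAntidiagonal.antidiagonal N,
    (τ ^ q.1 / (q.1.factorial : ℂ)) •
      ((pd 0)^[q.1] (PowerSeries.coeff q.2 f) * (pd 1)^[q.1] g)

theorem coeff_yStar (τ : ℂ) (g : Plane → ℂ) (f : Formal) (N : ℕ) :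
    PowerSeries.coeff N (yStar τ g f) = ∑ q ∈ Finset.HasAntidiagonal.antidiagonal N,
    (τ ^ q.1 / (q.1.factorial : ℂ)) •
      ((pd 0)^[q.1] (PowerSeries.coeff q.2 f) * (pd 1)^[q.1] g) := by
  simp [yStar]

theorem moyal_yFun_right {g : Plane → ℂ} (hg : IsYFun g) (f : Formal) :
    moyal f (PowerSeries.C g) = yStar (Complex.I * Real.pi) g f := by
  ext1 N
  rw [moyal_C_right_coeff, coeff_yStar]
  simp_rw [bidiff_yFun_right hg]

theorem moyal_yFun_left {g : Plane → ℂ} (hg : IsYFun g) (f : Formal) :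
    moyal (PowerSeries.C g) f = yStar (-(Complex.I * Real.pi)) g f := by
  ext1 N
  rw [moyal_C_left_coeff, coeff_yStar]
  simp_rw [bidiff_yFun_left hg, smul_smul]
  refine Finset.sum_congr rfl fun q _ => ?_
  congr 1
  rw [neg_pow]
  ring

theorem isSmooth_yStar (τ : ℂ) {g : Plane → ℂ} (hg : IsYFun g) {f : Formal} (hf : IsSmooth f) :
    IsSmooth (yStar τ g f) := fun N => by
  rw [coeff_yStar]
  have h : ContDiff ℝ ∞ fun p => ∑ q ∈ Finset.HasAntidiagonal.antidiagonal N,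
      ((τ ^ q.1 / (q.1.factorial : ℂ)) •
      ((pd 0)^[q.1] (PowerSeries.coeff q.2 f) * (pd 1)^[q.1] g)) p :=
    ContDiff.sum fun q _ => ((contDiff_iterate_pd 0 (hf q.2) q.1).mul (hg.iterate q.1).1).const_smul
      (τ ^ q.1 / (q.1.factorial : ℂ))
  refine (congrArg (ContDiff ℝ ∞) ?_).mp h
  funext p
  simp

theorem constantCoeff_yStar (τ : ℂ) (g : Plane → ℂ) (f : Formal) :
    PowerSeries.coeff 0 (yStar τ g f) = PowerSeries.coeff 0 f * g := by
  simp [coeff_yStar]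

theorem yStar_const_smul (τ c : ℂ) (g : Plane → ℂ) (f : Formal) :
    yStar τ g (c • f) = c • yStar τ g f := by
  ext1 N
  simp only [coeff_yStar, coeff_const_smul, iterate_pd_const_smul, Finset.smul_sum, smul_mul_assoc]
  exact Finset.sum_congr rfl fun q _ => smul_comm _ _ _

theorem yStar_const_smul_left (τ c : ℂ) (g : Plane → ℂ) (f : Formal) :
    yStar τ (c • g) f = c • yStar τ g f := by
  ext1 N
  simp only [coeff_yStar, coeff_const_smul, iterate_pd_const_smul, Finset.smul_sum, mul_smul_comm]
  exact Finset.sum_congr rfl fun q _ => smul_comm _ _ _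

theorem yStar_add (τ : ℂ) (g : Plane → ℂ) {f f' : Formal} (hf : IsSmooth f) (hf' : IsSmooth f') :
    yStar τ g (f + f') = yStar τ g f + yStar τ g f' := by
  ext1 N
  simp only [coeff_yStar, map_add, ← Finset.sum_add_distrib]
  refine Finset.sum_congr rfl fun q _ => ?_
  rw [iterate_pd_add 0 (hf _) (hf' _), add_mul, smul_add]

theorem yStar_X_mul (τ : ℂ) (g : Plane → ℂ) (f : Formal) :
    yStar τ g (PowerSeries.X * f) = PowerSeries.X * yStar τ g f := by
  ext1 N
  cases N with
  | zero => simp [coeff_yStar]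
  | succ N =>
    rw [PowerSeries.coeff_succ_X_mul, coeff_yStar, Finset.Nat.sum_antidiagonal_succ', coeff_yStar]
    simp [PowerSeries.coeff_succ_X_mul, iterate_pd_zero]

theorem factorial_succ_weight (τ : ℂ) (r : ℕ) :
    τ ^ (r + 1) / ((r + 1).factorial : ℂ) * ((r : ℂ) + 1) = τ * (τ ^ r / (r.factorial : ℂ)) := by
  have h1 : (r.factorial : ℂ) ≠ 0 := by exact_mod_cast r.factorial_ne_zero
  have h2 : ((r : ℂ) + 1) ≠ 0 := by exact_mod_cast r.succ_ne_zero
  rw [Nat.factorial_succ]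
  push_cast
  field_simp
  ring

/-- Differentiating the kernel exp(τθ ∂₁⊗∂₂) in θ brings down τ ∂₁⊗∂₂; the other term is the
derivative of the argument. -/
theorem dθ_yStar (τ : ℂ) (g : Plane → ℂ) (f : Formal) :
    dθ (yStar τ g f) = yStar τ g (dθ f) + τ • yStar τ (pd 1 g) (fpd 0 f) := by
  ext1 N
  -- The weight N + 1 is split as (order of the kernel) + (order of `f`); the two parts become the
  -- two terms of the product rule.
  have h : ((N : ℂ) + 1) • PowerSeries.coeff (N + 1) (yStar τ g f)
      = ∑ q ∈ Finset.HasAntidiagonal.antidiagonal (N + 1), (q.1 : ℂ) •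
          ((τ ^ q.1 / (q.1.factorial : ℂ)) •
            ((pd 0)^[q.1] (PowerSeries.coeff q.2 f) * (pd 1)^[q.1] g))
        + ∑ q ∈ Finset.HasAntidiagonal.antidiagonal (N + 1), (q.2 : ℂ) •
          ((τ ^ q.1 / (q.1.factorial : ℂ)) •
            ((pd 0)^[q.1] (PowerSeries.coeff q.2 f) * (pd 1)^[q.1] g)) := by
    rw [coeff_yStar, Finset.smul_sum, ← Finset.sum_add_distrib]
    refine Finset.sum_congr rfl fun q hq => ?_
    rw [Finset.HasAntidiagonal.mem_antidiagonal] at hq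
    rw [← add_smul]
    congr 1
    exact_mod_cast hq.symm
  rw [coeff_dθ, h, Finset.Nat.sum_antidiagonal_succ, Finset.Nat.sum_antidiagonal_succ', map_add,
    coeff_const_smul, coeff_yStar, coeff_yStar, add_comm, Finset.smul_sum]
  congr 1
  · simp only [Nat.cast_zero, zero_smul, zero_add, coeff_dθ, iterate_pd_const_smul, smul_mul_assoc]
    refine Finset.sum_congr rfl fun q _ => ?_
    rw [smul_comm]
    push_cast
    rfl
  · simp only [Nat.cast_zero, zero_smul, zero_add, coeff_fpd]
    refine Finset.sum_congr rfl fun q _ => ?_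
    rw [smul_smul, smul_smul, ← factorial_succ_weight, mul_comm]
    push_cast
    rfl

theorem fpd_zero_yStar (τ : ℂ) {g : Plane → ℂ} (hg : IsYFun g) {f : Formal} (hf : IsSmooth f) :
    fpd 0 (yStar τ g f) = yStar τ g (fpd 0 f) := by
  ext1 N
  rw [coeff_fpd, coeff_yStar, coeff_yStar, pd_sum]
  · refine Finset.sum_congr rfl fun q _ => ?_
    rw [pd_const_smul, pd_mul, (hg.iterate q.1).2, mul_zero, add_zero, iterate_pd_comm (hf _),
      coeff_fpd]
    · exact differentiable_of_contDiff (contDiff_iterate_pd 0 (hf _) _)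
    · exact differentiable_of_contDiff (hg.iterate _).1
  · exact fun q _ => ((differentiable_of_contDiff (contDiff_iterate_pd 0 (hf _) _)).mul
      (differentiable_of_contDiff (hg.iterate _).1)).const_smul _

theorem fpd_one_yStar (τ : ℂ) {g : Plane → ℂ} (hg : IsYFun g) {f : Formal} (hf : IsSmooth f) :
    fpd 1 (yStar τ g f) = yStar τ (pd 1 g) f + yStar τ g (fpd 1 f) := by
  ext1 N
  rw [coeff_fpd, map_add, coeff_yStar, coeff_yStar, coeff_yStar, pd_sum, ← Finset.sum_add_distrib]
  · refine Finset.sum_congr rfl fun q _ => ?_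
    rw [pd_const_smul, pd_mul, iterate_pd_comm (hf _), iterate_pd_comm hg.1,
      coeff_fpd, ← smul_add, add_comm]
    · exact differentiable_of_contDiff (contDiff_iterate_pd 0 (hf _) _)
    · exact differentiable_of_contDiff (hg.iterate _).1
  · exact fun q _ => ((differentiable_of_contDiff (contDiff_iterate_pd 0 (hf _) _)).mul
      (differentiable_of_contDiff (hg.iterate _).1)).const_smul _

/-- Moving σ¹ through exp(τθ ∂₁⊗∂₂) produces the commutator τθ ∂₂, acting on `g`. -/
theorem yStar_coordX_mul (τ : ℂ) (g : Plane → ℂ) {f : Formal} (hf : IsSmooth f) :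
    yStar τ g (PowerSeries.C coordX * f)
      = PowerSeries.C coordX * yStar τ g f + τ • (PowerSeries.X * yStar τ (pd 1 g) f) := by
  ext1 N
  cases N with
  | zero =>
    rw [map_add, coeff_const_smul, PowerSeries.coeff_zero_X_mul, PowerSeries.coeff_C_mul]
    simp [constantCoeff_yStar, -PowerSeries.coeff_zero_eq_constantCoeff, mul_assoc]
  | succ N =>
    rw [map_add, coeff_const_smul, PowerSeries.coeff_succ_X_mul, PowerSeries.coeff_C_mul,
      coeff_yStar, coeff_yStar, coeff_yStar, Finset.Nat.sum_antidiagonal_succ,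
      Finset.Nat.sum_antidiagonal_succ, mul_add, Finset.mul_sum, Finset.smul_sum, add_assoc,
      ← Finset.sum_add_distrib]
    congr 1
    · simp [mul_assoc]
    · refine Finset.sum_congr rfl fun q _ => ?_
      rw [PowerSeries.coeff_C_mul, iterate_pd_coordX_mul (hf _), add_mul, smul_add, smul_smul,
        smul_mul_assoc, smul_smul, factorial_succ_weight, mul_smul_comm, mul_assoc]
      rfl

theorem yStar_of_fpd_zero_eq_zero (τ : ℂ) (g : Plane → ℂ) {f : Formal} (hf : fpd 0 f = 0) :
    yStar τ g f = PowerSeries.C g * f := by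
  have h : ∀ i, pd 0 (PowerSeries.coeff i f) = 0 := fun i => by
    simpa using congrArg (PowerSeries.coeff i) hf
  ext1 N
  rw [coeff_yStar, Finset.sum_eq_single (0, N), PowerSeries.coeff_C_mul]
  · simp [mul_comm]
  · rintro ⟨a, b⟩ hab hne
    rw [Finset.HasAntidiagonal.mem_antidiagonal] at hab
    cases a with
    | zero => simp at hab; simp [hab] at hne
    | succ a => simp [h, iterate_pd_zero]
  · simp

end NCTorus

namespace NCTorus

/-! ### The evolution equation in `θ` -/

/-- The formal evolution equation
`(n - m θ) ∂_θ f = m σ^1 ∂_1 f + κ f + i π n ∂_1 ∂_2 f + c ∂_1 f`. For `c = 0` it is the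
Seiberg-Witten equation in the background `A^θ`, with `κ = 2m` in the fundamental and `κ = 0` in
the adjoint. -/
def SWEq (n : ℕ) (m : ℤ) (κ c : ℂ) (f : Formal) : Prop :=
  (n : ℂ) • dθ f = (m : ℂ) • (PowerSeries.X * dθ f) +
    (m : ℂ) • (PowerSeries.C coordX * fpd 0 f) + κ • f +
    (Complex.I * Real.pi * n) • fpd 0 (fpd 1 f) + c • fpd 0 f

variable {n : ℕ} {m : ℤ}

theorem coeff_X_mul_dθ (f : Formal) (N : ℕ) :
    PowerSeries.coeff N (PowerSeries.X * dθ f) = (N : ℂ) • PowerSeries.coeff N f := by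
  cases N with
  | zero => simp
  | succ N => rw [PowerSeries.coeff_succ_X_mul, coeff_dθ]; push_cast; rfl

theorem swEq_iff (κ c : ℂ) (f : Formal) : SWEq n m κ c f ↔ ∀ N : ℕ,
    ((n : ℂ) * (N + 1)) • PowerSeries.coeff (N + 1) f =
      ((m : ℂ) * N) • PowerSeries.coeff N f +
        (m : ℂ) • (coordX * pd 0 (PowerSeries.coeff N f)) + κ • PowerSeries.coeff N f +
        (Complex.I * Real.pi * n) • pd 0 (pd 1 (PowerSeries.coeff N f)) +
        c • pd 0 (PowerSeries.coeff N f) := by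
  rw [SWEq, PowerSeries.ext_iff]
  refine forall_congr' fun N => ?_
  simp only [map_add, coeff_const_smul, coeff_dθ, coeff_X_mul_dθ, PowerSeries.coeff_C_mul,
    coeff_fpd, smul_smul]

theorem SWEq.unique (hn : 0 < n) {κ c : ℂ} {f g : Formal} (hf : SWEq n m κ c f)
    (hg : SWEq n m κ c g) (h : PowerSeries.coeff 0 f = PowerSeries.coeff 0 g) : f = g := by
  rw [swEq_iff] at hf hg
  ext1 N
  induction N with
  | zero => exact h
  | succ N ih =>
    have h1 := hf N
    rw [ih, ← hg N] at h1
    have h2 : (n : ℂ) * ((N : ℂ) + 1) ≠ 0 :=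
      mul_ne_zero (by exact_mod_cast hn.ne') (by exact_mod_cast N.succ_ne_zero)
    exact smul_right_injective _ h2 h1

/-- The coefficients of the solution of `SWEq` with given value at `θ = 0`. -/
def evolve (n : ℕ) (m : ℤ) (κ c : ℂ) (f : Plane → ℂ) : ℕ → Plane → ℂ
  | 0 => f
  | N + 1 => ((n : ℂ) * (N + 1))⁻¹ • (((m : ℂ) * N) • evolve n m κ c f N +
        (m : ℂ) • (coordX * pd 0 (evolve n m κ c f N)) + κ • evolve n m κ c f N +
        (Complex.I * Real.pi * n) • pd 0 (pd 1 (evolve n m κ c f N)) +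
        c • pd 0 (evolve n m κ c f N))

theorem exists_swEq (hn : 0 < n) (κ c : ℂ) {f : Plane → ℂ} (hf : ContDiff ℝ ∞ f) :
    ∃ F : Formal, IsSmooth F ∧ PowerSeries.coeff 0 F = f ∧ SWEq n m κ c F := by
  refine ⟨PowerSeries.mk (evolve n m κ c f), fun N => ?_, ?_, ?_⟩
  · rw [PowerSeries.coeff_mk]
    induction N with
    | zero => exact hf
    | succ N ih =>
      have h0 := pd_contDiff 0 ih
      have h01 := pd_contDiff 0 (pd_contDiff 1 ih)
      have hx := contDiff_coordX.mul h0
      exact (((((ih.const_smul ((m : ℂ) * N)).add (hx.const_smul (m : ℂ))).add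
        (ih.const_smul κ)).add (h01.const_smul (Complex.I * Real.pi * n))).add
        (h0.const_smul c)).const_smul ((n : ℂ) * (N + 1))⁻¹
  · rw [PowerSeries.coeff_mk]; rfl
  · rw [swEq_iff]
    intro N
    have h2 : (n : ℂ) * ((N : ℂ) + 1) ≠ 0 :=
      mul_ne_zero (by exact_mod_cast hn.ne') (by exact_mod_cast N.succ_ne_zero)
    simp only [PowerSeries.coeff_mk]
    conv_lhs => rw [evolve]
    rw [smul_inv_smul₀ h2]

theorem SWEq.sum {κ c : ℂ} {ι : Type*} {s : Finset ι} {f : ι → Formal}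
    (hs : ∀ i ∈ s, IsSmooth (f i)) (hf : ∀ i ∈ s, SWEq n m κ c (f i)) :
    SWEq n m κ c (∑ i ∈ s, f i) := by
  rw [SWEq, dθ_sum, fpd_sum 0 s hs, fpd_sum 1 s hs, fpd_sum 0 s fun i hi => (hs i hi).fpd 1]
  simp only [Finset.mul_sum, Finset.smul_sum, ← Finset.sum_add_distrib]
  exact Finset.sum_congr rfl hf

/-- Apply `yStar τ g` to the equation for `f`. Three corrections arise: τ from the θ-derivative of
the kernel (its θ-multiple cancels the commutator of the kernel with σ¹), and -iπ from the term of
∂₁∂₂ in which ∂₂ hits `g`. What remains is the last summand, proportional to τ - iπ. -/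
theorem SWEq.yStar {κ c : ℂ} {f : Formal} (hf : SWEq n m κ c f) (hs : IsSmooth f) (τ : ℂ)
    {g : Plane → ℂ} (hg : IsYFun g) :
    (n : ℂ) • dθ (yStar τ g f) = (m : ℂ) • (PowerSeries.X * dθ (yStar τ g f)) +
    (m : ℂ) • (PowerSeries.C coordX * fpd 0 (yStar τ g f)) + κ • yStar τ g f +
    (Complex.I * Real.pi * n) • fpd 0 (fpd 1 (yStar τ g f)) + c • fpd 0 (yStar τ g f)
    + (n * (τ - Complex.I * Real.pi)) • yStar τ (pd 1 g) (fpd 0 f) := by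
  have hX : IsSmooth (PowerSeries.C coordX * fpd 0 f) :=
    (isSmooth_C contDiff_coordX).mul (hs.fpd 0)
  have hXd : IsSmooth (PowerSeries.X * dθ f) := isSmooth_X.mul hs.dθ
  have h := congrArg (NCTorus.yStar τ g) hf
  rw [yStar_add, yStar_add, yStar_add, yStar_add] at h
  · simp only [yStar_const_smul] at h
    rw [yStar_X_mul, yStar_coordX_mul _ _ (hs.fpd 0)] at h
    rw [dθ_yStar, fpd_one_yStar τ hg hs, fpd_zero_yStar τ hg hs, fpd_add,
      fpd_zero_yStar τ hg (hs.fpd 1), fpd_zero_yStar τ hg.pd_one hs, smul_add, h]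
    · rw [fpd_comm 0 1 hs]
      simp only [Algebra.smul_def, map_mul, map_sub]
      ring
    · exact isSmooth_yStar τ hg.pd_one hs
    · exact isSmooth_yStar τ hg (hs.fpd 1)
  · exact hXd.const_smul _
  · exact hX.const_smul _
  · exact (hXd.const_smul _).add (hX.const_smul _)
  · exact hs.const_smul _
  · exact ((hXd.const_smul _).add (hX.const_smul _)).add (hs.const_smul _)
  · exact ((hs.fpd 1).fpd 0).const_smul _
  · exact (((hXd.const_smul _).add (hX.const_smul _)).add (hs.const_smul _)).add
      (((hs.fpd 1).fpd 0).const_smul _)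
  · exact (hs.fpd 0).const_smul _

/-- Right ⋆-multiplication is the case τ = iπ, where the error term vanishes. This is the role of
the coefficient iπn in the equation. -/
theorem SWEq.moyal_yFun_right {κ c : ℂ} {f : Formal} (hf : SWEq n m κ c f) (hs : IsSmooth f)
    {g : Plane → ℂ} (hg : IsYFun g) : SWEq n m κ c (moyal f (PowerSeries.C g)) := by
  have h := hf.yStar hs (Complex.I * Real.pi) hg
  rwa [sub_self, mul_zero, zero_smul, add_zero, ← NCTorus.moyal_yFun_right hg] at h

/-- For τ = -iπ the error term remains; when `g` is an eigenfunction of ∂₂ it becomes a multiple of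
∂₁ of the product, that is, a drift. -/
theorem SWEq.moyal_yFun_left {κ c γ : ℂ} {f : Formal} (hf : SWEq n m κ c f) (hs : IsSmooth f)
    {g : Plane → ℂ} (hg : IsYFun g) (hγ : pd 1 g = (Complex.I * γ) • g) :
    SWEq n m κ (c + 2 * Real.pi * n * γ) (moyal (PowerSeries.C g) f) := by
  have h := hf.yStar hs (-(Complex.I * Real.pi)) hg
  rw [hγ, yStar_const_smul_left, ← fpd_zero_yStar _ hg hs, add_assoc, smul_smul, ← add_smul,
    ← NCTorus.moyal_yFun_left hg] at h
  rw [SWEq, h]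
  congr 2
  -- The drift constant is n(-2πi)(iγ) = 2πnγ.
  linear_combination (-2 * n * Real.pi * γ) * Complex.I_sq

/-- Only the coefficient σ¹ is not translation invariant; replacing it by σ¹ + 2π creates the drift
2πm ∂₁. -/
theorem SWEq.shift {κ : ℂ} {f : Formal} (hf : SWEq n m κ 0 f) (α : Fin 2) :
    SWEq n m κ (if α = 0 then 2 * Real.pi * m else 0) (shift α f) := by
  rw [swEq_iff] at hf ⊢
  intro N
  funext p
  have h := congrFun (hf N) (translate α p)
  simp only [coeff_shift, pd_translate, Pi.add_apply, Pi.smul_apply, Pi.mul_apply,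
    smul_eq_mul, coordX, translate_apply] at h ⊢
  rw [h]
  fin_cases α
  · simp
    ring
  · simp

/-! ### The background `A^θ` -/

theorem invNM_eq_scalarSeries : invNM n m = scalarSeries
    (PowerSeries.C (n : ℂ) - PowerSeries.C (m : ℂ) * PowerSeries.X)⁻¹ := rfl

theorem isSmooth_invNM : IsSmooth (invNM n m) := by
  rw [invNM_eq_scalarSeries]; exact isSmooth_scalarSeries _

theorem fpd_invNM (μ : Fin 2) : fpd μ (invNM n m) = 0 := by
  rw [invNM_eq_scalarSeries]; exact fpd_scalarSeries μ _

theorem invNM_spec (hn : 0 < n) :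
    (n : ℂ) • invNM n m - (m : ℂ) • (PowerSeries.X * invNM n m) = 1 := by
  set u : PowerSeries ℂ := PowerSeries.C (n : ℂ) - PowerSeries.C (m : ℂ) * PowerSeries.X with hu
  have h0 : PowerSeries.constantCoeff u ≠ 0 := by
    simp [hu, hn.ne']
  have h1 : u * u⁻¹ = 1 := PowerSeries.mul_inv_cancel u h0
  have h2 := congrArg (PowerSeries.map (algebraMap ℂ (Plane → ℂ))) h1
  rw [map_mul, map_one] at h2
  have h3 : PowerSeries.map (algebraMap ℂ (Plane → ℂ)) u =
      PowerSeries.C (fun _ => (n : ℂ)) - PowerSeries.C (fun _ => (m : ℂ)) * PowerSeries.X := by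
    rw [hu, map_sub, map_mul, PowerSeries.map_C, PowerSeries.map_C, PowerSeries.map_X]
    rfl
  rw [h3, sub_mul, mul_assoc, C_const_mul, C_const_mul] at h2
  exact h2

/-- The nonzero diagonal entry of `A^θ_2`. -/
def aθ (n : ℕ) (m : ℤ) : Formal :=
  PowerSeries.C (fun p : Plane => (m : ℂ) * (p 0 : ℂ) / (2 * (Real.pi : ℂ))) * invNM n m

/-- The constant `m / 2π`. -/
def slope (m : ℤ) : ℂ := (m : ℂ) / (2 * Real.pi)

theorem two_pi_mul_slope (m : ℤ) : 2 * (Real.pi : ℂ) * slope m = m := by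
  have h : (Real.pi : ℂ) ≠ 0 := by exact_mod_cast Real.pi_ne_zero
  rw [slope]
  field_simp

theorem aθ_eq : aθ n m = slope m • (PowerSeries.C coordX * invNM n m) := by
  rw [aθ, ← C_const_mul, ← mul_assoc, ← map_mul]
  congr 2
  funext p
  simp only [slope, coordX, Pi.mul_apply]
  ring

theorem isSmooth_aθ : IsSmooth (aθ n m) := by
  rw [aθ_eq]
  exact ((isSmooth_C contDiff_coordX).mul isSmooth_invNM).const_smul _

theorem fpd_zero_aθ : fpd 0 (aθ n m) = slope m • invNM n m := by
  rw [aθ_eq, fpd_const_smul, fpd_mul 0 (isSmooth_C contDiff_coordX) isSmooth_invNM, fpd_C,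
    pd_zero_coordX, fpd_invNM]
  simp

theorem fpd_one_aθ : fpd 1 (aθ n m) = 0 := by
  rw [aθ_eq, fpd_const_smul, fpd_mul 1 (isSmooth_C contDiff_coordX) isSmooth_invNM, fpd_C,
    pd_one_coordX, fpd_invNM]
  simp

theorem isAffine_aθ : IsAffine (aθ n m) :=
  ⟨fpd_one_aθ, by rw [fpd_zero_aθ, fpd_const_smul, fpd_invNM, smul_zero],
    by rw [fpd_zero_aθ, fpd_const_smul, fpd_invNM, smul_zero]⟩

theorem Aθ_zero : Aθ n m 0 = 0 := rfl

theorem Aθ_one : Aθ n m 1 = Matrix.diagonal fun _ => aθ n m := rfl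

theorem vstar_zero_left (φ : Vec n) : vstar 0 φ = 0 := by
  funext k
  simp [vstar, moyal_zero_left]

theorem mstar_zero_left (P : Mat n) : mstar 0 P = 0 := by
  ext1 k l
  simp [mstar, moyal_zero_left]

theorem mstar_zero_right (P : Mat n) : mstar P 0 = 0 := by
  ext1 k l
  simp [mstar, moyal_zero_right]

theorem vstar_diagonal (a : Formal) (φ : Vec n) :
    vstar (Matrix.diagonal fun _ => a) φ = fun k => moyal a (φ k) := by
  funext k
  rw [vstar, Finset.sum_eq_single k]
  · simp
  · intro l _ hl
    rw [Matrix.diagonal_apply_ne _ hl.symm, moyal_zero_left]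
  · simp

theorem mstar_diagonal_left (a : Formal) (P : Mat n) :
    mstar (Matrix.diagonal fun _ => a) P = P.map (moyal a) := by
  ext1 k l
  rw [mstar, Matrix.of_apply, Finset.sum_eq_single k]
  · simp
  · intro j _ hj
    rw [Matrix.diagonal_apply_ne _ hj.symm, moyal_zero_left]
  · simp

theorem mstar_diagonal_right (a : Formal) (P : Mat n) :
    mstar P (Matrix.diagonal fun _ => a) = P.map fun f => moyal f a := by
  ext1 k l
  rw [mstar, Matrix.of_apply, Finset.sum_eq_single l]
  · simp
  · intro j _ hj
    rw [Matrix.diagonal_apply_ne _ hj, moyal_zero_right]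
  · simp

theorem map_diagonal_fpd (a : Formal) (μ : Fin 2) :
    (Matrix.diagonal fun _ => a : Mat n).map (fpd μ) = Matrix.diagonal fun _ => fpd μ a := by
  rw [Matrix.diagonal_map (fpd_zero μ)]

theorem map_zero_fpd (μ : Fin 2) : (0 : Mat n).map (fpd μ) = 0 := by
  ext1 k l
  simp [fpd_zero]

theorem fieldStrength_self (A : Fin 2 → Mat n) (μ : Fin 2) : fieldStrength A μ μ = 0 := by
  simp [fieldStrength]

theorem fieldStrength_Aθ :
    fieldStrength (Aθ n m) 0 1 = Matrix.diagonal fun _ => slope m • invNM n m := by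
  rw [fieldStrength, Aθ_zero, Aθ_one, mstar_zero_left, mstar_zero_right, map_zero_fpd,
    map_diagonal_fpd, fpd_zero_aθ]
  simp

theorem covF_Aθ_zero (φ : Vec n) : covF (Aθ n m) 0 φ = fun k => fpd 0 (φ k) := by
  rw [covF, Aθ_zero, vstar_zero_left]
  simp

theorem covF_Aθ_one (φ : Vec n) :
    covF (Aθ n m) 1 φ = fun k => fpd 1 (φ k) - Complex.I • moyal (aθ n m) (φ k) := by
  rw [covF, Aθ_one, vstar_diagonal]
  rfl

theorem comm_zero_left (P : Mat n) : comm 0 P = 0 := by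
  rw [comm, mstar_zero_left, mstar_zero_right, sub_zero]

theorem covA_Aθ_zero (P : Mat n) : covA (Aθ n m) 0 P = P.map (fpd 0) := by
  rw [covA, Aθ_zero, comm_zero_left]
  simp

theorem moyal_aθ_left (f : Formal) : moyal (aθ n m) f =
    slope m • (PowerSeries.C coordX * invNM n m * f) + (Complex.I * Real.pi * slope m) •
      (PowerSeries.X * (invNM n m * fpd 1 f)) := by
  rw [isAffine_aθ.moyal_left, fpd_zero_aθ, aθ_eq]
  simp only [Algebra.smul_def, map_mul]
  ring

theorem moyal_aθ_right (f : Formal) : moyal f (aθ n m) =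
    slope m • (PowerSeries.C coordX * invNM n m * f) - (Complex.I * Real.pi * slope m) •
      (PowerSeries.X * (invNM n m * fpd 1 f)) := by
  rw [isAffine_aθ.moyal_right, fpd_zero_aθ, aθ_eq]
  simp only [Algebra.smul_def, map_mul]
  ring

/-- The pointwise parts of the commutator cancel and its first-order part contributes mθν ∂₂. Since
1 + mθν = nν, the total is nν ∂₂. -/
theorem covA_Aθ_one (hn : 0 < n) (P : Mat n) :
    covA (Aθ n m) 1 P = P.map fun f => (n : ℂ) • (invNM n m * fpd 1 f) := by
  ext1 k l
  have hν := invNM_spec (m := m) hn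
  have hI : algebraMap ℂ Formal Complex.I * algebraMap ℂ Formal Complex.I = -1 := by
    rw [← map_mul, Complex.I_mul_I, map_neg, map_one]
  have hm : algebraMap ℂ Formal m = 2 * algebraMap ℂ Formal Real.pi * algebraMap ℂ Formal (slope m) := by
    rw [← two_pi_mul_slope]; simp only [map_mul, map_ofNat]
  rw [covA, comm, Aθ_one, mstar_diagonal_left, mstar_diagonal_right]
  simp only [Matrix.sub_apply, Matrix.smul_apply, Matrix.map_apply, moyal_aθ_left, moyal_aθ_right]
  simp only [Algebra.smul_def, map_mul, hm] at hν ⊢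
  linear_combination (- fpd 1 (P k l)) * hν
    - 2 * algebraMap ℂ Formal Real.pi * algebraMap ℂ Formal (slope m) * PowerSeries.X * invNM n m *
      fpd 1 (P k l) * hI

theorem fpd_zero_moyal_aθ_left {f : Formal} (hf : IsSmooth f) : fpd 0 (moyal (aθ n m) f) =
    slope m • (invNM n m * f + PowerSeries.C coordX * invNM n m * fpd 0 f) +
      (Complex.I * Real.pi * slope m) • (PowerSeries.X * (invNM n m * fpd 0 (fpd 1 f))) := by
  have hx := isSmooth_C contDiff_coordX
  have hν := isSmooth_invNM (n := n) (m := m)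
  have hxν : IsSmooth (PowerSeries.C coordX * invNM n m) := hx.mul hν
  have h1 : IsSmooth (invNM n m * fpd 1 f) := hν.mul (hf.fpd 1)
  rw [moyal_aθ_left, fpd_add 0 ((hxν.mul hf).const_smul _) ((isSmooth_X.mul h1).const_smul _),
    fpd_const_smul, fpd_const_smul, fpd_mul 0 hxν hf, fpd_mul 0 hx hν, fpd_mul 0 isSmooth_X h1,
    fpd_mul 0 hν (hf.fpd 1), fpd_C, pd_zero_coordX, fpd_invNM, fpd_X]
  simp

end NCTorus

namespace NCTorus

variable {n : ℕ} {m : ℤ}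

/-! ### The Seiberg-Witten equations in the background `A^θ` -/

/-- The factor n - mθ is invertible with inverse ν, so multiplying the equation by it loses nothing.
-/
theorem eq_iff_swEq (hn : 0 < n) {κ : ℂ} {f R : Formal}
    (hR : (n : ℂ) • R = (m : ℂ) • (PowerSeries.X * R) +
      (m : ℂ) • (PowerSeries.C coordX * fpd 0 f) + κ • f +
      (Complex.I * Real.pi * n) • fpd 0 (fpd 1 f)) :
    dθ f = R ↔ SWEq n m κ 0 f := by
  have hν := invNM_spec (m := m) hn
  rw [SWEq, zero_smul, add_zero]
  constructor
  · rintro h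
    rw [h, hR]
  · intro h
    simp only [Algebra.smul_def] at hν hR h
    linear_combination (R - dθ f) * hν + invNM n m * h - invNM n m * hR

/-- Only the index pair (2,1) of the transport term survives since A₁ = 0, and the ambiguity
contributes -3F - iD₁D₂. The first-order Moyal corrections combine with ∂₁∂₂, and the constants with
-3F, leaving κ = 2m. -/
theorem isSWFund_iff (hn : 0 < n) (φ : Fin n → Plane → ℂ) (φh : Vec n) :
    IsSWFund (Aθ n m) φ φh ↔ (∀ k, IsSmooth (φh k)) ∧
      (∀ k, PowerSeries.coeff 0 (φh k) = φ k) ∧ ∀ k, SWEq n m (2 * m) 0 (φh k) := by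
  rw [IsSWFund]
  refine and_congr_right fun hs => and_congr (by simp) ?_
  rw [funext_iff]
  refine forall_congr' fun k => ?_
  have hν := invNM_spec (m := m) hn
  have hI : algebraMap ℂ Formal Complex.I * algebraMap ℂ Formal Complex.I = -1 := by
    rw [← map_mul, Complex.I_mul_I, map_neg, map_one]
  -- In the ring of formal series m, π, π/2 and m/2π are unrelated atoms; `hm` and `hp` express the
  -- first two through the others so that the final identity is polynomial.
  have hm : algebraMap ℂ Formal m
      = 2 * algebraMap ℂ Formal Real.pi * algebraMap ℂ Formal (slope m) := by
    rw [← two_pi_mul_slope]; simp only [map_mul, map_ofNat]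
  have hp : algebraMap ℂ Formal Real.pi = 2 * algebraMap ℂ Formal (Real.pi / 2) := by
    rw [← map_ofNat (algebraMap ℂ Formal) 2, ← map_mul]; congr 1; ring
  refine eq_iff_swEq hn ?_
  simp only [Fin.sum_univ_two, eps, ambF, Matrix.of_apply, Matrix.cons_val', Matrix.cons_val_zero,
    Matrix.cons_val_one, Matrix.cons_val_fin_one, zero_smul, add_zero, zero_add, one_smul,
    covF_Aθ_zero, covF_Aθ_one, Aθ_zero, vstar_zero_left, Aθ_one, vstar_diagonal, fieldStrength_Aθ,
    Pi.add_apply, Pi.smul_apply, Pi.neg_apply, Pi.sub_apply, neg_smul]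
  have hsm : IsSmooth (moyal (aθ n m) (φh k)) := by
    rw [moyal_aθ_left]
    exact ((((isSmooth_C contDiff_coordX).mul isSmooth_invNM).mul (hs k)).const_smul _).add
      ((isSmooth_X.mul (isSmooth_invNM.mul ((hs k).fpd 1))).const_smul _)
  have hc : ∀ μ, fpd μ (slope m • invNM n m) = 0 := fun μ => by
    rw [fpd_const_smul, fpd_invNM, smul_zero]
  rw [fpd_sub 0 ((hs k).fpd 1) (hsm.const_smul _), fpd_const_smul, fpd_zero_moyal_aθ_left (hs k),
    moyal_of_fpd_eq_zero_left hc, moyal_aθ_left, fpd_comm 1 0 (hs k)]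
  simp only [Algebra.smul_def, map_mul, map_ofNat, hm, hp] at hν ⊢
  generalize fpd 0 (fpd 1 (φh k)) = fxy
  generalize fpd 0 (φh k) = fx
  generalize φh k = f at *
  generalize algebraMap ℂ Formal (Real.pi / 2) = h at *
  generalize algebraMap ℂ Formal (slope m) = s at *
  generalize algebraMap ℂ Formal Complex.I = J at *
  generalize algebraMap ℂ Formal n = c at *
  generalize invNM n m = ν at *
  generalize (PowerSeries.C coordX : Formal) = x at *
  generalize (PowerSeries.X : Formal) = t at *
  linear_combination (2 * (2 * h) * s * (x * fx + 2 * f + J * (2 * h) * t * fxy)) * hν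
    - (c - 2 * (2 * h) * s * t) * (2 * h) * (s * (ν * f + x * ν * fx)
      + J * (2 * h) * s * (t * (ν * fxy))) * hI

theorem anticomm_zero_left (P : Mat n) : anticomm 0 P = 0 := by
  rw [anticomm, mstar_zero_left, mstar_zero_right, add_zero]

/-- The field strength is a constant multiple of the identity, hence ⋆-central. This is why κ is 0
in the adjoint. -/
theorem comm_fieldStrength_Aθ (Ψ : Mat n) : comm (fieldStrength (Aθ n m) 0 1) Ψ = 0 := by
  have hc : ∀ μ, fpd μ (slope m • invNM n m) = 0 := fun μ => by
    rw [fpd_const_smul, fpd_invNM, smul_zero]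
  ext1 k l
  rw [comm, fieldStrength_Aθ, mstar_diagonal_left, mstar_diagonal_right]
  simp only [Matrix.sub_apply, Matrix.map_apply, Matrix.zero_apply]
  rw [moyal_of_fpd_eq_zero_left hc, moyal_of_fpd_eq_zero_right hc, mul_comm, sub_self]

/-- With the curvature term gone and D₂ = nν ∂₂, the anticommutator gives the transport term and
-iD₁D₂ the term ∂₁∂₂; nothing of order zero is left. -/
theorem isSWAdj_iff (hn : 0 < n) (Ψ : Plane → Matrix (Fin n) (Fin n) ℂ) (Ψh : Mat n) :
    IsSWAdj (Aθ n m) Ψ Ψh ↔ (∀ k l, IsSmooth (Ψh k l)) ∧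
      (∀ k l, PowerSeries.coeff 0 (Ψh k l) = fun p => Ψ p k l) ∧
      ∀ k l, SWEq n m 0 0 (Ψh k l) := by
  rw [IsSWAdj]
  refine and_congr_right fun hs => and_congr (by simp) ?_
  rw [← Matrix.ext_iff]
  refine forall_congr' fun k => forall_congr' fun l => ?_
  have hν := invNM_spec (m := m) hn
  have hm : algebraMap ℂ Formal m
      = 2 * algebraMap ℂ Formal Real.pi * algebraMap ℂ Formal (slope m) := by
    rw [← two_pi_mul_slope]; simp only [map_mul, map_ofNat]
  have hp : algebraMap ℂ Formal Real.pi = 2 * algebraMap ℂ Formal (Real.pi / 2) := by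
    rw [← map_ofNat (algebraMap ℂ Formal) 2, ← map_mul]; congr 1; ring
  rw [Matrix.map_apply]
  refine eq_iff_swEq hn ?_
  simp only [Fin.sum_univ_two, eps, ambA, Matrix.of_apply, Matrix.cons_val', Matrix.cons_val_zero,
    Matrix.cons_val_one, Matrix.cons_val_fin_one, zero_smul, add_zero, zero_add, one_smul,
    covA_Aθ_zero, covA_Aθ_one hn, comm_fieldStrength_Aθ, Aθ_zero, anticomm_zero_left]
  simp only [Aθ_one, anticomm, mstar_diagonal_left, mstar_diagonal_right, smul_zero, neg_zero,
    zero_sub, Matrix.add_apply, Matrix.smul_apply, Matrix.neg_apply, Matrix.map_apply, neg_smul,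
    one_smul, neg_neg]
  have hν' : IsSmooth (invNM n m * fpd 1 (Ψh k l)) := isSmooth_invNM.mul ((hs k l).fpd 1)
  rw [fpd_const_smul, fpd_mul 0 isSmooth_invNM ((hs k l).fpd 1), fpd_invNM, moyal_aθ_left,
    moyal_aθ_right, fpd_add 1 ((hs k l).fpd 0) ((hs k l).fpd 0), fpd_comm 1 0 (hs k l)]
  simp only [Algebra.smul_def, map_mul, hm, hp] at hν ⊢
  generalize fpd 0 (fpd 1 (Ψh k l)) = fxy
  generalize fpd 0 (Ψh k l) = fx
  generalize algebraMap ℂ Formal (Real.pi / 2) = h at *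
  generalize algebraMap ℂ Formal (slope m) = s at *
  generalize algebraMap ℂ Formal Complex.I = J at *
  generalize algebraMap ℂ Formal n = c at *
  generalize invNM n m = ν at *
  generalize (PowerSeries.C coordX : Formal) = x at *
  generalize (PowerSeries.X : Formal) = t at *
  linear_combination (4 * h * s * x * fx + 2 * h * J * c * fxy) * hν

theorem exists_unique_isSWFund (hn : 0 < n) {φ : Fin n → Plane → ℂ}
    (hφ : ∀ k, ContDiff ℝ ∞ (φ k)) : ∃! φh, IsSWFund (Aθ n m) φ φh := by
  choose F h1 h2 h3 using fun k => exists_swEq (m := m) hn (2 * m) 0 (hφ k)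
  refine ⟨F, (isSWFund_iff hn _ _).2 ⟨h1, h2, h3⟩, fun G hG => ?_⟩
  obtain ⟨-, g2, g3⟩ := (isSWFund_iff hn _ _).1 hG
  funext k
  exact (g3 k).unique hn (h3 k) ((g2 k).trans (h2 k).symm)

theorem isSWAdj_unique (hn : 0 < n) {Ψ : Plane → Matrix (Fin n) (Fin n) ℂ} {F G : Mat n}
    (hF : IsSWAdj (Aθ n m) Ψ F) (hG : IsSWAdj (Aθ n m) Ψ G) : F = G := by
  obtain ⟨-, f2, f3⟩ := (isSWAdj_iff hn _ _).1 hF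
  obtain ⟨-, g2, g3⟩ := (isSWAdj_iff hn _ _).1 hG
  ext1 k l
  exact (f3 k l).unique hn (g3 k l) ((f2 k l).trans (g2 k l).symm)

theorem exists_unique_isSWAdj (hn : 0 < n) {Ψ : Plane → Matrix (Fin n) (Fin n) ℂ}
    (hΨ : ∀ k l, ContDiff ℝ ∞ fun p => Ψ p k l) : ∃! Ψh, IsSWAdj (Aθ n m) Ψ Ψh := by
  choose F h1 h2 h3 using fun k l => exists_swEq (m := m) hn 0 0 (hΨ k l)
  have hF : IsSWAdj (Aθ n m) Ψ (Matrix.of F) := (isSWAdj_iff hn _ _).2 ⟨h1, h2, h3⟩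
  exact ⟨_, hF, fun G hG => isSWAdj_unique hn hG hF⟩

/-! ### Transition functions -/

/-- The function `u e^{i γ σ^2}`. -/
def yExp (γ : ℝ) (u : ℂ) : Plane → ℂ := fun p => u * Complex.exp (Complex.I * γ * (p 1 : ℂ))

theorem yExp_eq_comp (γ : ℝ) (u : ℂ) : yExp γ u =
    fun p => (fun t : ℝ => u * Complex.exp (Complex.I * γ * (t : ℂ))) (p 1) := rfl

theorem hasDerivAt_exp_line (γ : ℝ) (u : ℂ) (t : ℝ) :
    HasDerivAt (fun t : ℝ => u * Complex.exp (Complex.I * γ * (t : ℂ)))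
      ((Complex.I * γ) * (u * Complex.exp (Complex.I * γ * (t : ℂ)))) t := by
  have h : HasDerivAt (fun t : ℝ => (t : ℂ)) 1 t := Complex.ofRealCLM.hasDerivAt
  refine (((h.const_mul (Complex.I * γ)).cexp).const_mul u).congr_deriv ?_
  ring

theorem isYFun_comp_coord {G : ℝ → ℂ} (hG : ContDiff ℝ ∞ G) : IsYFun fun p => G (p 1) := by
  refine ⟨hG.comp (contDiff_apply ℝ ℝ (1 : Fin 2)), ?_⟩
  rw [pd_comp_coord 0 1 (hG.differentiable (by simp))]
  funext p
  simp

theorem isYFun_yExp (γ : ℝ) (u : ℂ) : IsYFun (yExp γ u) := by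
  refine isYFun_comp_coord (G := fun t : ℝ => u * Complex.exp (Complex.I * γ * (t : ℂ))) ?_
  have : ContDiff ℝ ∞ fun t : ℝ => (t : ℂ) := Complex.ofRealCLM.contDiff
  fun_prop

theorem pd_one_yExp (γ : ℝ) (u : ℂ) : pd 1 (yExp γ u) = (Complex.I * γ) • yExp γ u := by
  rw [yExp_eq_comp, pd_comp_coord 1 1 fun t => (hasDerivAt_exp_line γ u t).differentiableAt]
  funext p
  rw [if_pos rfl, (hasDerivAt_exp_line γ u (p 1)).deriv]
  rfl

theorem conj_yExp (γ : ℝ) (u : ℂ) :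
    starRingEnd (Plane → ℂ) (yExp γ u) = yExp (-γ) (starRingEnd ℂ u) := by
  funext p
  simp [yExp, ← Complex.exp_conj]

theorem yExp_mul (γ δ : ℝ) (u v : ℂ) : yExp γ u * yExp δ v = yExp (γ + δ) (u * v) := by
  funext p
  simp only [yExp, Pi.mul_apply, Complex.ofReal_add]
  rw [mul_add, add_mul, Complex.exp_add]
  ring

theorem yExp_zero_left (u : ℂ) : yExp 0 u = fun _ => u := by
  funext p
  simp [yExp]

/-- The frequencies in `σ^2` of the transition functions. -/
def freq (n : ℕ) (m : ℤ) : Fin 2 → ℝ := ![(m : ℝ) / n, 0]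

/-- The constant parts of the transition functions. -/
def Ωconst (n : ℕ) (m : ℤ) : Fin 2 → Matrix (Fin n) (Fin n) ℂ := ![clock n m, shiftMat n]

theorem Ωcl_eq_smul (α : Fin 2) (p : Plane) : Ωcl n m α p =
    Complex.exp (Complex.I * freq n m α * (p 1 : ℂ)) • Ωconst n m α := by
  fin_cases α
  · simp only [Ωcl, freq, Ωconst, Fin.zero_eta, Matrix.cons_val_zero]
    congr 2
    push_cast
    ring
  · simp [Ωcl, freq, Ωconst]

theorem Ωcl_entry (α : Fin 2) (k l : Fin n) :
    (fun p => Ωcl n m α p k l) = yExp (freq n m α) (Ωconst n m α k l) := by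
  funext p
  rw [Ωcl_eq_smul, Matrix.smul_apply, smul_eq_mul, yExp, mul_comm]

theorem Ωθ_entry (α : Fin 2) (k l : Fin n) :
    Ωθ n m α k l = PowerSeries.C (yExp (freq n m α) (Ωconst n m α k l)) := by
  rw [← Ωcl_entry]
  rfl

theorem dagger_Ωθ_entry (α : Fin 2) (k l : Fin n) : dagger (Ωθ n m α) k l =
    PowerSeries.C (yExp (-freq n m α) (starRingEnd ℂ (Ωconst n m α l k))) := by
  rw [dagger, Matrix.of_apply, Ωθ_entry, fconj, PowerSeries.map_C, conj_yExp]

/-- The cyclic successor on `Fin n`. -/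
def cycSucc (k : Fin n) : Fin n := ⟨((k : ℕ) + 1) % n, Nat.mod_lt _ k.pos⟩

theorem cycSucc_injective : Function.Injective (cycSucc (n := n)) := by
  intro k l h
  have h1 : ((k : ℕ) + 1) % n = ((l : ℕ) + 1) % n := congrArg Fin.val h
  have h2 : (k : ℕ) % n = (l : ℕ) % n := Nat.ModEq.add_right_cancel' 1 h1
  rw [Nat.mod_eq_of_lt k.2, Nat.mod_eq_of_lt l.2] at h2
  exact Fin.ext h2

theorem shiftMat_apply (k l : Fin n) : shiftMat n k l = if l = cycSucc k then 1 else 0 := by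
  simp [shiftMat, cycSucc, Fin.ext_iff]

/-- It is a permutation matrix, because the cyclic successor is injective. -/
theorem shiftMat_mul_conjTranspose : shiftMat n * (shiftMat n).conjTranspose = 1 := by
  ext k l
  simp [Matrix.mul_apply, Matrix.conjTranspose_apply, shiftMat_apply, Matrix.one_apply,
    cycSucc_injective.eq_iff, eq_comm]

/-- The entries of the clock matrix. -/
def clockEntry (n : ℕ) (m : ℤ) (k : ℕ) : ℂ :=
  Complex.exp (2 * (Real.pi : ℂ) * Complex.I * ((k : ℂ) + 1) * (m : ℂ) / (n : ℂ))

theorem clock_eq : clock n m = Matrix.diagonal fun k : Fin n => clockEntry n m k := rfl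

theorem clockEntry_mul_conj (k : ℕ) :
    clockEntry n m k * starRingEnd ℂ (clockEntry n m k) = 1 := by
  rw [clockEntry, ← Complex.exp_conj, ← Complex.exp_add]
  simp only [map_div₀, map_mul, map_add, Complex.conj_I, Complex.conj_ofReal, map_one, map_ofNat,
    map_natCast, map_intCast]
  rw [← Complex.exp_zero]
  congr 1
  ring

theorem clock_mul_conjTranspose : clock n m * (clock n m).conjTranspose = 1 := by
  rw [clock_eq, Matrix.diagonal_conjTranspose, Matrix.diagonal_mul_diagonal, ← Matrix.diagonal_one]
  congr 1
  funext k
  exact clockEntry_mul_conj k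

theorem Ωconst_mul_conjTranspose (α : Fin 2) :
    Ωconst n m α * (Ωconst n m α).conjTranspose = 1 := by
  fin_cases α
  · exact clock_mul_conjTranspose
  · exact shiftMat_mul_conjTranspose

/-- Unitarity reconciles the inverse in the classical periodicity condition with the dagger in the
quantum one. -/
theorem Ωcl_inv_apply (α : Fin 2) (p : Plane) (k l : Fin n) :
    (Ωcl n m α p)⁻¹ k l = yExp (-freq n m α) (starRingEnd ℂ (Ωconst n m α l k)) p := by
  have h : (Ωcl n m α p)⁻¹ =
      Complex.exp (-(Complex.I * freq n m α * (p 1 : ℂ))) • (Ωconst n m α).conjTranspose := by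
    refine Matrix.inv_eq_right_inv ?_
    rw [Ωcl_eq_smul, Matrix.smul_mul, Matrix.mul_smul, Ωconst_mul_conjTranspose, smul_smul,
      ← Complex.exp_add, add_neg_cancel, Complex.exp_zero, one_smul]
  rw [h, Matrix.smul_apply, smul_eq_mul, yExp, mul_comm]
  push_cast
  rw [Matrix.conjTranspose_apply]
  simp

/-! ### Preservation of twisted periodicity -/

/-- The drift from translation equals the drift from left multiplication by Ω_α; this is where the
frequency m/n of Ω₁ enters. -/
theorem shift_exponent (hn : 0 < n) (α : Fin 2) :
    (if α = 0 then 2 * Real.pi * m else 0 : ℂ) = 0 + 2 * Real.pi * n * (freq n m α : ℝ) := by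
  have : (n : ℂ) ≠ 0 := by exact_mod_cast hn.ne'
  fin_cases α
  · simp [freq]
    field_simp
  · simp [freq]

theorem coeff_zero_moyal (f g : Formal) :
    PowerSeries.coeff 0 (moyal f g) = PowerSeries.coeff 0 f * PowerSeries.coeff 0 g := by
  rw [coeff_moyal]
  simp [bidiff]

theorem mstar_apply (P Q : Mat n) (k l : Fin n) :
    mstar P Q k l = ∑ j, moyal (P k j) (Q j l) := rfl

theorem isSmooth_moyal_yFun_left {f : Formal} (hf : IsSmooth f) {g : Plane → ℂ} (hg : IsYFun g) :
    IsSmooth (moyal (PowerSeries.C g) f) := by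
  rw [moyal_yFun_left hg]; exact isSmooth_yStar _ hg hf

theorem isSmooth_moyal_yFun_right {f : Formal} (hf : IsSmooth f) {g : Plane → ℂ} (hg : IsYFun g) :
    IsSmooth (moyal f (PowerSeries.C g)) := by
  rw [moyal_yFun_right hg]; exact isSmooth_yStar _ hg hf

/-- Both sides of the twisted condition solve `SWEq` with the same drift, and at θ = 0 they agree
because φ is a classical section. -/
theorem mem_Eθ_of_isSWFund (hn : 0 < n) {φ : Fin n → Plane → ℂ} (hφ : φ ∈ Ecl n m) {φh : Vec n}
    (h : IsSWFund (Aθ n m) φ φh) : φh ∈ Eθ n m := by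
  obtain ⟨h1, h2, h3⟩ := (isSWFund_iff hn _ _).1 h
  refine ⟨h1, fun α => funext fun k => ?_⟩
  have hterm : ∀ l, SWEq n m (2 * m) (0 + 2 * Real.pi * n * (freq n m α : ℝ))
      (moyal (Ωθ n m α k l) (φh l)) := fun l => by
    rw [Ωθ_entry]
    exact (h3 l).moyal_yFun_left (h1 l) (isYFun_yExp _ _) (pd_one_yExp _ _)
  refine ((h3 k).shift α).unique hn (g := vstar (Ωθ n m α) φh k) ?_ ?_
  · rw [shift_exponent hn]
    refine SWEq.sum (fun l _ => ?_) fun l _ => hterm l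
    rw [Ωθ_entry]
    exact isSmooth_moyal_yFun_left (h1 l) (isYFun_yExp _ _)
  · rw [coeff_shift, h2, vstar, map_sum]
    funext p
    rw [hφ.2 α p k, Finset.sum_apply]
    refine Finset.sum_congr rfl fun l _ => ?_
    rw [coeff_zero_moyal, h2, Pi.mul_apply, Ωθ_entry, ← Ωcl_entry]
    simp

/-- As for sections: the left factor Ω_α supplies the drift, and the right factor Ω_α^† leaves the
equation unchanged, being a function of σ². -/
theorem mem_Endθ_of_isSWAdj (hn : 0 < n) {Ψ : Plane → Matrix (Fin n) (Fin n) ℂ}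
    (hΨ : Ψ ∈ Endcl n m) {Ψh : Mat n} (h : IsSWAdj (Aθ n m) Ψ Ψh) : Ψh ∈ Endθ n m := by
  obtain ⟨h1, h2, h3⟩ := (isSWAdj_iff hn _ _).1 h
  refine ⟨h1, fun α => Matrix.ext fun k l => ?_⟩
  have hs1 : ∀ i j, IsSmooth (moyal (Ωθ n m α k i) (Ψh i j)) := fun i j => by
    rw [Ωθ_entry]
    exact isSmooth_moyal_yFun_left (h1 i j) (isYFun_yExp _ _)
  have he1 : ∀ i j, SWEq n m 0 (0 + 2 * Real.pi * n * (freq n m α : ℝ))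
      (moyal (Ωθ n m α k i) (Ψh i j)) := fun i j => by
    rw [Ωθ_entry]
    exact (h3 i j).moyal_yFun_left (h1 i j) (isYFun_yExp _ _) (pd_one_yExp _ _)
  have hs2 : ∀ j, IsSmooth (mstar (Ωθ n m α) Ψh k j) := fun j => by
    rw [mstar_apply]
    exact IsSmooth.sum fun i _ => hs1 i j
  have he2 : ∀ j, SWEq n m 0 (0 + 2 * Real.pi * n * (freq n m α : ℝ))
      (mstar (Ωθ n m α) Ψh k j) := fun j => by
    rw [mstar_apply]
    exact SWEq.sum (fun i _ => hs1 i j) fun i _ => he1 i j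
  rw [Matrix.map_apply]
  refine ((h3 k l).shift α).unique hn
    (g := mstar (mstar (Ωθ n m α) Ψh) (dagger (Ωθ n m α)) k l) ?_ ?_
  · rw [shift_exponent hn, mstar_apply]
    refine SWEq.sum (fun j _ => ?_) fun j _ => ?_
    · rw [dagger_Ωθ_entry]
      exact isSmooth_moyal_yFun_right (hs2 j) (isYFun_yExp _ _)
    · rw [dagger_Ωθ_entry]
      exact (he2 j).moyal_yFun_right (hs2 j) (isYFun_yExp _ _)
  · rw [coeff_shift, h2, mstar_apply, map_sum]
    funext p
    change Ψ (translate α p) k l = _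
    rw [hΨ.2 α p, Finset.sum_apply, Matrix.mul_apply]
    refine Finset.sum_congr rfl fun j _ => ?_
    rw [coeff_zero_moyal, Pi.mul_apply, Ωcl_inv_apply, dagger_Ωθ_entry, mstar_apply,
      map_sum, Finset.sum_apply, Matrix.mul_apply]
    congr 1
    · refine Finset.sum_congr rfl fun i _ => ?_
      rw [coeff_zero_moyal, h2, Pi.mul_apply, Ωθ_entry, ← Ωcl_entry]
      simp
    · simp

end NCTorus

namespace NCTorus

variable {n : ℕ} {m : ℤ}

/-! ### Quantization of the potential -/

/-- Formal matrices that agree up to order `N` in `θ`. -/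
def AgreeUpTo (N : ℕ) (P Q : Mat n) : Prop :=
  ∀ k l, ∀ i ≤ N, PowerSeries.coeff i (P k l) = PowerSeries.coeff i (Q k l)

theorem AgreeUpTo.add {N : ℕ} {P Q P' Q' : Mat n} (h : AgreeUpTo N P Q) (h' : AgreeUpTo N P' Q') :
    AgreeUpTo N (P + P') (Q + Q') := fun k l i hi => by
  rw [Matrix.add_apply, Matrix.add_apply, map_add, map_add, h k l i hi, h' k l i hi]

theorem AgreeUpTo.sub {N : ℕ} {P Q P' Q' : Mat n} (h : AgreeUpTo N P Q) (h' : AgreeUpTo N P' Q') :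
    AgreeUpTo N (P - P') (Q - Q') := fun k l i hi => by
  rw [Matrix.sub_apply, Matrix.sub_apply, map_sub, map_sub, h k l i hi, h' k l i hi]

theorem AgreeUpTo.const_smul {N : ℕ} {P Q : Mat n} (c : ℂ) (h : AgreeUpTo N P Q) :
    AgreeUpTo N (c • P) (c • Q) := fun k l i hi => by
  rw [Matrix.smul_apply, Matrix.smul_apply, coeff_const_smul, coeff_const_smul, h k l i hi]

theorem AgreeUpTo.map_fpd {N : ℕ} {P Q : Mat n} (μ : Fin 2) (h : AgreeUpTo N P Q) :
    AgreeUpTo N (P.map (fpd μ)) (Q.map (fpd μ)) := fun k l i hi => by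
  rw [Matrix.map_apply, Matrix.map_apply, coeff_fpd, coeff_fpd, h k l i hi]

theorem AgreeUpTo.mstar {N : ℕ} {P Q P' Q' : Mat n} (h : AgreeUpTo N P Q)
    (h' : AgreeUpTo N P' Q') : AgreeUpTo N (mstar P P') (mstar Q Q') := fun k l i hi => by
  rw [mstar_apply, mstar_apply, map_sum, map_sum]
  exact Finset.sum_congr rfl fun j _ => moyal_congr (h k j) (h' j l) i hi

theorem AgreeUpTo.anticomm {N : ℕ} {P Q P' Q' : Mat n} (h : AgreeUpTo N P Q)
    (h' : AgreeUpTo N P' Q') : AgreeUpTo N (anticomm P P') (anticomm Q Q') :=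
  (h.mstar h').add (h'.mstar h)

theorem AgreeUpTo.fieldStrength {N : ℕ} {A B : Fin 2 → Mat n} (h : ∀ κ, AgreeUpTo N (A κ) (B κ))
    (μ ν : Fin 2) : AgreeUpTo N (fieldStrength A μ ν) (fieldStrength B μ ν) :=
  ((((h ν).map_fpd μ).sub ((h μ).map_fpd ν)).sub (((h μ).mstar (h ν)).const_smul _)).add
    (((h ν).mstar (h μ)).const_smul _)

/-- Although the flow is nonlinear, its right side is built from operations that respect agreement
up to order N, so order N of ∂_θ fixes order N + 1 of the potential. -/
theorem isSWPotential_unique {A : Fin 2 → Plane → Matrix (Fin n) (Fin n) ℂ} {F G : Fin 2 → Mat n}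
    (hF : IsSWPotential A F) (hG : IsSWPotential A G) : F = G := by
  obtain ⟨-, f2, f3⟩ := hF
  obtain ⟨-, g2, g3⟩ := hG
  have key : ∀ N κ, AgreeUpTo N (F κ) (G κ) := by
    intro N
    induction N with
    | zero =>
      intro κ k l i hi
      obtain rfl : i = 0 := by omega
      rw [PowerSeries.coeff_zero_eq_constantCoeff, f2, g2]
    | succ N ih =>
      intro κ k l i hi
      rcases Nat.lt_or_ge i (N + 1) with h | h
      · exact ih κ k l i (by omega)
      obtain rfl : i = N + 1 := by omega
      have hterm : ∀ μ ν, AgreeUpTo N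
          (eps μ ν • anticomm (F μ) ((F κ).map (fpd ν) + fieldStrength F ν κ))
          (eps μ ν • anticomm (G μ) ((G κ).map (fpd ν) + fieldStrength G ν κ)) := fun μ ν =>
        ((ih μ).anticomm (((ih κ).map_fpd ν).add (AgreeUpTo.fieldStrength ih ν κ))).const_smul _
      have hrhs : AgreeUpTo N ((F κ).map dθ) ((G κ).map dθ) := by
        rw [f3, g3]
        simp only [Fin.sum_univ_two]
        exact (((hterm 0 0).add (hterm 0 1)).add ((hterm 1 0).add (hterm 1 1))).const_smul _
      have h1 := hrhs k l N le_rfl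
      rw [Matrix.map_apply, Matrix.map_apply, coeff_dθ, coeff_dθ] at h1
      have h2 : (N : ℂ) + 1 ≠ 0 := by exact_mod_cast N.succ_ne_zero
      exact smul_right_injective _ h2 h1
  funext κ
  ext1 k l
  ext1 i
  exact key i κ k l i le_rfl

theorem dθ_invNM (hn : 0 < n) : dθ (invNM n m) = (m : ℂ) • (invNM n m * invNM n m) := by
  have hν := invNM_spec (m := m) hn
  have h := congrArg dθ hν
  have h1 : dθ (1 : Formal) = 0 := by simp [dθ]
  rw [dθ_sub, dθ_const_smul, dθ_const_smul, dθ_mul, dθ_X, h1] at h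
  simp only [Algebra.smul_def] at h hν ⊢
  linear_combination (-dθ (invNM n m)) * hν + invNM n m * h

theorem coeff_zero_invNM (hn : 0 < n) : PowerSeries.coeff 0 (invNM n m) = fun _ => (n : ℂ)⁻¹ := by
  have h := congrArg (PowerSeries.coeff 0) (invNM_spec (m := m) hn)
  rw [map_sub, coeff_const_smul, coeff_const_smul, PowerSeries.coeff_zero_X_mul, smul_zero,
    sub_zero, PowerSeries.coeff_zero_one] at h
  funext p
  have hp : (n : ℂ) * PowerSeries.coeff 0 (invNM n m) p = 1 := congrFun h p
  exact eq_inv_of_mul_eq_one_right hp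

/-- For κ = 1 the equation is trivial. For κ = 2 the bracket ∂₁A₂ + F₁₂ is the constant 2(m/2π)ν, so
the equation reads ∂_θ a = mνa, which follows from ∂_θ ν = mν². -/
theorem isSWPotential_Aθ (hn : 0 < n) : IsSWPotential (Acl n m) (Aθ n m) := by
  refine ⟨fun κ k l => ?_, fun κ k l => ?_, fun κ => ?_⟩
  · fin_cases κ
    · exact isSmooth_zero
    · change IsSmooth (Matrix.diagonal (fun _ => aθ n m) k l)
      rw [Matrix.diagonal_apply]
      split_ifs
      · exact isSmooth_aθ
      · exact isSmooth_zero
  · rw [← PowerSeries.coeff_zero_eq_constantCoeff_apply]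
    fin_cases κ
    · simp [Aθ, Acl]
      rfl
    · change PowerSeries.coeff 0 (Matrix.diagonal (fun _ => aθ n m) k l) = _
      rw [Matrix.diagonal_apply]
      funext p
      change _ = (((m : ℂ) / (n : ℂ) * ((p 0 : ℂ) / (2 * (Real.pi : ℂ)))) •
        (1 : Matrix (Fin n) (Fin n) ℂ)) k l
      rw [Matrix.smul_apply, Matrix.one_apply]
      split_ifs
      · rw [aθ, PowerSeries.coeff_C_mul, coeff_zero_invNM hn]
        simp only [Pi.mul_apply, smul_eq_mul, mul_one]
        ring
      · simp
  · have hm : algebraMap ℂ Formal m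
        = 2 * algebraMap ℂ Formal Real.pi * algebraMap ℂ Formal (slope m) := by
      rw [← two_pi_mul_slope]; simp only [map_mul, map_ofNat]
    have hp : algebraMap ℂ Formal Real.pi = 2 * algebraMap ℂ Formal (Real.pi / 2) := by
      rw [← map_ofNat (algebraMap ℂ Formal) 2, ← map_mul]; congr 1; ring
    have h0 : dθ (0 : Formal) = 0 := by simp [dθ]
    have hc : ∀ μ, fpd μ (slope m • invNM n m + slope m • invNM n m) = 0 := fun μ => by
      rw [fpd_add μ (isSmooth_invNM.const_smul _) (isSmooth_invNM.const_smul _), fpd_const_smul,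
        fpd_invNM, smul_zero, add_zero]
    simp only [Fin.sum_univ_two, eps, Matrix.of_apply, Matrix.cons_val', Matrix.cons_val_zero,
      Matrix.cons_val_one, Matrix.cons_val_fin_one, zero_smul, add_zero, zero_add, one_smul,
      Aθ_zero, anticomm_zero_left]
    fin_cases κ
    · simp only [Fin.zero_eta, Aθ_zero, map_zero_fpd, fieldStrength_self, add_zero]
      rw [anticomm, mstar_zero_left, mstar_zero_right, add_zero, smul_zero, smul_zero]
      ext1 k l
      exact h0
    · simp only [Fin.mk_one, Aθ_one, map_diagonal_fpd, fieldStrength_Aθ, fpd_zero_aθ,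
        Matrix.diagonal_add]
      rw [anticomm, mstar_diagonal_left, mstar_diagonal_right, Matrix.diagonal_map h0,
        Matrix.diagonal_map (moyal_zero_right _), Matrix.diagonal_map (f := fun f => moyal f (aθ n m)) (moyal_zero_left _),
        Matrix.diagonal_add, ← Matrix.diagonal_smul, ← Matrix.diagonal_smul]
      congr 1
      funext _
      simp only [Pi.smul_apply]
      rw [moyal_of_fpd_eq_zero_left hc, moyal_of_fpd_eq_zero_right hc, aθ_eq, dθ_const_smul,
        dθ_mul, dθ_C, dθ_invNM hn]
      simp only [Algebra.smul_def, map_neg, map_one, hm, hp]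
      ring

/-! ### Quantization of the transition functions -/

/-- Each term of the equation contains ∂_θ or ∂₁ when κ = c = 0, and both annihilate a θ-independent
function of σ². Hence the transition functions are not deformed. -/
theorem swEq_C_yFun {g : Plane → ℂ} (hg : IsYFun g) : SWEq n m 0 0 (PowerSeries.C g) := by
  rw [SWEq, dθ_C, fpd_C, fpd_C, fpd_C, hg.2, hg.pd_one.2]
  simp

theorem isSWAdj_Ωθ (hn : 0 < n) (α : Fin 2) : IsSWAdj (Aθ n m) (Ωcl n m α) (Ωθ n m α) := by
  refine (isSWAdj_iff hn _ _).2 ⟨fun k l => ?_, fun k l => ?_, fun k l => ?_⟩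
  · rw [Ωθ_entry]
    exact isSmooth_C (isYFun_yExp _ _).1
  · rw [Ωθ_entry, Ωcl_entry]
    simp
  · rw [Ωθ_entry]
    exact swEq_C_yFun (isYFun_yExp _ _)

theorem shift_C (α : Fin 2) (g : Plane → ℂ) :
    shift α (PowerSeries.C g) = PowerSeries.C fun p => g (translate α p) := by
  ext1 N
  rw [coeff_shift, PowerSeries.coeff_C, PowerSeries.coeff_C]
  split_ifs <;> rfl

theorem moyal_C_yFun {f g : Plane → ℂ} (hf : IsYFun f) (hg : IsYFun g) :
    moyal (PowerSeries.C f) (PowerSeries.C g) = PowerSeries.C (f * g) := by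
  rw [moyal_of_fpd_zero_eq_zero (by rw [fpd_C, hf.2, map_zero]) (by rw [fpd_C, hg.2, map_zero]),
    map_mul]

/-! ### Clock and shift matrices, cocycle and connection conditions -/

theorem clockEntry_succ (k : ℕ) : clockEntry n m (k + 1) =
    Complex.exp (2 * Real.pi * Complex.I * m / n) * clockEntry n m k := by
  rw [clockEntry, clockEntry, ← Complex.exp_add]
  congr 1
  push_cast
  ring

/-- Away from the last index this is the geometric progression of the entries; at the wrap-around
the discrepancy is e^{2πim} = 1. -/
theorem clockEntry_cycSucc (k : Fin n) : clockEntry n m (cycSucc k) =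
    Complex.exp (2 * Real.pi * Complex.I * m / n) * clockEntry n m k := by
  rw [← clockEntry_succ]
  have hk := k.2
  have hn : (n : ℂ) ≠ 0 := by exact_mod_cast k.pos.ne'
  rcases Nat.lt_or_ge ((k : ℕ) + 1) n with h | h
  · congr 1
    exact Nat.mod_eq_of_lt h
  · have h1 : (k : ℕ) + 1 = n := by omega
    have h2 : ((cycSucc k : Fin n) : ℕ) = 0 := by
      change ((k : ℕ) + 1) % n = 0
      rw [h1, Nat.mod_self]
    rw [h2, h1, clockEntry, clockEntry]
    have : 2 * (Real.pi : ℂ) * Complex.I * ((n : ℂ) + 1) * m / n =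
        2 * (Real.pi : ℂ) * Complex.I * (((0 : ℕ) : ℂ) + 1) * m / n
          + m * (2 * Real.pi * Complex.I) := by
      field_simp
      push_cast
      ring
    rw [this, Complex.exp_add, Complex.exp_int_mul_two_pi_mul_I, mul_one]

theorem shiftMat_mul_clock : shiftMat n * clock n m =
    Complex.exp (2 * Real.pi * Complex.I * m / n) • (clock n m * shiftMat n) := by
  ext k l
  rw [clock_eq, Matrix.mul_diagonal, Matrix.smul_apply, Matrix.diagonal_mul, shiftMat_apply]
  split_ifs with h
  · rw [h, clockEntry_cycSucc]
    simp
  · simp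

theorem mstar_constMat {P Q : Plane → Matrix (Fin n) (Fin n) ℂ}
    (hP : ∀ k l, IsYFun fun p => P p k l) (hQ : ∀ k l, IsYFun fun p => Q p k l) :
    mstar (constMat P) (constMat Q) = constMat fun p => P p * Q p := by
  ext1 k l
  rw [mstar_apply]
  simp only [constMat, Matrix.of_apply]
  rw [Finset.sum_congr rfl fun j _ => moyal_C_yFun (hP k j) (hQ j l), ← map_sum]
  congr 1
  funext p
  simp [Matrix.mul_apply]

theorem isYFun_Ωcl (α : Fin 2) (k l : Fin n) : IsYFun fun p => Ωcl n m α p k l := by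
  rw [Ωcl_entry]; exact isYFun_yExp _ _

theorem isYFun_translate {g : Plane → ℂ} (hg : IsYFun g) (α : Fin 2) :
    IsYFun fun p => g (translate α p) :=
  ⟨hg.1.comp (contDiff_translate α), by rw [pd_translate, hg.2]; rfl⟩

theorem map_shift_Ωθ (α β : Fin 2) :
    (Ωθ n m α).map (shift β) = constMat fun p => Ωcl n m α (translate β p) := by
  ext1 k l
  exact shift_C β _

/-- All entries are functions of σ², so the products are pointwise. The phase e^{2πim/n} gained by
Ω₁ under translation of σ² is the one in VU = e^{2πim/n} UV. -/
theorem cocycle_Ωθ (hn : 0 < n) : Cocycle (Ωθ n m) := by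
  have hn' : (n : ℂ) ≠ 0 := by exact_mod_cast hn.ne'
  rw [Cocycle, map_shift_Ωθ, map_shift_Ωθ, Ωθ, Ωθ,
    mstar_constMat (fun k l => isYFun_translate (isYFun_Ωcl 0 k l) 1) (isYFun_Ωcl 1),
    mstar_constMat (fun k l => isYFun_translate (isYFun_Ωcl 1 k l) 0) (isYFun_Ωcl 0)]
  congr 1
  funext p
  change (Complex.exp (Complex.I * m * (translate 1 p 1 : ℂ) / n) • clock n m) * shiftMat n
    = shiftMat n * (Complex.exp (Complex.I * m * (p 1 : ℂ) / n) • clock n m)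
  rw [Matrix.smul_mul, Matrix.mul_smul, shiftMat_mul_clock, smul_smul, translate_apply, if_pos rfl,
    ← Complex.exp_add]
  congr 2
  push_cast
  field_simp

theorem sum_Ω_mul_conj (α : Fin 2) (k l : Fin n) :
    ∑ j, (PowerSeries.C (yExp (freq n m α) (Ωconst n m α k j)) : Formal) *
      PowerSeries.C (yExp (-freq n m α) (starRingEnd ℂ (Ωconst n m α l j))) =
      if k = l then 1 else 0 := by
  simp only [← map_mul, ← map_sum, yExp_mul, add_neg_cancel, yExp_zero_left]
  have h := congrFun (congrFun (Ωconst_mul_conjTranspose (n := n) (m := m) α) k) l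
  rw [Matrix.mul_apply] at h
  have h2 : (∑ j, fun _ : Plane => Ωconst n m α k j * starRingEnd ℂ (Ωconst n m α l j)) =
      if k = l then 1 else 0 := by
    funext p
    rw [Finset.sum_apply]
    refine Eq.trans h ?_
    rw [Matrix.one_apply]
    split_ifs <;> rfl
  rw [h2]
  split_ifs
  · exact map_one _
  · exact map_zero _

/-- ⋆-conjugation by e^{iγσ²} translates σ¹ by 2πγθ; on the affine function a this adds slope · ν
times that shift. -/
theorem moyal_Ω_aθ_conj {γ : ℝ} (u v : ℂ) :
    moyal (moyal (PowerSeries.C (yExp γ u)) (aθ n m)) (PowerSeries.C (yExp (-γ) v)) =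
      (aθ n m + (2 * Real.pi * slope m * γ : ℂ) • (PowerSeries.X * invNM n m)) *
        (PowerSeries.C (yExp γ u) * PowerSeries.C (yExp (-γ) v)) := by
  have hI : algebraMap ℂ Formal Complex.I * algebraMap ℂ Formal Complex.I = -1 := by
    rw [← map_mul, Complex.I_mul_I, map_neg, map_one]
  set G : Formal := PowerSeries.C (yExp γ u) with hG
  have hGs : IsSmooth G := isSmooth_C (isYFun_yExp γ u).1
  have hνG : IsSmooth (invNM n m * G) := isSmooth_invNM.mul hGs
  have h0 : fpd 0 (invNM n m * G) = 0 := by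
    rw [fpd_mul 0 isSmooth_invNM hGs, fpd_invNM, hG, fpd_C, (isYFun_yExp γ u).2]
    simp
  have h1 : fpd 1 G = (Complex.I * γ) • G := by
    rw [hG, fpd_C, pd_one_yExp, ← C_const_mul, ← map_mul]
    rfl
  have h2 : moyal G (aθ n m) = slope m • (PowerSeries.C coordX * (invNM n m * G)) -
      (Complex.I * Real.pi * slope m * (Complex.I * γ)) • (PowerSeries.X * (invNM n m * G)) := by
    rw [moyal_aθ_right, h1]
    simp only [Algebra.smul_def, map_mul]
    ring
  have hs1 : IsSmooth (PowerSeries.C coordX * (invNM n m * G)) :=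
    (isSmooth_C contDiff_coordX).mul hνG
  have hs2 : IsSmooth (PowerSeries.X * (invNM n m * G)) := isSmooth_X.mul hνG
  rw [h2, sub_eq_add_neg, ← neg_smul, moyal_yFun_right (isYFun_yExp _ _),
    yStar_add _ _ (hs1.const_smul _) (hs2.const_smul _), yStar_const_smul, yStar_const_smul,
    yStar_coordX_mul _ _ hνG, yStar_X_mul, pd_one_yExp, yStar_const_smul_left,
    yStar_of_fpd_zero_eq_zero _ _ h0, aθ_eq]
  simp only [Algebra.smul_def, map_mul, map_neg, map_ofNat, Complex.ofReal_neg]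
  linear_combination (-2 * algebraMap ℂ Formal Real.pi * algebraMap ℂ Formal (slope m) *
    algebraMap ℂ Formal γ * PowerSeries.X * invNM n m * G * PowerSeries.C (yExp (-γ) v)) * hI

theorem shift_aθ (α : Fin 2) : shift α (aθ n m) =
    aθ n m + (if α = 0 then (m : ℂ) else 0) • invNM n m := by
  have hν : ∀ i p, PowerSeries.coeff i (invNM n m) (translate α p)
      = PowerSeries.coeff i (invNM n m) p := by
    intro i p
    rw [invNM_eq_scalarSeries, scalarSeries, PowerSeries.coeff_map]
    rfl
  have hpi : (Real.pi : ℂ) ≠ 0 := by exact_mod_cast Real.pi_ne_zero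
  ext1 N
  funext p
  rw [coeff_shift, map_add, coeff_const_smul, aθ, PowerSeries.coeff_C_mul]
  simp only [Pi.mul_apply, Pi.add_apply, Pi.smul_apply, hν, smul_eq_mul, translate_apply]
  fin_cases α
  · simp
    field_simp
  · simp

/-- For A₁ every term vanishes. For A₂, translation by 2πe₁ adds mν, while conjugation by Ω₁ adds
(m/n)mθν and the inhomogeneous term adds m/n. -/
theorem twistedConnection_Ωθ (hn : 0 < n) : TwistedConnection (Ωθ n m) (Aθ n m) := by
  have hn' : (n : ℂ) ≠ 0 := by exact_mod_cast hn.ne'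
  have hs0 : ∀ α, shift α (0 : Formal) = 0 := fun α => by
    ext1 N; rw [coeff_shift]; simp; rfl
  intro α μ
  fin_cases μ
  · have h : (dagger (Ωθ n m α)).map (fpd 0) = 0 := by
      ext1 k l
      rw [Matrix.map_apply, dagger_Ωθ_entry, fpd_C, (isYFun_yExp _ _).2, map_zero]
      rfl
    simp only [Fin.zero_eta, Aθ_zero, mstar_zero_left, mstar_zero_right, h, smul_zero, add_zero]
    ext1 k l
    exact hs0 α
  · ext1 k l
    have hν := invNM_spec (m := m) hn
    simp only [Fin.mk_one, Aθ_one, mstar_diagonal_right, Matrix.add_apply, Matrix.smul_apply,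
      mstar_apply, Matrix.map_apply, dagger_Ωθ_entry, Ωθ_entry, fpd_C, pd_one_yExp,
      moyal_Ω_aθ_conj]
    have h2 : ∀ j, moyal (PowerSeries.C (yExp (freq n m α) (Ωconst n m α k j)))
        (PowerSeries.C ((Complex.I * ((-freq n m α : ℝ) : ℂ)) • 
          yExp (-freq n m α) (starRingEnd ℂ (Ωconst n m α l j)))) =
        (Complex.I * ((-freq n m α : ℝ) : ℂ)) •
          (PowerSeries.C (yExp (freq n m α) (Ωconst n m α k j)) *
          PowerSeries.C (yExp (-freq n m α) (starRingEnd ℂ (Ωconst n m α l j)))) := fun j => by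
      have : IsYFun ((Complex.I * ((-freq n m α : ℝ) : ℂ)) •
          yExp (-freq n m α) (starRingEnd ℂ (Ωconst n m α l j))) := by
        rw [← pd_one_yExp]; exact (isYFun_yExp _ _).pd_one
      rw [moyal_C_yFun (isYFun_yExp _ _) this, ← map_mul, ← C_const_mul, ← map_mul]
      congr 1
      exact mul_smul_comm _ _ _
    simp only [h2]
    rw [← Finset.mul_sum, ← Finset.smul_sum, sum_Ω_mul_conj, Matrix.diagonal_apply]
    split_ifs with hkl
    · rw [shift_aθ, mul_one, smul_smul, two_pi_mul_slope, add_assoc]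
      congr 1
      rw [show Complex.I * (Complex.I * ((-freq n m α : ℝ) : ℂ)) = (freq n m α : ℂ) by
        push_cast; linear_combination (-(freq n m α : ℂ)) * Complex.I_sq]
      have hf : (if α = 0 then (m : ℂ) else 0) = freq n m α * n := by
        fin_cases α
        · simp [freq]; field_simp
        · simp [freq]
      rw [hf]
      simp only [Algebra.smul_def, map_mul] at hν ⊢
      -- With γ the frequency, the claim is γ(mθν + 1) = γnν.
      linear_combination (algebraMap ℂ Formal (freq n m α)) * hν
    · rw [hs0]
      simp

theorem isInducedQuantization_iff (hn : 0 < n) (Eh : Set (Vec n)) (Ah : Fin 2 → Mat n) :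
    IsInducedQuantization (Ωcl n m) (Acl n m) Eh Ah ↔ Eh = Eθ n m ∧ Ah = Aθ n m := by
  constructor
  · rintro ⟨hA, Ωh, hΩ, -, -, hE⟩
    obtain rfl := isSWPotential_unique hA (isSWPotential_Aθ hn)
    have : Ωh = Ωθ n m := funext fun α => isSWAdj_unique hn (hΩ α) (isSWAdj_Ωθ hn α)
    subst this
    exact ⟨hE, rfl⟩
  · rintro ⟨rfl, rfl⟩
    exact ⟨isSWPotential_Aθ hn, Ωθ n m, isSWAdj_Ωθ hn, cocycle_Ωθ hn, twistedConnection_Ωθ hn, rfl⟩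

end NCTorus

namespace NCTorus

variable {n : ℕ} {m : ℤ}

/-! ### Solutions that depend on `σ^1` only -/

/-- A solution of the evolution equation in the adjoint that depends on `σ^1` only. -/
structure IsXFlow (n : ℕ) (m : ℤ) (f : Formal) : Prop where
  smooth : IsSmooth f
  fpd_one : fpd 1 f = 0
  eq : (n : ℂ) • dθ f = (m : ℂ) • (PowerSeries.X * dθ f) +
    (m : ℂ) • (PowerSeries.C coordX * fpd 0 f)

theorem IsXFlow.swEq {f : Formal} (hf : IsXFlow n m f) : SWEq n m 0 0 f := by
  rw [SWEq, hf.fpd_one, fpd_zero, hf.eq]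
  simp

theorem isXFlow_one : IsXFlow n m 1 := by
  have h : ∀ μ, fpd μ (1 : Formal) = 0 := fun μ => by
    rw [← map_one PowerSeries.C, fpd_C]
    exact (congrArg _ (pd_const μ 1)).trans (map_zero _)
  have h' : dθ (1 : Formal) = 0 := by simp [dθ]
  refine ⟨isSmooth_one, h 1, ?_⟩
  rw [h 0, h']
  simp

/-- Without σ²-dependence the equation is first order and homogeneous, given by a derivation, so its
solutions form a ring. -/
theorem IsXFlow.mul {f g : Formal} (hf : IsXFlow n m f) (hg : IsXFlow n m g) :
    IsXFlow n m (f * g) := by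
  refine ⟨hf.smooth.mul hg.smooth, ?_, ?_⟩
  · rw [fpd_mul 1 hf.smooth hg.smooth, hf.fpd_one, hg.fpd_one]
    simp
  · have h1 := hf.eq
    have h2 := hg.eq
    rw [dθ_mul, fpd_mul 0 hf.smooth hg.smooth]
    simp only [Algebra.smul_def] at h1 h2 ⊢
    linear_combination g * h1 + f * h2

theorem IsXFlow.pow {f : Formal} (hf : IsXFlow n m f) (k : ℕ) : IsXFlow n m (f ^ k) := by
  induction k with
  | zero => rw [pow_zero]; exact isXFlow_one
  | succ k ih => rw [pow_succ]; exact ih.mul hf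

theorem pd_conj (μ : Fin 2) {f : Plane → ℂ} (hf : Differentiable ℝ f) :
    pd μ (fun p => starRingEnd ℂ (f p)) = fun p => starRingEnd ℂ (pd μ f p) := by
  funext p
  have h := (Complex.conjCLE.toContinuousLinearMap.hasFDerivAt.comp p (hf p).hasFDerivAt).fderiv
  have h' : fderiv ℝ (fun p => starRingEnd ℂ (f p)) p = _ := h
  simp [pd, h']

theorem fpd_fconj (μ : Fin 2) {f : Formal} (hf : IsSmooth f) :
    fpd μ (fconj f) = fconj (fpd μ f) := by
  ext1 N
  have h : PowerSeries.coeff N (fconj f) = fun p => starRingEnd ℂ (PowerSeries.coeff N f p) := by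
    funext p
    simp
  rw [coeff_fpd, h, pd_conj μ (hf.differentiable N)]
  funext p
  simp

theorem dθ_fconj (f : Formal) : dθ (fconj f) = fconj (dθ f) := by
  ext1 N
  funext p
  simp

theorem fconj_const_smul (c : ℂ) (f : Formal) : fconj (c • f) = starRingEnd ℂ c • fconj f := by
  ext1 N
  funext p
  simp

theorem IsXFlow.fconj {f : Formal} (hf : IsXFlow n m f) : IsXFlow n m (fconj f) := by
  refine ⟨hf.smooth.fconj, ?_, ?_⟩
  · rw [fpd_fconj 1 hf.smooth, hf.fpd_one]
    exact map_zero _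
  · have hx : starRingEnd (Plane → ℂ) coordX = coordX := by
      funext p; simp [coordX]
    have h := congrArg NCTorus.fconj hf.eq
    have hadd : ∀ f g : Formal, NCTorus.fconj (f + g) = NCTorus.fconj f + NCTorus.fconj g :=
      fun f g => map_add _ f g
    have hmul : ∀ f g : Formal, NCTorus.fconj (f * g) = NCTorus.fconj f * NCTorus.fconj g :=
      fun f g => map_mul _ f g
    have hX : NCTorus.fconj PowerSeries.X = PowerSeries.X := PowerSeries.map_X _
    have hC : NCTorus.fconj (PowerSeries.C coordX) = PowerSeries.C coordX := by
      rw [NCTorus.fconj, PowerSeries.map_C, hx]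
    rw [hadd, fconj_const_smul, fconj_const_smul, fconj_const_smul, hmul, hmul, hX, hC] at h
    rw [dθ_fconj, fpd_fconj 0 hf.smooth]
    simpa using h

/-! ### The exponential `e^{i σ^1 / (n - m θ)}` -/

/-- Partial sums of the exponential series. -/
def expPartial (u : Formal) (L : ℕ) : Formal :=
  ∑ l ∈ Finset.range L, (1 / (l.factorial : ℂ)) • u ^ l

theorem isSmooth_expPartial {u : Formal} (hu : IsSmooth u) (L : ℕ) :
    IsSmooth (expPartial u L) :=
  IsSmooth.sum fun l _ => (hu.pow l).const_smul _

/-- Stated for an abstract derivation in order to serve ∂₁, ∂₂ and ∂_θ alike. Differentiation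
shortens the truncated exponential by one term. -/
theorem derivation_expPartial {D : Formal → Formal}
    (hadd : ∀ f g, IsSmooth f → IsSmooth g → D (f + g) = D f + D g)
    (hsmul : ∀ (c : ℂ) f, D (c • f) = c • D f)
    (hmul : ∀ f g, IsSmooth f → IsSmooth g → D (f * g) = D f * g + f * D g)
    (hone : D 1 = 0) {u : Formal} (hu : IsSmooth u) (L : ℕ) :
    D (expPartial u (L + 1)) = expPartial u L * D u := by
  have hpow : ∀ k : ℕ, D (u ^ (k + 1)) = ((k : ℂ) + 1) • (u ^ k * D u) := by
    intro k
    induction k with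
    | zero => simp
    | succ k ih =>
      rw [pow_succ, hmul _ _ (hu.pow _) hu, ih]
      simp only [Algebra.smul_def, Nat.cast_succ, map_add, map_one]
      ring
  induction L with
  | zero => simp [expPartial, hone]
  | succ L ih =>
    have h1 : expPartial u (L + 1 + 1) =
        expPartial u (L + 1) + (1 / ((L + 1).factorial : ℂ)) • u ^ (L + 1) :=
      Finset.sum_range_succ _ _
    have h2 : expPartial u (L + 1) = expPartial u L + (1 / (L.factorial : ℂ)) • u ^ L :=
      Finset.sum_range_succ _ _
    rw [h1, hadd _ _ (isSmooth_expPartial hu _) ((hu.pow _).const_smul _), ih, hsmul, hpow, h2,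
      add_mul, smul_smul, smul_mul_assoc]
    congr 2
    have h3 : (L.factorial : ℂ) ≠ 0 := by exact_mod_cast L.factorial_ne_zero
    have h4 : ((L : ℂ) + 1) ≠ 0 := by exact_mod_cast L.succ_ne_zero
    rw [Nat.factorial_succ]
    push_cast
    field_simp

theorem coeff_pow_eq_zero {u : Formal} (hu : PowerSeries.constantCoeff u = 0) {N l : ℕ}
    (h : N < l) : PowerSeries.coeff N (u ^ l) = 0 :=
  PowerSeries.X_pow_dvd_iff.1 (pow_dvd_pow_of_dvd (PowerSeries.X_dvd_iff.2 hu) l) N h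

/-- The exponent minus its value at θ = 0 is divisible by θ, so any truncation longer than N
computes order N. Identities can thus be proved for a fixed polynomial truncation. -/
theorem coeff_formalExp (g : Formal) {N L : ℕ} (h : N < L) :
    PowerSeries.coeff N (formalExp g) = PowerSeries.coeff N
      (PowerSeries.C (fun p => Complex.exp (PowerSeries.constantCoeff g p)) *
        expPartial (g - PowerSeries.C (PowerSeries.constantCoeff g)) L) := by
  have hu : PowerSeries.constantCoeff (g - PowerSeries.C (PowerSeries.constantCoeff g)) = 0 := by
    simp
  rw [formalExp, PowerSeries.coeff_C_mul, PowerSeries.coeff_C_mul, PowerSeries.coeff_mk, expPartial,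
    map_sum]
  congr 1
  refine Finset.sum_subset (fun l hl => ?_) fun l _ hl => ?_
  · simp only [Finset.mem_range] at hl ⊢
    omega
  · rw [coeff_pow_eq_zero hu, smul_zero]
    simp only [Finset.mem_range] at hl
    omega

/-- The exponent `i σ^1 / (n - m θ)`. -/
def zExponent (n : ℕ) (m : ℤ) : Formal :=
  PowerSeries.C (fun p : Plane => Complex.I * (p 0 : ℂ)) * invNM n m

theorem zExponent_eq : zExponent n m = Complex.I • (PowerSeries.C coordX * invNM n m) := by
  rw [zExponent, ← C_const_mul, ← mul_assoc, ← map_mul]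
  rfl

theorem constantCoeff_zExponent (hn : 0 < n) : PowerSeries.constantCoeff (zExponent n m) =
    (Complex.I / n) • coordX := by
  rw [zExponent_eq, ← PowerSeries.coeff_zero_eq_constantCoeff_apply, coeff_const_smul,
    PowerSeries.coeff_C_mul, coeff_zero_invNM hn]
  funext p
  simp only [Pi.smul_apply, Pi.mul_apply, smul_eq_mul]
  ring

theorem isSmooth_zExponent : IsSmooth (zExponent n m) := by
  rw [zExponent_eq]
  exact ((isSmooth_C contDiff_coordX).mul isSmooth_invNM).const_smul _

theorem fpd_zExponent (μ : Fin 2) :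
    fpd μ (zExponent n m) = Complex.I • (PowerSeries.C (pd μ coordX) * invNM n m) := by
  rw [zExponent_eq, fpd_const_smul, fpd_mul μ (isSmooth_C contDiff_coordX) isSmooth_invNM, fpd_C,
    fpd_invNM]
  simp

theorem C_const_smul (c : ℂ) (f : Plane → ℂ) :
    (PowerSeries.C (c • f) : Formal) = c • PowerSeries.C f := by
  rw [← C_const_mul, ← map_mul]
  rfl

theorem fpd_one_eq_zero (μ : Fin 2) : fpd μ (1 : Formal) = 0 := by
  rw [← map_one PowerSeries.C, fpd_C]
  exact (congrArg _ (pd_const μ 1)).trans (map_zero _)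

/-- The exponent iσ¹ν satisfies (n - mθ)∂_θ = mσ¹∂₁, a derivation equation, so its exponential does
too. The proof runs through truncations, where a remainder appears beyond the order considered. -/
theorem isXFlow_formalExp (hn : 0 < n) : IsXFlow n m (formalExp (zExponent n m)) := by
  set e : Formal :=
    PowerSeries.C (fun p => Complex.exp (PowerSeries.constantCoeff (zExponent n m) p)) with he
  set u : Formal :=
    zExponent n m - PowerSeries.C (PowerSeries.constantCoeff (zExponent n m)) with hu
  have hE : ∀ {N L : ℕ}, N < L → PowerSeries.coeff N (formalExp (zExponent n m)) =
    PowerSeries.coeff N (e * expPartial u L) := fun h => coeff_formalExp _ h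
  have hcs : ContDiff ℝ ∞ (PowerSeries.constantCoeff (zExponent n m)) := by
    rw [constantCoeff_zExponent hn]; exact contDiff_coordX.const_smul (Complex.I / n)
  have hu0 : PowerSeries.constantCoeff u = 0 := by simp [hu]
  have hes : IsSmooth e := isSmooth_C hcs.cexp
  have hus : IsSmooth u := isSmooth_zExponent.sub (isSmooth_C hcs)
  have hS := isSmooth_expPartial hus
  have hfu : ∀ μ, fpd μ u = Complex.I • (PowerSeries.C (pd μ coordX) * invNM n m)
      - (Complex.I / n) • PowerSeries.C (pd μ coordX) := fun μ => by
    rw [hu, fpd_sub μ isSmooth_zExponent (isSmooth_C hcs), fpd_zExponent, fpd_C,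
      constantCoeff_zExponent hn, pd_const_smul, C_const_smul]
  have hdu : dθ u = Complex.I • (m : ℂ) • (PowerSeries.C coordX * (invNM n m * invNM n m)) := by
    rw [hu, dθ_sub, dθ_C, sub_zero, zExponent_eq, dθ_const_smul, dθ_mul, dθ_C, dθ_invNM hn,
      zero_mul, zero_add, mul_smul_comm]
  have hfe : ∀ μ, fpd μ e = (Complex.I / n) • (PowerSeries.C (pd μ coordX) * e) := fun μ => by
    rw [he, fpd_C, pd_cexp μ (differentiable_of_contDiff hcs), constantCoeff_zExponent hn,
      pd_const_smul, ← map_mul, ← C_const_smul]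
    congr 1
    funext p
    simp only [Pi.smul_apply, Pi.mul_apply, smul_eq_mul]
    ring
  have hde : dθ e = 0 := dθ_C _
  have hfS : ∀ μ L, fpd μ (expPartial u (L + 1)) = expPartial u L * fpd μ u := fun μ =>
    derivation_expPartial (fun _ _ => fpd_add μ) (fpd_const_smul μ) (fun _ _ => fpd_mul μ)
      (fpd_one_eq_zero μ) hus
  have hdS : ∀ L, dθ (expPartial u (L + 1)) = expPartial u L * dθ u :=
    derivation_expPartial (fun f g _ _ => dθ_add f g) dθ_const_smul (fun f g _ _ => dθ_mul f g)
      (by simp [dθ]) hus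
  refine ⟨fun N => ?_, ?_, ?_⟩
  · rw [hE N.lt_succ_self]
    exact hes.mul (hS _) N
  · ext1 N
    rw [coeff_fpd, hE (show N < N + 1 + 1 by omega), ← coeff_fpd, fpd_mul 1 hes (hS _), hfS, hfe,
      hfu, pd_one_coordX]
    simp
  · have hν := invNM_spec (m := m) hn
    -- Derivatives falling on the truncation give length L, while the derivative of `e` keeps length
    -- L + 1; the mismatch is the single term in u^L.
    have hres : ∀ L : ℕ, (n : ℂ) • dθ (e * expPartial u (L + 1)) =
        (m : ℂ) • (PowerSeries.X * dθ (e * expPartial u (L + 1))) +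
        (m : ℂ) • (PowerSeries.C coordX * fpd 0 (e * expPartial u (L + 1)))
        - (m : ℂ) • (Complex.I / n) • (1 / (L.factorial : ℂ)) •
          (PowerSeries.C coordX * e * u ^ L) := by
      intro L
      have h2 : expPartial u (L + 1) = expPartial u L + (1 / (L.factorial : ℂ)) • u ^ L :=
        Finset.sum_range_succ _ _
      rw [dθ_mul, fpd_mul 0 hes (hS _), hfS, hdS, hfe, hfu, hde, hdu, pd_zero_coordX, h2, map_one]
      simp only [Algebra.smul_def] at hν ⊢
      linear_combination (e * expPartial u L * algebraMap ℂ Formal Complex.I *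
        algebraMap ℂ Formal m * PowerSeries.C coordX * invNM n m) * hν
    ext1 N
    -- With L = N + 1 the remainder has order above N, and the truncation of length N + 2 is exact
    -- at both orders N and N + 1 that occur.
    have h := congrArg (PowerSeries.coeff N) (hres (N + 1))
    have hz : PowerSeries.coeff N (PowerSeries.C coordX * e * u ^ (N + 1)) = 0 := by
      rw [PowerSeries.coeff_mul]
      refine Finset.sum_eq_zero fun q hq => ?_
      rw [Finset.HasAntidiagonal.mem_antidiagonal] at hq
      rw [coeff_pow_eq_zero hu0 (by omega), mul_zero]
    simp only [map_sub, map_add, coeff_const_smul, hz, smul_zero, sub_zero, coeff_dθ,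
      coeff_X_mul_dθ, PowerSeries.coeff_C_mul, coeff_fpd] at h ⊢
    rw [hE (show N + 1 < N + 1 + 1 by omega), hE (show N < N + 1 + 1 by omega), h]

theorem coeff_zero_formalExp (hn : 0 < n) : PowerSeries.coeff 0 (formalExp (zExponent n m)) =
    fun p => Complex.exp (Complex.I * (p 0 : ℂ) / n) := by
  rw [coeff_formalExp _ zero_lt_one, PowerSeries.coeff_C_mul, constantCoeff_zExponent hn]
  funext p
  simp [expPartial, coordX]
  congr 1
  ring

theorem coeff_zero_mul (f g : Formal) : PowerSeries.coeff 0 (f * g) =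
    PowerSeries.coeff 0 f * PowerSeries.coeff 0 g := by
  simp

theorem coeff_zero_fconj_formalExp (hn : 0 < n) :
    PowerSeries.coeff 0 (fconj (formalExp (zExponent n m))) =
    fun p => Complex.exp (-(Complex.I * (p 0 : ℂ) / n)) := by
  funext p
  rw [coeff_fconj, coeff_zero_formalExp hn, ← Complex.exp_conj]
  congr 1
  simp
  ring

/-- Both sides solve the transport equation and equal 1 at θ = 0. -/
theorem formalExp_mul_fconj (hn : 0 < n) :
    formalExp (zExponent n m) * fconj (formalExp (zExponent n m)) = 1 := by
  have hE := isXFlow_formalExp (m := m) hn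
  refine (hE.mul hE.fconj).swEq.unique hn isXFlow_one.swEq ?_
  rw [coeff_zero_mul, coeff_zero_formalExp hn, coeff_zero_fconj_formalExp hn]
  funext p
  simp [← Complex.exp_add]

/-! ### Star powers -/

theorem smul_constMat_apply (F : Formal) (P : Matrix (Fin n) (Fin n) ℂ) (k l : Fin n) :
    (F • constMat (fun _ => P)) k l = P k l • F := by
  rw [Matrix.smul_apply, constMat, Matrix.of_apply, smul_eq_mul, mul_comm, C_const_mul]

/-- Scalars depending on σ¹ only multiply pointwise, so ⋆-algebra with constant matrices is the
undeformed one. -/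
theorem mstar_smul_constMat {F G : Formal} (hF : fpd 1 F = 0) (hG : fpd 1 G = 0)
    (P Q : Matrix (Fin n) (Fin n) ℂ) :
    mstar (F • constMat (fun _ => P)) (G • constMat (fun _ => Q)) =
      (F * G) • constMat fun _ => P * Q := by
  ext1 k l
  rw [mstar_apply, smul_constMat_apply, Matrix.mul_apply, Finset.sum_smul]
  refine Finset.sum_congr rfl fun j _ => ?_
  rw [smul_constMat_apply, smul_constMat_apply,
    moyal_of_fpd_one_eq_zero (by rw [fpd_const_smul, hF, smul_zero])
      (by rw [fpd_const_smul, hG, smul_zero]), smul_mul_smul_comm]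

theorem dagger_smul_constMat (F : Formal) (P : Matrix (Fin n) (Fin n) ℂ) :
    dagger (F • constMat (fun _ => P)) = fconj F • constMat fun _ => P.conjTranspose := by
  ext1 k l
  rw [dagger, Matrix.of_apply, smul_constMat_apply, smul_constMat_apply, fconj_const_smul]
  rfl

theorem one_eq_smul_constMat : (1 : Mat n) = (1 : Formal) • constMat fun _ => 1 := by
  ext1 k l
  rw [smul_constMat_apply, Matrix.one_apply, Matrix.one_apply]
  split_ifs <;> simp

theorem starPow_smul_constMat {F : Formal} (hF : IsXFlow n m F) (P : Matrix (Fin n) (Fin n) ℂ)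
    (k : ℕ) : starPow (F • constMat fun _ => P) k = (F ^ k) • constMat fun _ => P ^ k := by
  induction k with
  | zero => simpa [starPow] using one_eq_smul_constMat
  | succ k ih =>
    rw [starPow, ih, mstar_smul_constMat (hF.pow k).fpd_one hF.fpd_one, pow_succ, pow_succ]

/-- The matrix valued function `e^{i γ σ^2} P`. -/
def yMat (γ : ℝ) (P : Matrix (Fin n) (Fin n) ℂ) : Mat n :=
  Matrix.of fun k l => PowerSeries.C (yExp γ (P k l))

theorem yMat_apply (γ : ℝ) (P : Matrix (Fin n) (Fin n) ℂ) (k l : Fin n) :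
    yMat γ P k l = PowerSeries.C (yExp γ (P k l)) := rfl

theorem mstar_yMat (γ δ : ℝ) (P Q : Matrix (Fin n) (Fin n) ℂ) :
    mstar (yMat γ P) (yMat δ Q) = yMat (γ + δ) (P * Q) := by
  ext1 k l
  simp only [mstar_apply, yMat_apply]
  rw [Finset.sum_congr rfl fun j _ => moyal_C_yFun (isYFun_yExp γ _) (isYFun_yExp δ _), ← map_sum]
  congr 1
  funext p
  simp only [yExp_mul, Matrix.mul_apply, Finset.sum_apply, yExp, Finset.sum_mul]

theorem dagger_yMat (γ : ℝ) (P : Matrix (Fin n) (Fin n) ℂ) :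
    dagger (yMat γ P) = yMat (-γ) P.conjTranspose := by
  ext1 k l
  rw [dagger, Matrix.of_apply, yMat_apply, yMat_apply, fconj, PowerSeries.map_C, conj_yExp]
  rfl

theorem one_eq_yMat : (1 : Mat n) = yMat 0 1 := by
  ext1 k l
  rw [yMat_apply, yExp_zero_left, Matrix.one_apply, Matrix.one_apply]
  split_ifs
  · exact (map_one _).symm
  · exact (map_zero _).symm

theorem starPow_yMat (γ : ℝ) (P : Matrix (Fin n) (Fin n) ℂ) (k : ℕ) :
    starPow (yMat γ P) k = yMat (k * γ) (P ^ k) := by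
  induction k with
  | zero => simpa [starPow] using one_eq_yMat
  | succ k ih =>
    rw [starPow, ih, mstar_yMat, pow_succ]
    congr 1
    push_cast
    ring

/-! ### Integer powers of unitary matrices -/

theorem isUnit_det_of_mul_conjTranspose {P : Matrix (Fin n) (Fin n) ℂ}
    (h : P * P.conjTranspose = 1) : IsUnit P.det :=
  Matrix.isUnit_det_of_right_inverse h

theorem conjTranspose_eq_inv {P : Matrix (Fin n) (Fin n) ℂ} (h : P * P.conjTranspose = 1) :
    P.conjTranspose = P⁻¹ := (Matrix.inv_eq_right_inv h).symm

theorem zpow_mul_conjTranspose {P : Matrix (Fin n) (Fin n) ℂ} (h : P * P.conjTranspose = 1)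
    (k : ℤ) : P ^ k * (P ^ k).conjTranspose = 1 := by
  rw [Matrix.conjTranspose_zpow, conjTranspose_eq_inv h, Matrix.inv_zpow]
  exact Matrix.mul_nonsing_inv _ ((isUnit_det_of_mul_conjTranspose h).det_zpow k)

theorem zpow_negSucc_conjTranspose {P : Matrix (Fin n) (Fin n) ℂ} (h : P * P.conjTranspose = 1)
    (k : ℕ) : P.conjTranspose ^ (k + 1) = P ^ (Int.negSucc k) := by
  rw [conjTranspose_eq_inv h, Matrix.inv_pow', zpow_negSucc]

theorem starZPow_yMat (γ : ℝ) {P : Matrix (Fin n) (Fin n) ℂ} (h : P * P.conjTranspose = 1)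
    (q : ℤ) : starZPow (yMat γ P) q = yMat (q * γ) (P ^ q) := by
  cases q with
  | ofNat k =>
    rw [starZPow, starPow_yMat]
    simp
  | negSucc k =>
    rw [starZPow, dagger_yMat, starPow_yMat, zpow_negSucc_conjTranspose h, Int.cast_negSucc]
    congr 1
    push_cast
    ring

theorem smul_zpow_of_ne_zero {c : ℂ} (hc : c ≠ 0) {P : Matrix (Fin n) (Fin n) ℂ}
    (h : IsUnit P.det) (q : ℤ) : (c • P) ^ q = c ^ q • P ^ q := by
  have h1 : IsUnit (c • P).det := by
    rw [Matrix.det_smul]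
    exact ((IsUnit.mk0 c hc).pow _).mul h
  have h2 : (c • P)⁻¹ = c⁻¹ • P⁻¹ := by
    refine Matrix.inv_eq_right_inv ?_
    rw [smul_mul_smul_comm, Matrix.mul_nonsing_inv _ h, mul_inv_cancel₀ hc, one_smul]
  induction q using Int.induction_on with
  | zero => simp
  | succ k ih =>
    rw [Matrix.zpow_add_one h1, ih, smul_mul_smul_comm, ← Matrix.zpow_add_one h, ← zpow_add_one₀ hc]
  | pred k ih =>
    rw [Matrix.zpow_sub_one h1, ih, h2, smul_mul_smul_comm, ← Matrix.zpow_sub_one h,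
      ← zpow_sub_one₀ hc]

end NCTorus

namespace NCTorus

variable {n : ℕ} {m : ℤ}

/-! ### Ordered monomials -/

theorem Zθ_zero (b : ℤ) : Zθ n m b 0 =
    formalExp (zExponent n m) • constMat fun _ => shiftMat n ^ b := rfl

theorem Zθ_one (b : ℤ) : Zθ n m b 1 = yMat (1 / n) (clock n m ^ (-b)) := by
  ext1 k l
  rw [yMat_apply]
  change PowerSeries.C (fun p : Plane => (Complex.exp (Complex.I * (p 1 : ℂ) / n) •
    clock n m ^ (-b)) k l) = _
  congr 1
  funext p
  rw [Matrix.smul_apply, yExp, smul_eq_mul, mul_comm]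
  congr 2
  push_cast
  ring

theorem isStarUnitary_Zθ (hn : 0 < n) (b : ℤ) (μ : Fin 2) : IsStarUnitary (Zθ n m b μ) := by
  have hE := isXFlow_formalExp (m := m) hn
  fin_cases μ
  · have h := zpow_mul_conjTranspose (shiftMat_mul_conjTranspose (n := n)) b
    simp only [Fin.zero_eta, IsStarUnitary, Zθ_zero, dagger_smul_constMat,
      mstar_smul_constMat hE.fpd_one hE.fconj.fpd_one,
      mstar_smul_constMat hE.fconj.fpd_one hE.fpd_one, h, mul_eq_one_comm.1 h,
      formalExp_mul_fconj hn, mul_eq_one_comm.1 (formalExp_mul_fconj (m := m) hn),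
      one_eq_smul_constMat, and_self]
  · have h := zpow_mul_conjTranspose (clock_mul_conjTranspose (n := n) (m := m)) (-b)
    simp only [Fin.mk_one, IsStarUnitary, Zθ_one, dagger_yMat, mstar_yMat, h,
      mul_eq_one_comm.1 h, add_neg_cancel, neg_add_cancel, one_eq_yMat, and_self]

theorem exists_starZPow_Zθ_zero (hn : 0 < n) (b p : ℤ) : ∃ F, IsXFlow n m F ∧
    PowerSeries.coeff 0 F = (fun x => Complex.exp (Complex.I * (x 0 : ℂ) / n) ^ p) ∧
    starZPow (Zθ n m b 0) p = F • constMat fun _ => (shiftMat n ^ b) ^ p := by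
  have hE := isXFlow_formalExp (m := m) hn
  have hpow : ∀ (f : Formal) (k : ℕ),
      PowerSeries.coeff 0 (f ^ k) = PowerSeries.coeff 0 f ^ k := fun f k => by simp
  cases p with
  | ofNat k =>
    refine ⟨_, hE.pow k, ?_, ?_⟩
    · rw [hpow, coeff_zero_formalExp hn]
      funext x
      simp
    · rw [starZPow, Zθ_zero, starPow_smul_constMat hE]
      simp
  | negSucc k =>
    refine ⟨_, hE.fconj.pow (k + 1), ?_, ?_⟩
    · rw [hpow, coeff_zero_fconj_formalExp hn]
      funext x
      rw [zpow_negSucc, Pi.pow_apply, Complex.exp_neg, inv_pow]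
    · rw [starZPow, Zθ_zero, dagger_smul_constMat, starPow_smul_constMat hE.fconj,
        zpow_negSucc_conjTranspose
          (zpow_mul_conjTranspose (shiftMat_mul_conjTranspose (n := n)) b)]

theorem starZPow_Zθ_one (b q : ℤ) :
    starZPow (Zθ n m b 1) q = yMat (q * (1 / n)) ((clock n m ^ (-b)) ^ q) := by
  rw [Zθ_one, starZPow_yMat]
  exact zpow_mul_conjTranspose (clock_mul_conjTranspose (n := n) (m := m)) (-b)

theorem Zcl_zero_zpow (b p : ℤ) (x : Plane) : Zcl n m b 0 x ^ p =
    Complex.exp (Complex.I * (x 0 : ℂ) / n) ^ p • (shiftMat n ^ b) ^ p :=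
  smul_zpow_of_ne_zero (Complex.exp_ne_zero _)
    ((isUnit_det_of_mul_conjTranspose shiftMat_mul_conjTranspose).det_zpow b) p

theorem Zcl_one_zpow (b q : ℤ) (x : Plane) : Zcl n m b 1 x ^ q =
    Complex.exp (Complex.I * (x 1 : ℂ) / n) ^ q • (clock n m ^ (-b)) ^ q :=
  smul_zpow_of_ne_zero (Complex.exp_ne_zero _)
    ((isUnit_det_of_mul_conjTranspose clock_mul_conjTranspose).det_zpow (-b)) q

/-- The first factor is a solution in σ¹ alone, and the second is a matrix of functions of σ²
multiplied from the right, which preserves the equation. The order of the two factors is essential: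
from the left they would create a drift. -/
theorem isSWAdj_monomial (hn : 0 < n) (b p q : ℤ) :
    IsSWAdj (Aθ n m) (fun x => Zcl n m b 0 x ^ p * Zcl n m b 1 x ^ q)
      (mstar (starZPow (Zθ n m b 0) p) (starZPow (Zθ n m b 1) q)) := by
  obtain ⟨F, hF, hF0, hp⟩ := exists_starZPow_Zθ_zero (m := m) hn b p
  rw [hp, starZPow_Zθ_one]
  have hFs : ∀ c : ℂ, IsXFlow n m (c • F) := fun c => by
    refine ⟨hF.smooth.const_smul c, by rw [fpd_const_smul, hF.fpd_one, smul_zero], ?_⟩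
    have h := hF.eq
    rw [dθ_const_smul, fpd_const_smul]
    simp only [Algebra.smul_def] at h ⊢
    linear_combination algebraMap ℂ Formal c * h
  refine (isSWAdj_iff hn _ _).2 ⟨fun k l => ?_, fun k l => ?_, fun k l => ?_⟩
  · rw [mstar_apply]
    refine IsSmooth.sum fun j _ => ?_
    rw [smul_constMat_apply, yMat_apply]
    exact isSmooth_moyal_yFun_right (hFs _).smooth (isYFun_yExp _ _)
  · rw [mstar_apply, map_sum]
    funext x
    rw [Zcl_zero_zpow, Zcl_one_zpow, Matrix.mul_apply, Finset.sum_apply]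
    refine Finset.sum_congr rfl fun j _ => ?_
    rw [smul_constMat_apply, yMat_apply, coeff_zero_moyal, coeff_const_smul, hF0]
    simp only [Pi.mul_apply, Pi.smul_apply, Matrix.smul_apply, smul_eq_mul,
      PowerSeries.coeff_zero_eq_constantCoeff, PowerSeries.constantCoeff_C, yExp]
    have h : Complex.exp (Complex.I * ((q * (1 / n) : ℝ) : ℂ) * (x 1 : ℂ)) =
        Complex.exp (Complex.I * (x 1 : ℂ) / n) ^ q := by
      rw [← Complex.exp_int_mul]
      congr 1
      push_cast
      ring
    rw [h]
    ring
  · rw [mstar_apply]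
    refine SWEq.sum (fun j _ => ?_) fun j _ => ?_
    · rw [smul_constMat_apply, yMat_apply]
      exact isSmooth_moyal_yFun_right (hFs _).smooth (isYFun_yExp _ _)
    · rw [smul_constMat_apply, yMat_apply]
      exact (hFs _).swEq.moyal_yFun_right (hFs _).smooth (isYFun_yExp _ _)

/-! ### Clock and shift commutation, classical periodicity of the monomials -/

theorem semiconjBy_shiftMat_clock : SemiconjBy (shiftMat n) (clock n m)
    (Complex.exp (2 * Real.pi * Complex.I * m / n) • clock n m) := by
  rw [SemiconjBy, shiftMat_mul_clock, Matrix.smul_mul]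

theorem semiconjBy_clock_shiftMat : SemiconjBy (clock n m) (shiftMat n)
    ((Complex.exp (2 * Real.pi * Complex.I * m / n))⁻¹ • shiftMat n) := by
  rw [SemiconjBy, Matrix.smul_mul, shiftMat_mul_clock, smul_smul,
    inv_mul_cancel₀ (Complex.exp_ne_zero _), one_smul]

theorem isUnit_det_clock : IsUnit (clock n m).det :=
  isUnit_det_of_mul_conjTranspose clock_mul_conjTranspose

theorem isUnit_det_shiftMat : IsUnit (shiftMat n).det :=
  isUnit_det_of_mul_conjTranspose shiftMat_mul_conjTranspose

theorem isUnit_det_smul {c : ℂ} (hc : c ≠ 0) {P : Matrix (Fin n) (Fin n) ℂ}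
    (h : IsUnit P.det) : IsUnit (c • P).det := by
  rw [Matrix.det_smul]
  exact ((IsUnit.mk0 c hc).pow _).mul h

theorem shiftMat_mul_clock_zpow (k : ℤ) : shiftMat n * clock n m ^ k =
    Complex.exp (2 * Real.pi * Complex.I * m / n) ^ k • (clock n m ^ k * shiftMat n) := by
  have h := Matrix.SemiconjBy.zpow_right isUnit_det_clock
    (isUnit_det_smul (Complex.exp_ne_zero _) isUnit_det_clock)
    (semiconjBy_shiftMat_clock (n := n) (m := m)) k
  rw [SemiconjBy, smul_zpow_of_ne_zero (Complex.exp_ne_zero _) isUnit_det_clock,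
    Matrix.smul_mul] at h
  exact h

theorem clock_mul_shiftMat_zpow (k : ℤ) : clock n m * shiftMat n ^ k =
    (Complex.exp (2 * Real.pi * Complex.I * m / n))⁻¹ ^ k • (shiftMat n ^ k * clock n m) := by
  have h0 := inv_ne_zero (Complex.exp_ne_zero (2 * Real.pi * Complex.I * m / n))
  have h := Matrix.SemiconjBy.zpow_right isUnit_det_shiftMat
    (isUnit_det_smul h0 isUnit_det_shiftMat)
    (semiconjBy_clock_shiftMat (n := n) (m := m)) k
  rw [SemiconjBy, smul_zpow_of_ne_zero h0 isUnit_det_shiftMat, Matrix.smul_mul] at h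
  exact h

/-- From 1 = an - bm, the phase e^{2πi/n} equals e^{-2πibm/n} up to e^{2πia} = 1. It matches
translation of the monomials with the commutation phases of U and V. -/
theorem exp_two_pi_zpow_eq (hn : 0 < n) {a b : ℤ} (hab : a * n - b * m = 1) (p : ℤ) :
    Complex.exp (Complex.I * (2 * Real.pi) / n) ^ p =
      (Complex.exp (2 * Real.pi * Complex.I * m / n))⁻¹ ^ (b * p) := by
  have hn' : (n : ℂ) ≠ 0 := by exact_mod_cast hn.ne'
  have hab' : (a : ℂ) * n - b * m = 1 := by exact_mod_cast hab
  rw [← Complex.exp_neg, ← Complex.exp_int_mul, ← Complex.exp_int_mul,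
    ← mul_one (Complex.exp (((b * p : ℤ) : ℂ) * _)),
    ← Complex.exp_int_mul_two_pi_mul_I (a * p), ← Complex.exp_add]
  congr 1
  push_cast
  field_simp
  linear_combination (-p : ℂ) * hab'

theorem monomial_mem_Endcl (hn : 0 < n) {a b : ℤ} (hab : a * n - b * m = 1) (p q : ℤ) :
    (fun x => Zcl n m b 0 x ^ p * Zcl n m b 1 x ^ q) ∈ Endcl n m := by
  refine ⟨fun k l => ?_, fun α x => ?_⟩
  -- Smoothness is read off from order zero of the quantized monomial.
  · have h := ((isSWAdj_monomial (m := m) hn b p q).1 k l) 0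
    have h2 := (isSWAdj_monomial (m := m) hn b p q).2.1 k l
    rw [PowerSeries.coeff_zero_eq_constantCoeff_apply, h2] at h
    exact h
  · have hΩ : IsUnit (Ωcl n m α x).det := by
      rw [Ωcl_eq_smul]
      exact isUnit_det_smul (Complex.exp_ne_zero _)
        (isUnit_det_of_mul_conjTranspose (Ωconst_mul_conjTranspose α))
    have hV : (shiftMat n ^ b) ^ p = shiftMat n ^ (b * p) :=
      (Matrix.zpow_mul _ isUnit_det_shiftMat b p).symm
    have hU : (clock n m ^ (-b)) ^ q = clock n m ^ (-b * q) :=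
      (Matrix.zpow_mul _ isUnit_det_clock (-b) q).symm
    -- The condition is first proved with the inverse moved to the other side, as a commutation
    -- relation.
    have key : (Zcl n m b 0 (translate α x) ^ p * Zcl n m b 1 (translate α x) ^ q) * Ωcl n m α x =
        Ωcl n m α x * (Zcl n m b 0 x ^ p * Zcl n m b 1 x ^ q) := by
      have hexp : ∀ t : ℝ, Complex.exp (Complex.I * ((t + 2 * Real.pi : ℝ) : ℂ) / n) =
          Complex.exp (Complex.I * (t : ℂ) / n) * Complex.exp (Complex.I * (2 * Real.pi) / n) :=
        fun t => by
          rw [← Complex.exp_add]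
          congr 1
          push_cast
          ring
      simp only [Zcl_zero_zpow, Zcl_one_zpow, Ωcl_eq_smul, translate_apply, hV, hU]
      fin_cases α
      · simp only [Fin.zero_eta, if_true, Ωconst, Matrix.cons_val_zero, one_ne_zero, if_false,
          add_zero, hexp, Matrix.smul_mul, Matrix.mul_smul, smul_smul, mul_zpow,
          exp_two_pi_zpow_eq hn hab p]
        rw [← mul_assoc (clock n m), clock_mul_shiftMat_zpow, Matrix.smul_mul, smul_smul,
          mul_assoc (shiftMat n ^ (b * p)), mul_assoc (shiftMat n ^ (b * p)),
          (Matrix.Commute.self_zpow (clock n m) _).eq]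
        congr 1
        ring
      · simp only [Fin.mk_one, if_true, Ωconst, Matrix.cons_val_one, Matrix.cons_val_fin_one,
          zero_ne_one, if_false, add_zero, hexp, Matrix.smul_mul, Matrix.mul_smul, smul_smul,
          mul_zpow, exp_two_pi_zpow_eq hn hab q]
        rw [← mul_assoc (shiftMat n), (Matrix.Commute.self_zpow (shiftMat n) _).eq,
          mul_assoc (shiftMat n ^ (b * p)), mul_assoc (shiftMat n ^ (b * p)),
          shiftMat_mul_clock_zpow, Matrix.mul_smul, smul_smul]
        congr 1
        rw [inv_zpow', ← neg_mul]
        ring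
    change Zcl n m b 0 (translate α x) ^ p * Zcl n m b 1 (translate α x) ^ q = _
    rw [← key, mul_assoc, Matrix.mul_nonsing_inv _ hΩ, mul_one]

end NCTorus

namespace NCTorus

/-! ### Termwise differentiation of rapidly converging families -/

/-- A family of smooth functions all of whose iterated partial derivatives are, locally uniformly,
of order `1 / (1 + s²)`. -/
structure IsRapid (F : ℤ → Plane → ℂ) : Prop where
  smooth : ∀ s, ContDiff ℝ ∞ (F s)
  bound : ∀ (w : List (Fin 2)) (R : ℝ), ∃ C : ℝ, ∀ s p, |p 0| ≤ R → |p 1| ≤ R →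
    ‖w.foldr pd (F s) p‖ ≤ C * (1 / (1 + (s : ℝ) ^ 2))

theorem contDiff_foldr_pd (w : List (Fin 2)) {f : Plane → ℂ} (hf : ContDiff ℝ ∞ f) :
    ContDiff ℝ ∞ (w.foldr pd f) := by
  induction w with
  | nil => exact hf
  | cons μ w ih => exact pd_contDiff μ ih

theorem foldr_pd_add (w : List (Fin 2)) {f g : Plane → ℂ} (hf : ContDiff ℝ ∞ f)
    (hg : ContDiff ℝ ∞ g) : w.foldr pd (f + g) = w.foldr pd f + w.foldr pd g := by
  induction w with
  | nil => rfl
  | cons μ w ih =>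
    rw [List.foldr_cons, ih, pd_add μ (differentiable_of_contDiff (contDiff_foldr_pd w hf))
      (differentiable_of_contDiff (contDiff_foldr_pd w hg))]
    rfl

theorem foldr_pd_const_smul (w : List (Fin 2)) (c : ℂ) (f : Plane → ℂ) :
    w.foldr pd (c • f) = c • w.foldr pd f := by
  induction w with
  | nil => rfl
  | cons μ w ih => rw [List.foldr_cons, ih, pd_const_smul]; rfl

theorem IsRapid.pd {F : ℤ → Plane → ℂ} (hF : IsRapid F) (μ : Fin 2) :
    IsRapid fun s => pd μ (F s) := by
  refine ⟨fun s => pd_contDiff μ (hF.smooth s), fun w R => ?_⟩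
  -- Bounds are assumed for all words of derivatives, so the extra derivative is absorbed as the
  -- innermost letter.
  obtain ⟨C, hC⟩ := hF.bound (w ++ [μ]) R
  refine ⟨C, fun s p h0 h1 => ?_⟩
  have := hC s p h0 h1
  rwa [List.foldr_append] at this

theorem IsRapid.add {F G : ℤ → Plane → ℂ} (hF : IsRapid F) (hG : IsRapid G) :
    IsRapid fun s => F s + G s := by
  refine ⟨fun s => (hF.smooth s).add (hG.smooth s), fun w R => ?_⟩
  obtain ⟨C, hC⟩ := hF.bound w R
  obtain ⟨D, hD⟩ := hG.bound w R
  refine ⟨C + D, fun s p h0 h1 => ?_⟩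
  rw [foldr_pd_add w (hF.smooth s) (hG.smooth s), add_mul]
  exact (norm_add_le _ _).trans (add_le_add (hC s p h0 h1) (hD s p h0 h1))

theorem IsRapid.const_smul {F : ℤ → Plane → ℂ} (c : ℂ) (hF : IsRapid F) :
    IsRapid fun s => c • F s := by
  refine ⟨fun s => (hF.smooth s).const_smul c, fun w R => ?_⟩
  obtain ⟨C, hC⟩ := hF.bound w R
  refine ⟨‖c‖ * C, fun s p h0 h1 => ?_⟩
  rw [foldr_pd_const_smul, Pi.smul_apply, norm_smul, mul_assoc]
  exact mul_le_mul_of_nonneg_left (hC s p h0 h1) (norm_nonneg c)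

theorem isRapid_zero : IsRapid fun _ => 0 := by
  refine ⟨fun s => contDiff_const, fun w R => ⟨0, fun s p _ _ => ?_⟩⟩
  have h := foldr_pd_const_smul w 0 0
  rw [zero_smul, zero_smul] at h
  rw [h]
  simp

theorem IsRapid.sum {ι : Type*} {t : Finset ι} {F : ι → ℤ → Plane → ℂ}
    (hF : ∀ i ∈ t, IsRapid (F i)) : IsRapid fun s => ∑ i ∈ t, F i s := by
  classical
  induction t using Finset.induction_on with
  | empty => simpa using isRapid_zero
  | insert i t hi ih =>
    simp only [Finset.sum_insert hi]
    exact (hF i (Finset.mem_insert_self i t)).add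
      (ih fun j hj => hF j (Finset.mem_insert_of_mem hj))

theorem summable_one_div_one_add_sq : Summable fun s : ℤ => 1 / (1 + (s : ℝ) ^ 2) := by
  have h : Summable fun s : ℤ => 1 / (s : ℝ) ^ 2 := Real.summable_one_div_int_pow.2 one_lt_two
  refine Summable.of_norm_bounded_eventually h ?_
  have : ∀ᶠ s : ℤ in Filter.cofinite, s ≠ 0 := Filter.eventually_cofinite_ne 0
  filter_upwards [this] with s hs
  have hs' : 0 < (s : ℝ) ^ 2 := by positivity
  rw [Real.norm_of_nonneg (by positivity)]
  exact one_div_le_one_div_of_le hs' (by linarith)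

theorem exists_box (p : Plane) : ∃ R : ℝ, |p 0| < R ∧ |p 1| < R :=
  ⟨max |p 0| |p 1| + 1, by linarith [le_max_left |p 0| |p 1|],
    by linarith [le_max_right |p 0| |p 1|]⟩

theorem IsRapid.summable {F : ℤ → Plane → ℂ} (hF : IsRapid F) (p : Plane) :
    Summable fun s => F s p := by
  obtain ⟨R, h0, h1⟩ := exists_box p
  obtain ⟨C, hC⟩ := hF.bound [] R
  exact Summable.of_norm_bounded (summable_one_div_one_add_sq.mul_left C)
    fun s => hC s p h0.le h1.le

theorem plane_eq (v : Plane) : v = v 0 • Pi.single 0 1 + v 1 • Pi.single 1 1 := by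
  funext i
  fin_cases i <;> simp

theorem fderiv_apply_eq (f : Plane → ℂ) (p v : Plane) :
    fderiv ℝ f p v = (v 0 : ℂ) * pd 0 f p + (v 1 : ℂ) * pd 1 f p := by
  conv_lhs => rw [plane_eq v, map_add, map_smul, map_smul]
  rfl

theorem norm_fderiv_le (f : Plane → ℂ) (p : Plane) :
    ‖fderiv ℝ f p‖ ≤ ‖pd 0 f p‖ + ‖pd 1 f p‖ := by
  refine ContinuousLinearMap.opNorm_le_bound _ (by positivity) fun v => ?_
  rw [fderiv_apply_eq, add_mul]
  refine (norm_add_le _ _).trans (add_le_add ?_ ?_)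
  · rw [norm_mul, mul_comm, Complex.norm_real]
    exact mul_le_mul_of_nonneg_left (norm_le_pi_norm v 0) (norm_nonneg _)
  · rw [norm_mul, mul_comm, Complex.norm_real]
    exact mul_le_mul_of_nonneg_left (norm_le_pi_norm v 1) (norm_nonneg _)

/-- The sum of a family of functions. -/
def familySum (F : ℤ → Plane → ℂ) : Plane → ℂ := fun p => ∑' s, F s p

/-- On an open box around the point the derivatives are dominated by a summable sequence; the box is
convex, hence preconnected, as the theorem on derivatives of series requires. -/
theorem IsRapid.hasFDerivAt {F : ℤ → Plane → ℂ} (hF : IsRapid F) (p : Plane) :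
    HasFDerivAt (familySum F) (∑' s, fderiv ℝ (F s) p) p ∧
      Summable fun s => fderiv ℝ (F s) p := by
  obtain ⟨R, h0, h1⟩ := exists_box p
  obtain ⟨C, hC⟩ := hF.bound [0] R
  obtain ⟨D, hD⟩ := hF.bound [1] R
  set U : Set Plane := {q | |q 0| < R ∧ |q 1| < R} with hU
  have hUo : IsOpen U :=
    (isOpen_lt (continuous_apply 0).abs continuous_const).inter
      (isOpen_lt (continuous_apply 1).abs continuous_const)
  have hUc : Convex ℝ U := by
    intro x hx y hy a b ha hb hab
    have key : ∀ i : Fin 2, |x i| < R → |y i| < R → |(a • x + b • y) i| < R := fun i h h' => by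
      rw [abs_lt] at h h' ⊢
      have := (convex_Ioo (-R) R) h h' ha hb hab
      simpa using this
    exact ⟨key 0 hx.1 hy.1, key 1 hx.2 hy.2⟩
  have hu : Summable fun s : ℤ => (C + D) * (1 / (1 + (s : ℝ) ^ 2)) :=
    summable_one_div_one_add_sq.mul_left _
  have hb : ∀ s, ∀ q ∈ U, ‖fderiv ℝ (F s) q‖ ≤ (C + D) * (1 / (1 + (s : ℝ) ^ 2)) := by
    intro s q hq
    rw [add_mul]
    exact (norm_fderiv_le (F s) q).trans
      (add_le_add (hC s q hq.1.le hq.2.le) (hD s q hq.1.le hq.2.le))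
  refine ⟨hasFDerivAt_tsum_of_isPreconnected hu hUo hUc.isPreconnected
    (fun s q _ => (differentiable_of_contDiff (hF.smooth s) q).hasFDerivAt) hb
    (show p ∈ U from ⟨h0, h1⟩) (hF.summable p) (show p ∈ U from ⟨h0, h1⟩), ?_⟩
  exact Summable.of_norm_bounded hu fun s => hb s p ⟨h0, h1⟩

theorem IsRapid.pd_familySum {F : ℤ → Plane → ℂ} (hF : IsRapid F) (μ : Fin 2) :
    NCTorus.pd μ (familySum F) = familySum fun s => NCTorus.pd μ (F s) := by
  funext p
  obtain ⟨h, hs⟩ := hF.hasFDerivAt p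
  rw [NCTorus.pd, h.fderiv]
  exact (ContinuousLinearMap.apply ℝ ℂ (Pi.single μ (1 : ℝ) : Plane)).map_tsum hs

/-- The partial derivatives of the sum are sums of rapid families again, so the induction must range
over all families at once. -/
theorem IsRapid.contDiff_nat (N : ℕ) : ∀ {F : ℤ → Plane → ℂ}, IsRapid F →
    ContDiff ℝ N (familySum F) := by
  induction N with
  | zero =>
    intro F hF
    refine contDiff_zero.2 (continuous_iff_continuousAt.2 fun p => ?_)
    exact (hF.hasFDerivAt p).1.continuousAt
  | succ N ih =>
    intro F hF
    have hN : ((N + 1 : ℕ) : WithTop ℕ∞) = (N : WithTop ℕ∞) + 1 := by push_cast; rfl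
    rw [hN, contDiff_succ_iff_fderiv_apply]
    refine ⟨fun p => (hF.hasFDerivAt p).1.differentiableAt, by simp, fun v => ?_⟩
    simp only [fderiv_apply_eq, hF.pd_familySum]
    exact (contDiff_const.mul (ih (hF.pd 0))).add (contDiff_const.mul (ih (hF.pd 1)))

theorem IsRapid.contDiff {F : ℤ → Plane → ℂ} (hF : IsRapid F) : ContDiff ℝ ∞ (familySum F) :=
  contDiff_infty.2 fun N => IsRapid.contDiff_nat N hF

end NCTorus

namespace NCTorus

/-! ### Oscillating families -/

/-- The affine functions `σ^2 / 2π + c + n s`. -/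
def tau (n : ℕ) (c : ℝ) (s : ℤ) (p : Plane) : ℝ := p 1 / (2 * Real.pi) + c + n * s

/-- Formal span of the families `e^{i η σ^1 τ} (σ^1)^a τ^b φ(τ)` with `τ = tau n c s` and
`φ ∈ T`. -/
inductive OscSpan (n : ℕ) (c η : ℝ) (T : Set (ℝ → ℂ)) : (ℤ → Plane → ℂ) → Prop
  | base (a b : ℕ) (φ : ℝ → ℂ) (hφ : φ ∈ T) : OscSpan n c η T fun s =>
      (fun p => Complex.exp (((Complex.I * η) • (coordX * fun p => (tau n c s p : ℂ))) p)) *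
        coordX ^ a * (fun p => (tau n c s p : ℂ)) ^ b * fun p => φ (tau n c s p)
  | zero : OscSpan n c η T fun _ => 0
  | add (F G : ℤ → Plane → ℂ) (hF : OscSpan n c η T F) (hG : OscSpan n c η T G) :
      OscSpan n c η T fun s => F s + G s
  | smul (k : ℂ) (F : ℤ → Plane → ℂ) (hF : OscSpan n c η T F) : OscSpan n c η T fun s => k • F s

/-- A set of smooth functions of one variable stable under derivation. -/
def DerivStable (T : Set (ℝ → ℂ)) : Prop := ∀ φ ∈ T, ContDiff ℝ ∞ φ ∧ deriv φ ∈ T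

variable {n : ℕ} {c η : ℝ} {T : Set (ℝ → ℂ)}

theorem contDiff_comp_tau {φ : ℝ → ℂ} (hφ : ContDiff ℝ ∞ φ) (s : ℤ) :
    ContDiff ℝ ∞ fun p => φ (tau n c s p) := by
  refine hφ.comp ?_
  unfold tau
  fun_prop

theorem pd_comp_tau (μ : Fin 2) {φ : ℝ → ℂ} (hφ : ContDiff ℝ ∞ φ) (s : ℤ) :
    pd μ (fun p => φ (tau n c s p)) =
      (if μ = 1 then (1 / (2 * Real.pi) : ℂ) else 0) • fun p => deriv φ (tau n c s p) := by
  have hd : ∀ t : ℝ, HasDerivAt (fun t : ℝ => φ (t / (2 * Real.pi) + c + n * s))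
      ((1 / (2 * Real.pi) : ℝ) • deriv φ (t / (2 * Real.pi) + c + n * s)) t := by
    intro t
    have h1 : HasDerivAt (fun t : ℝ => t / (2 * Real.pi) + c + n * s) (1 / (2 * Real.pi)) t :=
      (((hasDerivAt_id t).div_const _).add_const _).add_const _
    exact ((hφ.differentiable (by simp) _).hasDerivAt).scomp t h1
  have h := pd_comp_coord μ 1 (G := fun t : ℝ => φ (t / (2 * Real.pi) + c + n * s))
    fun t => (hd t).differentiableAt
  refine h.trans ?_
  funext p
  rw [(hd (p 1)).deriv]
  split_ifs with hμ
  · rw [Pi.smul_apply, Complex.real_smul, smul_eq_mul]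
    push_cast
    rfl
  · simp

theorem contDiff_tau (s : ℤ) : ContDiff ℝ ∞ fun p => (tau n c s p : ℂ) :=
  contDiff_comp_tau (φ := fun t : ℝ => (t : ℂ)) Complex.ofRealCLM.contDiff s

theorem pd_tau (μ : Fin 2) (s : ℤ) : pd μ (fun p => (tau n c s p : ℂ)) =
    fun _ => if μ = 1 then (1 / (2 * Real.pi) : ℂ) else 0 := by
  rw [pd_comp_tau μ (φ := fun t : ℝ => (t : ℂ)) Complex.ofRealCLM.contDiff]
  funext p
  have h : deriv (fun t : ℝ => (t : ℂ)) (tau n c s p) = 1 := Complex.ofRealCLM.hasDerivAt.deriv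
  simp [h]

theorem pd_pow (μ : Fin 2) {f : Plane → ℂ} (hf : Differentiable ℝ f) (k : ℕ) :
    pd μ (f ^ k) = (k : ℂ) • (f ^ (k - 1) * pd μ f) := by
  induction k with
  | zero =>
    rw [pow_zero, Nat.cast_zero, zero_smul]
    exact pd_const μ 1
  | succ k ih =>
    rw [pow_succ, pd_mul μ (hf.pow k) hf, ih]
    cases k with
    | zero => simp
    | succ k =>
      simp only [Nat.add_sub_cancel, Algebra.smul_def, pow_succ, Nat.cast_succ, map_add, map_one]
      ring

theorem DerivStable.smooth (hT : DerivStable T) {F : ℤ → Plane → ℂ} (hF : OscSpan n c η T F)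
    (s : ℤ) : ContDiff ℝ ∞ (F s) := by
  induction hF with
  | base a b φ hφ =>
    exact (((((contDiff_coordX.mul (contDiff_tau s)).const_smul (Complex.I * η)).cexp).mul
      (contDiff_coordX.pow a)).mul ((contDiff_tau s).pow b)).mul
        (contDiff_comp_tau (hT φ hφ).1 s)
  | zero => exact contDiff_const
  | add F G _ _ ihF ihG => exact ihF.add ihG
  | smul k F _ ih => exact ih.const_smul k

/-- The derivatives of phase, powers and profile are again phase times monomials times a profile in
`T`, with coefficients independent of s; uniform estimates later need this independence. -/
theorem DerivStable.pd (hT : DerivStable T) {F : ℤ → Plane → ℂ} (hF : OscSpan n c η T F)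
    (μ : Fin 2) : OscSpan n c η T fun s => pd μ (F s) := by
  induction hF with
  | base a b φ hφ =>
    have hx := differentiable_of_contDiff contDiff_coordX
    have ht : ∀ s, Differentiable ℝ fun p => (tau n c s p : ℂ) :=
      fun s => differentiable_of_contDiff (contDiff_tau s)
    have hf : ∀ s, Differentiable ℝ ((Complex.I * η) • (coordX * fun p => (tau n c s p : ℂ))) :=
      fun s => (hx.mul (ht s)).const_smul _
    have hφd : ∀ s, Differentiable ℝ fun p => φ (tau n c s p) :=
      fun s => differentiable_of_contDiff (contDiff_comp_tau (hT φ hφ).1 s)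
    have hpd : ∀ s, NCTorus.pd μ
        ((fun p => Complex.exp (((Complex.I * η) • (coordX * fun p => (tau n c s p : ℂ))) p)) *
          coordX ^ a * (fun p => (tau n c s p : ℂ)) ^ b * fun p => φ (tau n c s p)) = _ := fun s => by
      rw [pd_mul μ ((((hf s).cexp).mul (hx.pow a)).mul ((ht s).pow b)) (hφd s),
        pd_mul μ (((hf s).cexp).mul (hx.pow a)) ((ht s).pow b),
        pd_mul μ ((hf s).cexp) (hx.pow a), pd_cexp μ (hf s), pd_const_smul, pd_mul μ hx (ht s),
        pd_pow μ hx, pd_pow μ (ht s), pd_tau, pd_comp_tau μ (hT φ hφ).1]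
    simp only [hpd]
    fin_cases μ
    -- The truncated exponent `a - 1` is harmless at a = 0, where its coefficient vanishes; likewise
    -- `b - 1` in the other case.
    · have h := OscSpan.add _ _
        (OscSpan.smul (Complex.I * η) _ (OscSpan.base (n := n) (c := c) (η := η) a (b + 1) φ hφ))
        (OscSpan.smul (a : ℂ) _ (OscSpan.base (n := n) (c := c) (η := η) (a - 1) b φ hφ))
      convert h using 1
      funext s p
      simp only [Fin.zero_eta, pd_zero_coordX, zero_ne_one, if_false, Pi.add_apply, Pi.mul_apply,
        Pi.smul_apply, Pi.pow_apply, Pi.one_apply, smul_eq_mul]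
      ring
    · have h := OscSpan.smul (1 / (2 * Real.pi) : ℂ) _ (OscSpan.add _ _ (OscSpan.add _ _
        (OscSpan.smul (Complex.I * η) _ (OscSpan.base (n := n) (c := c) (η := η) (a + 1) b φ hφ))
        (OscSpan.smul (b : ℂ) _ (OscSpan.base (n := n) (c := c) (η := η) a (b - 1) φ hφ)))
        (OscSpan.base (n := n) (c := c) (η := η) a b _ (hT φ hφ).2))
      convert h using 1
      funext s p
      simp only [Fin.mk_one, pd_one_coordX, if_true, Pi.add_apply, Pi.mul_apply,
        Pi.smul_apply, Pi.pow_apply, Pi.zero_apply, smul_eq_mul]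
      ring
  | zero =>
    simp only [pd_zero]
    exact OscSpan.zero
  | add F G hF hG ihF ihG =>
    have h : ∀ s, NCTorus.pd μ (F s + G s) = NCTorus.pd μ (F s) + NCTorus.pd μ (G s) := fun s =>
      pd_add μ (differentiable_of_contDiff (hT.smooth hF s))
        (differentiable_of_contDiff (hT.smooth hG s))
    simp only [h]
    exact OscSpan.add _ _ ihF ihG
  | smul k F hF ih =>
    simp only [pd_const_smul]
    exact OscSpan.smul k _ ih

theorem DerivStable.iterate_pd (hT : DerivStable T) {F : ℤ → Plane → ℂ} (hF : OscSpan n c η T F)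
    (μ : Fin 2) (r : ℕ) : OscSpan n c η T fun s => (NCTorus.pd μ)^[r] (F s) := by
  induction r with
  | zero => exact hF
  | succ r ih =>
    simp only [Function.iterate_succ_apply']
    exact hT.pd ih μ

theorem DerivStable.foldr_pd (hT : DerivStable T) {F : ℤ → Plane → ℂ} (hF : OscSpan n c η T F)
    (w : List (Fin 2)) : OscSpan n c η T fun s => w.foldr NCTorus.pd (F s) := by
  induction w with
  | nil => exact hF
  | cons μ w ih => exact hT.pd ih μ

theorem OscSpan.sum {ι : Type*} {t : Finset ι} {F : ι → ℤ → Plane → ℂ}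
    (hF : ∀ i ∈ t, OscSpan n c η T (F i)) : OscSpan n c η T fun s => ∑ i ∈ t, F i s := by
  classical
  induction t using Finset.induction_on with
  | empty => simpa using OscSpan.zero
  | insert i t hi ih =>
    simp only [Finset.sum_insert hi]
    exact OscSpan.add _ _ (hF i (Finset.mem_insert_self i t))
      (ih fun j hj => hF j (Finset.mem_insert_of_mem hj))

/-- The constant functions. -/
def constFuns : Set (ℝ → ℂ) := {φ | ∃ z : ℂ, φ = fun _ => z}

/-- The Schwartz functions. -/
def schwartzFuns : Set (ℝ → ℂ) := {φ | ∃ ψ : SchwartzMap ℝ ℂ, φ = ψ}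

theorem derivStable_constFuns : DerivStable constFuns := by
  rintro φ ⟨z, rfl⟩
  exact ⟨contDiff_const, 0, by funext t; simp⟩

theorem derivStable_schwartzFuns : DerivStable schwartzFuns := by
  rintro φ ⟨ψ, rfl⟩
  exact ⟨ψ.smooth ⊤, SchwartzMap.derivCLM ℂ ℂ ψ, by funext t; rfl⟩

theorem OscSpan.mul_schwartz {F : ℤ → Plane → ℂ} (hF : OscSpan n c η constFuns F) {φ : ℝ → ℂ}
    (hφ : φ ∈ schwartzFuns) :
    OscSpan n c η schwartzFuns fun s => F s * fun p => φ (tau n c s p) := by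
  induction hF with
  | base a b χ hχ =>
    obtain ⟨z, rfl⟩ := hχ
    convert OscSpan.smul z _ (OscSpan.base (n := n) (c := c) (η := η) a b φ hφ) using 1
    funext s p
    simp only [Pi.mul_apply, Pi.smul_apply, smul_eq_mul]
    ring
  | zero =>
    simp only [zero_mul]
    exact OscSpan.zero
  | add F G _ _ ihF ihG =>
    simp only [add_mul]
    exact OscSpan.add _ _ ihF ihG
  | smul k F _ ih =>
    simp only [smul_mul_assoc]
    exact OscSpan.smul k _ ih

/-! ### Decay of oscillating families -/

theorem one_div_one_add_tau_sq_le (hn : 0 < n) {R : ℝ} {p : Plane} (h1 : |p 1| ≤ R) (s : ℤ) :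
    1 / (1 + tau n c s p ^ 2) ≤ 2 * (1 + (R + |c|) ^ 2) * (1 / (1 + (s : ℝ) ^ 2)) := by
  set β : ℝ := p 1 / (2 * Real.pi) + c with hβ
  have hβR : |β| ≤ R + |c| := by
    refine (abs_add_le _ _).trans (add_le_add ?_ le_rfl)
    rw [abs_div, abs_of_pos (show 0 < 2 * Real.pi by positivity)]
    refine (div_le_self (abs_nonneg _) ?_).trans h1
    linarith [Real.pi_gt_three]
  have hβ2 : β ^ 2 ≤ (R + |c|) ^ 2 := by
    rw [← sq_abs β]
    exact pow_le_pow_left₀ (abs_nonneg _) hβR 2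
  have hns : (s : ℝ) ^ 2 ≤ (n * s : ℝ) ^ 2 := by
    have h1n : (1 : ℝ) ≤ n := by exact_mod_cast hn
    rw [mul_pow]
    nlinarith [sq_nonneg (s : ℝ), mul_self_nonneg ((n : ℝ) - 1)]
  have ht : tau n c s p = β + n * s := rfl
  rw [ht, mul_one_div, div_le_div_iff₀ (by positivity) (by positivity), one_mul]
  -- Peetre's inequality for ns = (β + ns) - β: decay in τ becomes decay in s, at the cost of a
  -- factor bounded on the box.
  have h3 : 1 + (n * s : ℝ) ^ 2 ≤ 2 * (1 + β ^ 2) * (1 + (β + n * s) ^ 2) := by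
    nlinarith [sq_nonneg (2 * β + n * s : ℝ), mul_nonneg (sq_nonneg β) (sq_nonneg (β + n * s))]
  have h4 : 2 * (1 + β ^ 2) * (1 + (β + n * s) ^ 2) ≤
      2 * (1 + (R + |c|) ^ 2) * (1 + (β + n * s) ^ 2) := by
    refine mul_le_mul_of_nonneg_right ?_ (by positivity)
    linarith
  linarith

theorem norm_exp_phase (η x t : ℝ) :
    ‖Complex.exp (((Complex.I * η) • ((x : ℂ) * (t : ℂ))))‖ = 1 := by
  rw [smul_eq_mul, show Complex.I * (η : ℂ) * ((x : ℂ) * (t : ℂ)) = ((η * (x * t) : ℝ) : ℂ) *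
    Complex.I by push_cast; ring]
  exact Complex.norm_exp_ofReal_mul_I _

/-- The phase has modulus one, powers of σ¹ are bounded on the box, and τ^b φ(τ) is O(1/(1+τ²)) for
a Schwartz profile. -/
theorem OscSpan.bound (hn : 0 < n) {F : ℤ → Plane → ℂ} (hF : OscSpan n c η schwartzFuns F)
    (R : ℝ) : ∃ C : ℝ, ∀ s p, |p 0| ≤ R → |p 1| ≤ R → ‖F s p‖ ≤ C * (1 / (1 + (s : ℝ) ^ 2)) := by
  induction hF with
  | base a b φ hφ =>
    obtain ⟨ψ, rfl⟩ := hφ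
    -- Decay of orders b and b + 2 adds up to a bound for (1 + t²)|t|^b ‖ψ(t)‖.
    obtain ⟨C, hC0, hC⟩ := ψ.decay b 0
    obtain ⟨D, hD0, hD⟩ := ψ.decay (b + 2) 0
    have hCD : ∀ t : ℝ, |t| ^ b * ‖ψ t‖ ≤ (C + D) * (1 / (1 + t ^ 2)) := by
      intro t
      have h1 := hC t
      have h2 := hD t
      have h1' : |t| ^ b * ‖ψ t‖ ≤ C := by simpa using h1
      have h2' : |t| ^ (b + 2) * ‖ψ t‖ ≤ D := by simpa using h2
      rw [mul_one_div, le_div_iff₀ (by positivity)]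
      rw [pow_add, sq_abs] at h2'
      linarith
    refine ⟨R ^ a * ((C + D) * (2 * (1 + (R + |c|) ^ 2))), fun s p h0 h1 => ?_⟩
    have hCD0 : 0 ≤ C + D := by positivity
    have hR : 0 ≤ R := (abs_nonneg _).trans h0
    have e1 : ‖Complex.exp (((Complex.I * η) • (coordX * fun p => (tau n c s p : ℂ))) p)‖ = 1 :=
      norm_exp_phase η (p 0) (tau n c s p)
    have e2 : ‖coordX p‖ = |p 0| := Complex.norm_real _
    have e3 : ‖(tau n c s p : ℂ)‖ = |tau n c s p| := Complex.norm_real _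
    simp only [Pi.mul_apply, Pi.pow_apply, norm_mul, norm_pow, e2, e3]
    rw [e1, one_mul, mul_assoc, mul_assoc]
    refine mul_le_mul (pow_le_pow_left₀ (abs_nonneg _) h0 a) ?_ (by positivity) (by positivity)
    refine (hCD _).trans ?_
    rw [mul_assoc]
    exact mul_le_mul_of_nonneg_left (one_div_one_add_tau_sq_le hn h1 s) hCD0
  | zero => exact ⟨0, fun s p _ _ => by simp⟩
  | add F G _ _ ihF ihG =>
    obtain ⟨C, hC⟩ := ihF
    obtain ⟨D, hD⟩ := ihG
    refine ⟨C + D, fun s p h0 h1 => ?_⟩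
    rw [add_mul]
    exact (norm_add_le _ _).trans (add_le_add (hC s p h0 h1) (hD s p h0 h1))
  | smul k F _ ih =>
    obtain ⟨C, hC⟩ := ih
    refine ⟨‖k‖ * C, fun s p h0 h1 => ?_⟩
    change ‖k • F s p‖ ≤ _
    rw [norm_smul, mul_assoc]
    exact mul_le_mul_of_nonneg_left (hC s p h0 h1) (norm_nonneg k)

theorem OscSpan.isRapid (hn : 0 < n) {F : ℤ → Plane → ℂ} (hF : OscSpan n c η schwartzFuns F) :
    IsRapid F :=
  ⟨derivStable_schwartzFuns.smooth hF,
    fun w R => (derivStable_schwartzFuns.foldr_pd hF w).bound hn R⟩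

end NCTorus

namespace NCTorus

/-! ### The normal ordered exponential -/

/-- The Laguerre type polynomials `∑_j (N choose j) X^j / j!`. -/
def lagPoly (N : ℕ) : Polynomial ℂ :=
  ∑ j ∈ Finset.range (N + 1), Polynomial.monomial j ((N.choose j : ℂ) / (j.factorial : ℂ))

theorem coeff_lagPoly (N j : ℕ) :
    (lagPoly N).coeff j = (N.choose j : ℂ) / (j.factorial : ℂ) := by
  rw [lagPoly, Polynomial.finsetSum_coeff]
  simp only [Polynomial.coeff_monomial]
  rw [Finset.sum_ite_eq']
  split_ifs with h
  · rfl
  · rw [Finset.mem_range] at h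
    rw [Nat.choose_eq_zero_of_lt (by omega)]
    simp

/-- These are L_N(-X), so this is a Laguerre recurrence in which the index N + 1 is reached from N
by differentiation alone, as the evolution equation demands. On coefficients it reduces to Pascal's
rule and the absorption identity. -/
theorem lagPoly_succ (N : ℕ) : ((N : ℂ) + 1) • lagPoly (N + 1) =
    (2 * (N : ℂ) + 1) • lagPoly N + Polynomial.X * lagPoly N - (lagPoly N).derivative -
      Polynomial.X * (lagPoly N).derivative.derivative := by
  have hfac : ∀ j : ℕ, (j.factorial : ℂ) ≠ 0 := fun j => by exact_mod_cast j.factorial_ne_zero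
  ext j
  cases j with
  | zero =>
    simp only [Polynomial.coeff_sub, Polynomial.coeff_add, Polynomial.coeff_smul,
      Polynomial.coeff_X_mul_zero, Polynomial.coeff_derivative, coeff_lagPoly]
    simp
    ring
  | succ j =>
    have h1 : (((N + 1).choose (j + 1) : ℕ) : ℂ) = N.choose j + N.choose (j + 1) := by
      rw [Nat.choose_succ_succ]; push_cast; rfl
    have h2 : (N.choose (j + 1) : ℂ) * ((j : ℂ) + 1) = N.choose j * ((N : ℂ) - j) := by
      rcases le_or_gt j N with h | h
      · have := Nat.choose_succ_right_eq N j
        have h' : ((N.choose (j + 1) * (j + 1) : ℕ) : ℂ) = ((N.choose j * (N - j) : ℕ) : ℂ) := by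
          rw [this]
        push_cast [Nat.cast_sub h] at h'
        exact h'
      · rw [Nat.choose_eq_zero_of_lt h, Nat.choose_eq_zero_of_lt (by omega)]
        simp
    have h3 : (N.choose (j + 1 + 1) : ℂ) * ((j : ℂ) + 1 + 1) = N.choose (j + 1) * ((N : ℂ) - (j + 1)) := by
      rcases le_or_gt (j + 1) N with h | h
      · have := Nat.choose_succ_right_eq N (j + 1)
        have h' : ((N.choose (j + 1 + 1) * (j + 1 + 1) : ℕ) : ℂ) =
            ((N.choose (j + 1) * (N - (j + 1)) : ℕ) : ℂ) := by rw [this]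
        push_cast [Nat.cast_sub h] at h'
        exact h'
      · rw [Nat.choose_eq_zero_of_lt h, Nat.choose_eq_zero_of_lt (by omega)]
        simp
    simp only [Polynomial.coeff_sub, Polynomial.coeff_add, Polynomial.coeff_smul,
      Polynomial.coeff_X_mul, Polynomial.coeff_derivative, coeff_lagPoly, smul_eq_mul, h1]
    have hj1 : ((j : ℂ) + 1) ≠ 0 := by exact_mod_cast j.succ_ne_zero
    have hj2 : ((j : ℂ) + 1 + 1) ≠ 0 := by exact_mod_cast (j + 1).succ_ne_zero
    rw [Nat.factorial_succ (j + 1), Nat.factorial_succ j]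
    push_cast
    have := hfac j
    field_simp
    linear_combination h3 - h2

/-- The entire function `e^z P(z)`. -/
def polyExp (P : Polynomial ℂ) (z : ℂ) : ℂ := Complex.exp z * P.eval z

theorem hasDerivAt_polyExp (P : Polynomial ℂ) (z : ℂ) :
    HasDerivAt (polyExp P) (polyExp (P + P.derivative) z) z := by
  refine ((Complex.hasDerivAt_exp z).mul (P.hasDerivAt z)).congr_deriv ?_
  rw [polyExp, Polynomial.eval_add, mul_add]

/-- The same recurrence after multiplication by e^z, where differentiation acts as P ↦ P + P'. -/
theorem polyExp_lagPoly_succ (N : ℕ) (z : ℂ) :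
    ((N : ℂ) + 1) * polyExp (lagPoly (N + 1)) z = 2 * ((N : ℂ) + 1) * polyExp (lagPoly N) z +
      2 * z * polyExp (lagPoly N + (lagPoly N).derivative) z -
      polyExp (lagPoly N + (lagPoly N).derivative) z -
      z * polyExp (lagPoly N + (lagPoly N).derivative +
        (lagPoly N + (lagPoly N).derivative).derivative) z := by
  have h := congrArg (Polynomial.eval z) (lagPoly_succ N)
  simp only [Polynomial.eval_add, Polynomial.eval_sub, Polynomial.eval_smul, Polynomial.eval_mul,
    Polynomial.eval_X, smul_eq_mul] at h
  simp only [polyExp, Polynomial.derivative_add, Polynomial.eval_add]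
  linear_combination Complex.exp z * h

/-! ### Summing the ordered series -/

theorem hasSum_choose_mul_pow (j : ℕ) (z : ℂ) :
    HasSum (fun k : ℕ => (k.choose j : ℂ) * (z ^ k / (k.factorial : ℂ)))
      (z ^ j / (j.factorial : ℂ) * Complex.exp z) := by
  have hexp : HasSum (fun k : ℕ => z ^ k / (k.factorial : ℂ)) (Complex.exp z) := by
    rw [Complex.exp_eq_exp_ℂ]
    exact NormedSpace.expSeries_div_hasSum_exp z
  have h := hexp.mul_left (z ^ j / (j.factorial : ℂ))
  have hinj : Function.Injective fun k : ℕ => k + j := add_left_injective j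
  refine (hinj.hasSum_iff fun k hk => ?_).1 (h.congr_fun ?_)
  · have : k < j := by
      by_contra hlt
      exact hk ⟨k - j, by simp only; omega⟩
    rw [Nat.choose_eq_zero_of_lt this]
    simp
  · intro k
    have h1 := Nat.add_choose_mul_factorial_mul_factorial k j
    have h2 : ((k + j).choose j : ℂ) * k.factorial * j.factorial = ((k + j).factorial : ℂ) := by
      exact_mod_cast h1
    have hk : (k.factorial : ℂ) ≠ 0 := by exact_mod_cast k.factorial_ne_zero
    have hj : (j.factorial : ℂ) ≠ 0 := by exact_mod_cast j.factorial_ne_zero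
    have hkj : ((k + j).factorial : ℂ) ≠ 0 := by exact_mod_cast (k + j).factorial_ne_zero
    simp only [Function.comp_apply]
    rw [pow_add]
    field_simp
    linear_combination (z ^ k * z ^ j) * h2

theorem hasSum_polyExp_lagPoly (N : ℕ) (z : ℂ) :
    HasSum (fun k : ℕ => ((N + k).choose N : ℂ) * (z ^ k / (k.factorial : ℂ)))
      (polyExp (lagPoly N) z) := by
  have h : HasSum (fun k : ℕ => ∑ j ∈ Finset.range (N + 1),
      (N.choose j : ℂ) * ((k.choose j : ℂ) * (z ^ k / (k.factorial : ℂ))))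
      (∑ j ∈ Finset.range (N + 1), (N.choose j : ℂ) * (z ^ j / (j.factorial : ℂ) * Complex.exp z)) :=
    hasSum_sum fun j _ => (hasSum_choose_mul_pow j z).mul_left _
  convert h using 1
  · funext k
    -- Vandermonde's identity decouples N from k, so that each j contributes a shifted exponential
    -- series.
    have hV : ((N + k).choose N : ℂ) =
        ∑ j ∈ Finset.range (N + 1), (N.choose j : ℂ) * (k.choose j : ℂ) := by
      rw [add_comm N k, Nat.add_choose_eq, Finset.Nat.sum_antidiagonal_eq_sum_range_succ
        (fun a b => k.choose a * N.choose b)]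
      push_cast
      refine Finset.sum_congr rfl fun j hj => ?_
      rw [Finset.mem_range] at hj
      rw [Nat.choose_symm (by omega : j ≤ N), mul_comm]
    rw [hV, Finset.sum_mul]
    exact Finset.sum_congr rfl fun j _ => mul_assoc _ _ _
  · rw [polyExp, lagPoly, Polynomial.eval_finsetSum, Finset.mul_sum]
    refine Finset.sum_congr rfl fun j _ => ?_
    rw [Polynomial.eval_monomial]
    ring

theorem iterate_pd_pow {μ : Fin 2} {f : Plane → ℂ} (hf : Differentiable ℝ f) {κ : ℂ}
    (h : pd μ f = fun _ => κ) (l N : ℕ) :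
    (pd μ)^[N] (f ^ l) = ((l.descFactorial N : ℂ) * κ ^ N) • f ^ (l - N) := by
  induction N with
  | zero => simp
  | succ N ih =>
    rw [Function.iterate_succ_apply', ih, pd_const_smul, pd_pow μ hf, h, Nat.descFactorial_succ,
      Nat.sub_sub]
    funext p
    simp only [Pi.smul_apply, Pi.mul_apply, Pi.pow_apply, smul_eq_mul]
    push_cast
    ring

variable {α : ℂ} {A B : Plane → ℂ}

/-- A function of `σ^2` with constant derivative `α`. -/
structure IsYLinear (α : ℂ) (A : Plane → ℂ) : Prop where
  smooth : ContDiff ℝ ∞ A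
  pd_zero : pd 0 A = 0
  pd_one : pd 1 A = fun _ => α

/-- A function of `σ^1` with constant derivative `α`. -/
structure IsXLinear (α : ℂ) (B : Plane → ℂ) : Prop where
  smooth : ContDiff ℝ ∞ B
  pd_one : pd 1 B = 0
  pd_zero : pd 0 B = fun _ => α

theorem coeff_moyal_C_C (f g : Plane → ℂ) (N : ℕ) :
    PowerSeries.coeff N (moyal (PowerSeries.C f) (PowerSeries.C g)) =
      ((Complex.I * (Real.pi : ℂ)) ^ N / (N.factorial : ℂ)) • bidiff N f g := by
  rw [moyal_C_right_coeff, Finset.sum_eq_single (N, 0)]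
  · simp
  · rintro ⟨a, b⟩ h hne
    rw [Finset.HasAntidiagonal.mem_antidiagonal] at h
    have : b ≠ 0 := by rintro rfl; simp at h; simp [h] at hne
    simp [PowerSeries.coeff_C, this, bidiff_zero_left]
  · simp

theorem coeff_orderedTerm (hA : IsYLinear α A) (hB : IsXLinear Complex.I B) (N l : ℕ) (p : Plane) :
    PowerSeries.coeff N (orderedTerm A B l) p = (Real.pi * α) ^ N *
      ((l.descFactorial N : ℂ) ^ 2 / ((l.factorial : ℂ) * (N.factorial : ℂ)) *
        (A p * B p) ^ (l - N)) := by
  have hAy : IsYFun (A ^ l) := by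
    refine ⟨hA.smooth.pow l, ?_⟩
    rw [pd_pow 0 (differentiable_of_contDiff hA.smooth), hA.pd_zero, mul_zero, smul_zero]
  rw [orderedTerm, coeff_const_smul, coeff_moyal_C_C, bidiff_yFun_left hAy,
    iterate_pd_pow (differentiable_of_contDiff hB.smooth) hB.pd_zero,
    iterate_pd_pow (differentiable_of_contDiff hA.smooth) hA.pd_one]
  simp only [Pi.smul_apply, Pi.mul_apply, Pi.pow_apply, smul_eq_mul, mul_pow]
  -- The three sources of sign cancel: i from the Moyal kernel, i from ∂₁B, and -1 from ε^{21}.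
  have h : Complex.I ^ N * Complex.I ^ N * (-1 : ℂ) ^ N = 1 := by
    rw [← mul_pow, ← mul_pow, Complex.I_mul_I]
    simp
  have h1 : (l.factorial : ℂ) ≠ 0 := by exact_mod_cast l.factorial_ne_zero
  have h2 : (N.factorial : ℂ) ≠ 0 := by exact_mod_cast N.factorial_ne_zero
  field_simp
  linear_combination ((l.descFactorial N : ℂ) ^ 2 * B p ^ (l - N) * α ^ N * A p ^ (l - N)) * h

/-- Terms with l < N vanish. Putting l = N + k, the weight (l)_N²/(l! N!) becomes C(N+k, N)/k!,
which is the series of e^z L_N(-z). -/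
theorem hasSum_orderedTerm (hA : IsYLinear α A) (hB : IsXLinear Complex.I B) (N : ℕ) (p : Plane) :
    HasSum (fun l => PowerSeries.coeff N (orderedTerm A B l) p)
      ((Real.pi * α) ^ N * polyExp (lagPoly N) (A p * B p)) := by
  simp only [coeff_orderedTerm hA hB]
  refine HasSum.mul_left _ ?_
  have hinj : Function.Injective fun k : ℕ => N + k := add_right_injective N
  refine (hinj.hasSum_iff fun l hl => ?_).1 ((hasSum_polyExp_lagPoly N _).congr_fun ?_)
  · have : l < N := by
      by_contra hlt
      exact hl ⟨l - N, by simp only; omega⟩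
    rw [Nat.descFactorial_of_lt this]
    simp
  · intro k
    have h1 : ((N + k).descFactorial N : ℂ) = N.factorial * (N + k).choose N := by
      exact_mod_cast Nat.descFactorial_eq_factorial_mul_choose (N + k) N
    have h2 : ((N + k).choose N : ℂ) * N.factorial * k.factorial = ((N + k).factorial : ℂ) := by
      rw [Nat.choose_symm_add]
      exact_mod_cast Nat.add_choose_mul_factorial_mul_factorial N k
    have hk : (k.factorial : ℂ) ≠ 0 := by exact_mod_cast k.factorial_ne_zero
    have hN : (N.factorial : ℂ) ≠ 0 := by exact_mod_cast N.factorial_ne_zero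
    have hkN : ((N + k).factorial : ℂ) ≠ 0 := by exact_mod_cast (N + k).factorial_ne_zero
    simp only [Function.comp_apply, Nat.add_sub_cancel_left]
    rw [h1]
    field_simp
    linear_combination (((N + k).choose N : ℂ) * A p ^ k * B p ^ k) * h2

end NCTorus

namespace NCTorus

variable {n : ℕ} {m : ℤ} {α : ℂ} {A : Plane → ℂ}

/-! ### Evolution equation of the normal ordered exponential -/

theorem pd_comp_complex (μ : Fin 2) {G G' : ℂ → ℂ} (hG : ∀ z, HasDerivAt G (G' z) z)
    {f : Plane → ℂ} (hf : Differentiable ℝ f) :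
    pd μ (fun p => G (f p)) = fun p => G' (f p) * pd μ f p := by
  funext p
  have h := (((hG (f p)).hasFDerivAt.restrictScalars ℝ).comp p (hf p).hasFDerivAt).fderiv
  have h' : fderiv ℝ (fun p => G (f p)) p = _ := h
  simp [pd, h', mul_comm]

theorem contDiff_polyExp (P : Polynomial ℂ) : ContDiff ℝ ∞ (polyExp P) := by
  have h : Differentiable ℂ (polyExp P) := fun z => (hasDerivAt_polyExp P z).differentiableAt
  exact (h.contDiff (n := ∞)).restrict_scalars ℝ

theorem isXLinear_coordB : IsXLinear Complex.I coordB := by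
  have h : coordB = Complex.I • coordX := rfl
  refine ⟨?_, ?_, ?_⟩
  · rw [h]; exact contDiff_coordX.const_smul Complex.I
  · rw [h, pd_const_smul, pd_one_coordX, smul_zero]
  · rw [h, pd_const_smul, pd_zero_coordX]
    funext p
    simp

/-- The sum `∑_l A^l ⋆ B^l / l!` in closed form. -/
def orderedExp (α : ℂ) (A : Plane → ℂ) : Formal :=
  PowerSeries.mk fun N p => (Real.pi * α) ^ N * polyExp (lagPoly N) (A p * coordB p)

theorem coeff_orderedExp (N : ℕ) : PowerSeries.coeff N (orderedExp α A) =
    ((Real.pi * α) ^ N : ℂ) • fun p => polyExp (lagPoly N) ((A * coordB) p) := by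
  rw [orderedExp, PowerSeries.coeff_mk]
  rfl

theorem isSmooth_orderedExp (hA : IsYLinear α A) : IsSmooth (orderedExp α A) := fun N => by
  rw [coeff_orderedExp]
  exact ((contDiff_polyExp _).comp (hA.smooth.mul isXLinear_coordB.smooth)).const_smul
    ((Real.pi * α) ^ N : ℂ)

/-- Every derivative is a function of z = AB times explicit factors. Order N of the equation is then
`polyExp_lagPoly_succ` at z, scaled by πnα times (πα)^N. -/
theorem swEq_orderedExp (hα : 2 * Real.pi * n * α = m) (hA : IsYLinear α A) :
    SWEq n m m 0 (orderedExp α A) := by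
  rw [swEq_iff]
  intro N
  have hB := isXLinear_coordB
  have hAd := differentiable_of_contDiff hA.smooth
  have hBd := differentiable_of_contDiff hB.smooth
  have hz : ContDiff ℝ ∞ (A * coordB) := hA.smooth.mul hB.smooth
  have hzd : Differentiable ℝ (A * coordB) := differentiable_of_contDiff hz
  set P := lagPoly N with hP
  set Q := P + P.derivative with hQ
  set R := Q + Q.derivative with hR
  have h0 : pd 0 (A * coordB) = fun p => Complex.I * A p := by
    rw [pd_mul 0 hAd hBd, hA.pd_zero, hB.pd_zero]
    funext p
    simp [mul_comm]
  have h1 : pd 1 (A * coordB) = α • coordB := by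
    rw [pd_mul 1 hAd hBd, hA.pd_one, hB.pd_one]
    funext p
    simp
  have e0 : pd 0 (fun p => polyExp P ((A * coordB) p)) =
      fun p => polyExp Q ((A * coordB) p) * (Complex.I * A p) := by
    rw [pd_comp_complex 0 (hasDerivAt_polyExp P) hzd, h0]
  have e1 : pd 1 (fun p => polyExp P ((A * coordB) p)) =
      α • ((fun p => polyExp Q ((A * coordB) p)) * coordB) := by
    rw [pd_comp_complex 1 (hasDerivAt_polyExp P) hzd, h1]
    funext p
    simp only [Pi.smul_apply, Pi.mul_apply, smul_eq_mul]
    ring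
  have hQd : Differentiable ℝ fun p => polyExp Q ((A * coordB) p) :=
    differentiable_of_contDiff ((contDiff_polyExp Q).comp hz)
  have e01 : pd 0 (pd 1 (fun p => polyExp P ((A * coordB) p))) = α •
      ((fun p => polyExp R ((A * coordB) p) * (Complex.I * A p)) * coordB +
        (fun p => polyExp Q ((A * coordB) p)) * fun _ => Complex.I) := by
    rw [e1, pd_const_smul, pd_mul 0 hQd hBd, pd_comp_complex 0 (hasDerivAt_polyExp Q) hzd, h0,
      hB.pd_zero]
  rw [coeff_orderedExp, coeff_orderedExp, pd_const_smul, pd_const_smul, pd_const_smul, e0, e01]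
  funext p
  have hrec := polyExp_lagPoly_succ N ((A * coordB) p)
  rw [← hP, ← hQ, ← hR] at hrec
  have hx : (A * coordB) p = Complex.I * (coordX p * A p) := by
    simp only [Pi.mul_apply, coordB, coordX]
    ring
  have hBx : coordB p = Complex.I * coordX p := rfl
  simp only [Pi.smul_apply, Pi.mul_apply, Pi.add_apply, smul_eq_mul, zero_smul, add_zero, hBx,
    pow_succ, Pi.zero_apply] at hrec ⊢
  generalize polyExp (lagPoly (N + 1)) (A p * (Complex.I * coordX p)) = a at *
  generalize polyExp P (A p * (Complex.I * coordX p)) = b at *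
  generalize polyExp Q (A p * (Complex.I * coordX p)) = d at *
  generalize polyExp R (A p * (Complex.I * coordX p)) = e at *
  rw [← hα]
  linear_combination (((Real.pi * α) ^ N : ℂ) * Real.pi * n * α) * hrec
    - (((Real.pi * α) ^ N : ℂ) * Real.pi * n * α) *
      (d + e * Complex.I * A p * coordX p) * Complex.I_sq

/-- Since B is affine in σ¹, the commutator is exactly 2παθ = mθ/n, so clearing the prefactor means
multiplying by n - mθ. -/
theorem normalOrdered_spec (hα : 2 * Real.pi * n * α = m) (hA : IsYLinear α A) :
    (n : ℂ) • normalOrdered A coordB - (m : ℂ) • (PowerSeries.X * normalOrdered A coordB) =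
      (n : ℂ) • orderedExp α A := by
  have hB := isXLinear_coordB
  have hBA : IsAffine (PowerSeries.C coordB) := by
    refine ⟨?_, ?_, ?_⟩
    · rw [fpd_C, hB.pd_one, map_zero]
    · rw [fpd_C, fpd_C, hB.pd_zero, pd_const, map_zero]
    · rw [fpd_C, fpd_C, hB.pd_zero, pd_const, map_zero]
  have hcomm : moyal (PowerSeries.C A) (PowerSeries.C coordB) -
      moyal (PowerSeries.C coordB) (PowerSeries.C A) = (2 * Real.pi * α : ℂ) • PowerSeries.X := by
    have hI : algebraMap ℂ Formal Complex.I * algebraMap ℂ Formal Complex.I = -1 := by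
      rw [← map_mul, Complex.I_mul_I, map_neg, map_one]
    have hc : ∀ c : ℂ, (PowerSeries.C (fun _ => c) : Formal) = algebraMap ℂ Formal c := fun c => by
      rw [← mul_one (PowerSeries.C _), C_const_mul, Algebra.smul_def, mul_one]
    rw [hBA.moyal_right, hBA.moyal_left, fpd_C, fpd_C, hB.pd_zero, hA.pd_one, hc, hc]
    simp only [Algebra.smul_def, map_mul, map_ofNat]
    linear_combination (-2 * algebraMap ℂ Formal Real.pi * algebraMap ℂ Formal α *
      PowerSeries.X) * hI
  have hsum : (PowerSeries.mk fun N p => ∑' l : ℕ,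
      PowerSeries.coeff N (orderedTerm A coordB l) p) = orderedExp α A := by
    ext1 N
    rw [PowerSeries.coeff_mk, coeff_orderedExp]
    funext p
    rw [(hasSum_orderedTerm hA hB N p).tsum_eq]
    rfl
  have hinv := PowerSeries.mul_invOfUnit
    (1 - (2 * Real.pi * α : ℂ) • PowerSeries.X : Formal) 1 (by
      rw [map_sub, ← PowerSeries.coeff_zero_eq_constantCoeff_apply,
        ← PowerSeries.coeff_zero_eq_constantCoeff_apply, coeff_const_smul]
      simp)
  rw [normalOrdered, hcomm, hsum]
  generalize PowerSeries.invOfUnit (1 - (2 * Real.pi * α : ℂ) • PowerSeries.X : Formal) 1 = v at *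
  rw [← hα]
  simp only [Algebra.smul_def, map_mul, map_ofNat] at hinv ⊢
  linear_combination (algebraMap ℂ Formal n * orderedExp α A) * hinv

theorem coeff_succ_normalOrdered (hn : 0 < n) (hα : 2 * Real.pi * n * α = m)
    (hA : IsYLinear α A) (N : ℕ) : PowerSeries.coeff (N + 1) (normalOrdered A coordB) =
      PowerSeries.coeff (N + 1) (orderedExp α A) +
        ((m : ℂ) / n) • PowerSeries.coeff N (normalOrdered A coordB) := by
  have hn' : (n : ℂ) ≠ 0 := by exact_mod_cast hn.ne'
  have h := congrArg (PowerSeries.coeff (N + 1)) (normalOrdered_spec hα hA)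
  rw [map_sub, coeff_const_smul, coeff_const_smul, coeff_const_smul,
    PowerSeries.coeff_succ_X_mul] at h
  funext p
  have hp := congrFun h p
  simp only [Pi.sub_apply, Pi.smul_apply, Pi.add_apply, smul_eq_mul] at hp ⊢
  field_simp
  linear_combination hp

theorem coeff_zero_normalOrdered (hn : 0 < n) (hα : 2 * Real.pi * n * α = m)
    (hA : IsYLinear α A) : PowerSeries.coeff 0 (normalOrdered A coordB) =
      PowerSeries.coeff 0 (orderedExp α A) := by
  have hn' : (n : ℂ) ≠ 0 := by exact_mod_cast hn.ne'
  have h := congrArg (PowerSeries.coeff 0) (normalOrdered_spec hα hA)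
  rw [map_sub, coeff_const_smul, coeff_const_smul, coeff_const_smul,
    PowerSeries.coeff_zero_X_mul, smul_zero, sub_zero] at h
  exact smul_right_injective _ hn' h

theorem isSmooth_normalOrdered (hn : 0 < n) (hα : 2 * Real.pi * n * α = m)
    (hA : IsYLinear α A) : IsSmooth (normalOrdered A coordB) := by
  intro N
  induction N with
  | zero =>
    rw [coeff_zero_normalOrdered hn hα hA]
    exact isSmooth_orderedExp hA 0
  | succ N ih =>
    rw [coeff_succ_normalOrdered hn hα hA]
    exact (isSmooth_orderedExp hA (N + 1)).add (ih.const_smul ((m : ℂ) / n))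

/-- The prefactor is nν, and (n - mθ)∂_θ ν = mν: it adds m to κ, giving 2m as required for sections.
-/
theorem swEq_normalOrdered (hn : 0 < n) (hα : 2 * Real.pi * n * α = m)
    (hA : IsYLinear α A) : SWEq n m (2 * m) 0 (normalOrdered A coordB) := by
  have hν := invNM_spec (m := m) hn
  have hW := isSmooth_normalOrdered hn hα hA
  have a := normalOrdered_spec hα hA
  have e := swEq_orderedExp hα hA
  rw [SWEq] at e ⊢
  have hsub : ∀ μ {f : Formal}, IsSmooth f → fpd μ ((n : ℂ) • f - (m : ℂ) • (PowerSeries.X * f)) =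
      (n : ℂ) • fpd μ f - (m : ℂ) • (PowerSeries.X * fpd μ f) := fun μ f hf => by
    rw [fpd_sub μ (hf.const_smul _) ((isSmooth_X.mul hf).const_smul _), fpd_const_smul,
      fpd_const_smul, fpd_mul μ isSmooth_X hf, fpd_X, zero_mul, zero_add]
  -- The relation n M = (n - mθ)E between the ordered sum M and E is differentiated in θ, in σ¹ and
  -- in both coordinates; the final combination substitutes these into the equation for M and
  -- cancels n - mθ using ν.
  have b := congrArg dθ a
  have c := congrArg (fpd 0) a
  have d := congrArg (fun f => fpd 0 (fpd 1 f)) a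
  beta_reduce at d
  rw [dθ_sub, dθ_const_smul, dθ_const_smul, dθ_mul, dθ_X, dθ_const_smul] at b
  rw [hsub 0 hW, fpd_const_smul] at c
  rw [hsub 1 hW, hsub 0 (hW.fpd 1), fpd_const_smul, fpd_const_smul] at d
  generalize fpd 0 (fpd 1 (normalOrdered A coordB)) = Wxy at *
  generalize fpd 0 (normalOrdered A coordB) = Wx at *
  generalize dθ (normalOrdered A coordB) = Wd at *
  generalize normalOrdered A coordB = W at *
  generalize fpd 0 (fpd 1 (orderedExp α A)) = Mxy at *
  generalize fpd 0 (orderedExp α A) = Mx at *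
  generalize dθ (orderedExp α A) = Md at *
  generalize orderedExp α A = M at *
  simp only [Algebra.smul_def, map_mul, map_ofNat, map_zero, zero_mul, add_zero] at hν a b c d e ⊢
  generalize algebraMap ℂ Formal n = c' at *
  generalize algebraMap ℂ Formal m = m' at *
  generalize algebraMap ℂ Formal Complex.I * algebraMap ℂ Formal Real.pi = q at *
  generalize (PowerSeries.C coordX : Formal) = x at *
  generalize (PowerSeries.X : Formal) = t at *
  generalize invNM n m = ν at *
  linear_combination (-(c' * Wd - m' * (t * Wd) - m' * (x * Wx) - 2 * m' * W - q * c' * Wxy)) * hν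
    + ν * ((c' - m' * t) * b + c' * e - m' * a - m' * x * c - q * c' * d)

end NCTorus

namespace NCTorus

/-! ### The explicit sections -/

variable {n : ℕ} {m : ℤ}

/-- The offset `k + (n/m) j`. -/
def offset (n : ℕ) (m : ℤ) (k : Fin n) (j : Fin m.natAbs) : ℝ :=
  ((k : ℕ) + 1 : ℝ) + (n : ℝ) / (m : ℝ) * ((j : ℕ) + 1 : ℝ)

/-- With this offset the profile is φ̃_j(τ) and AB = i(m/n)σ¹τ, so the terms of the sections are
oscillating families with η = m/n. -/
theorem coordA_eq (hm : m ≠ 0) (k : Fin n) (j : Fin m.natAbs) (s : ℤ) (p : Plane) :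
    coordA n m k j s p = (m : ℝ) / n * tau n (offset n m k j) s p := by
  have hn' : (n : ℝ) ≠ 0 := by exact_mod_cast k.pos.ne'
  have hm' : (m : ℝ) ≠ 0 := by exact_mod_cast hm
  rw [coordA, tau, offset]
  field_simp
  ring

theorem profile_eq (hm : m ≠ 0) (φt : Fin m.natAbs → SchwartzMap ℝ ℂ) (k : Fin n)
    (j : Fin m.natAbs) (s : ℤ) :
    profile n m φt k j s = fun p => φt j (tau n (offset n m k j) s p) := by
  have hn' : (n : ℝ) ≠ 0 := by exact_mod_cast k.pos.ne'
  have hm' : (m : ℝ) ≠ 0 := by exact_mod_cast hm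
  funext p
  rw [profile, coordA_eq hm]
  congr 1
  field_simp

theorem isYFun_profile (hm : m ≠ 0) (φt : Fin m.natAbs → SchwartzMap ℝ ℂ) (k : Fin n)
    (j : Fin m.natAbs) (s : ℤ) : IsYFun (profile n m φt k j s) := by
  rw [profile_eq hm]
  refine ⟨contDiff_comp_tau ((φt j).smooth ⊤) s, ?_⟩
  rw [pd_comp_tau 0 ((φt j).smooth ⊤)]
  simp

theorem isYLinear_coordA (hm : m ≠ 0) (k : Fin n) (j : Fin m.natAbs) (s : ℤ) :
    IsYLinear ((m : ℂ) / (2 * Real.pi * n)) fun p => (coordA n m k j s p : ℂ) := by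
  have h : (fun p => (coordA n m k j s p : ℂ)) =
      ((m : ℂ) / n) • fun p => (tau n (offset n m k j) s p : ℂ) := by
    funext p
    rw [coordA_eq hm]
    simp
  rw [h]
  refine ⟨(contDiff_tau s).const_smul ((m : ℂ) / n), ?_, ?_⟩
  · rw [pd_const_smul, pd_tau]
    funext p
    simp
  · rw [pd_const_smul, pd_tau]
    funext p
    simp only [Pi.smul_apply, smul_eq_mul, if_true]
    rw [div_mul_div_comm, mul_one, mul_comm (n : ℂ)]

theorem two_pi_mul_slope_coordA (hn : 0 < n) :
    2 * Real.pi * n * ((m : ℂ) / (2 * Real.pi * n)) = m := by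
  have hn' : (n : ℂ) ≠ 0 := by exact_mod_cast hn.ne'
  have hpi : (Real.pi : ℂ) ≠ 0 := by exact_mod_cast Real.pi_ne_zero
  field_simp

theorem oscSpan_orderedExp (hm : m ≠ 0) (k : Fin n) (j : Fin m.natAbs) (α : ℂ) (N : ℕ) :
    OscSpan n (offset n m k j) ((m : ℝ) / n) constFuns fun s =>
      PowerSeries.coeff N (orderedExp α fun p => (coordA n m k j s p : ℂ)) := by
  have h := OscSpan.smul ((Real.pi * α) ^ N) _ (OscSpan.sum (t := Finset.range (N + 1))
    (F := fun i => _) fun i _ => OscSpan.smul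
      ((N.choose i : ℂ) / (i.factorial : ℂ) * (Complex.I * ((m : ℝ) / n : ℝ)) ^ i) _
      (OscSpan.base (n := n) (c := offset n m k j) (η := (m : ℝ) / n) i i (fun _ => (1 : ℂ))
        (show (fun _ => (1 : ℂ)) ∈ constFuns from ⟨1, rfl⟩)))
  convert h using 1
  funext s p
  rw [coeff_orderedExp]
  have hz : ((fun p => (coordA n m k j s p : ℂ)) * coordB) p =
      ((Complex.I * ((m : ℝ) / n : ℝ)) •
        (coordX * fun p => (tau n (offset n m k j) s p : ℂ))) p := by
    simp only [Pi.mul_apply, Pi.smul_apply, smul_eq_mul, coordB, coordX]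
    rw [coordA_eq hm]
    push_cast
    ring
  rw [Pi.smul_apply, Pi.smul_apply, hz, polyExp, lagPoly, Polynomial.eval_finsetSum,
    Finset.mul_sum, Finset.sum_apply]
  congr 1
  refine Finset.sum_congr rfl fun i _ => ?_
  simp only [Polynomial.eval_monomial, Pi.smul_apply, Pi.mul_apply, Pi.pow_apply, smul_eq_mul]
  ring

theorem oscSpan_normalOrdered (hm : m ≠ 0) (k : Fin n) (j : Fin m.natAbs) (N : ℕ) :
    OscSpan n (offset n m k j) ((m : ℝ) / n) constFuns fun s =>
      PowerSeries.coeff N (normalOrdered (fun p => (coordA n m k j s p : ℂ)) coordB) := by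
  have hα := two_pi_mul_slope_coordA (m := m) k.pos
  induction N with
  | zero =>
    simp only [coeff_zero_normalOrdered k.pos hα (isYLinear_coordA hm k j _)]
    exact oscSpan_orderedExp hm k j _ 0
  | succ N ih =>
    simp only [coeff_succ_normalOrdered k.pos hα (isYLinear_coordA hm k j _)]
    exact OscSpan.add _ _ (oscSpan_orderedExp hm k j _ (N + 1)) (OscSpan.smul _ _ ih)

/-- The point is that one Schwartz function ψ works for all s. -/
theorem iterate_pd_comp_tau {c : ℝ} {φ : ℝ → ℂ} (hφ : φ ∈ schwartzFuns) (r : ℕ) :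
    ∃ ψ ∈ schwartzFuns, ∀ s, (pd 1)^[r] (fun p => φ (tau n c s p)) =
      ((1 / (2 * Real.pi) : ℂ) ^ r) • fun p => ψ (tau n c s p) := by
  induction r with
  | zero => exact ⟨φ, hφ, fun s => by simp⟩
  | succ r ih =>
    obtain ⟨ψ, hψ, h⟩ := ih
    obtain ⟨hs, hd⟩ := derivStable_schwartzFuns ψ hψ
    refine ⟨deriv ψ, hd, fun s => ?_⟩
    rw [Function.iterate_succ_apply', h, pd_const_smul, pd_comp_tau 1 hs, if_pos rfl, smul_smul,
      pow_succ]

/-- Each order is a finite sum of derivatives of phase-polynomial families multiplied by derivatives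
of the Schwartz profile, hence rapid. -/
theorem isRapid_coeff_quantumTerm (hm : m ≠ 0) (φt : Fin m.natAbs → SchwartzMap ℝ ℂ) (k : Fin n)
    (N : ℕ) : IsRapid fun s => PowerSeries.coeff N (quantumTerm n m φt k s) := by
  simp only [quantumTerm, map_sum]
  refine IsRapid.sum fun j _ => ?_
  simp only [moyal_yFun_right (isYFun_profile hm φt k j _), coeff_yStar]
  refine IsRapid.sum fun q _ => IsRapid.const_smul _ ?_
  obtain ⟨ψ, hψ, h⟩ := iterate_pd_comp_tau (n := n) (c := offset n m k j)
    (show (φt j : ℝ → ℂ) ∈ schwartzFuns from ⟨φt j, rfl⟩) q.1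
  simp only [profile_eq hm, h, mul_smul_comm]
  exact IsRapid.const_smul _ (((derivStable_constFuns.iterate_pd
    (oscSpan_normalOrdered hm k j q.2) 0 q.1).mul_schwartz hψ).isRapid k.pos)

theorem swEq_quantumTerm (hm : m ≠ 0) (φt : Fin m.natAbs → SchwartzMap ℝ ℂ) (k : Fin n)
    (s : ℤ) : SWEq n m (2 * m) 0 (quantumTerm n m φt k s) := by
  have hα := two_pi_mul_slope_coordA (m := m) k.pos
  refine SWEq.sum (fun j _ => ?_) fun j _ => ?_
  · exact isSmooth_moyal_yFun_right (isSmooth_normalOrdered k.pos hα (isYLinear_coordA hm k j s))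
      (isYFun_profile hm φt k j s)
  · exact (swEq_normalOrdered k.pos hα (isYLinear_coordA hm k j s)).moyal_yFun_right
      (isSmooth_normalOrdered k.pos hα (isYLinear_coordA hm k j s)) (isYFun_profile hm φt k j s)

theorem coeff_quantumSection (φt : Fin m.natAbs → SchwartzMap ℝ ℂ) (k : Fin n) (N : ℕ) :
    PowerSeries.coeff N (quantumSection n m φt k) =
      familySum fun s => PowerSeries.coeff N (quantumTerm n m φt k s) :=
  PowerSeries.coeff_mk _ _

theorem IsRapid.hasSum {F : ℤ → Plane → ℂ} (hF : IsRapid F) (p : Plane) :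
    HasSum (fun s => F s p) (familySum F p) :=
  (hF.summable p).hasSum

theorem swEq_quantumSection (hm : m ≠ 0) (φt : Fin m.natAbs → SchwartzMap ℝ ℂ) (k : Fin n) :
    SWEq n m (2 * m) 0 (quantumSection n m φt k) := by
  rw [swEq_iff]
  intro N
  have h := isRapid_coeff_quantumTerm hm φt k N
  simp only [coeff_quantumSection]
  rw [h.pd_familySum 0, h.pd_familySum 1, (h.pd 1).pd_familySum 0]
  funext p
  have hL := ((isRapid_coeff_quantumTerm hm φt k (N + 1)).hasSum p).mul_left ((n : ℂ) * (N + 1))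
  have hR := (((((h.hasSum p).mul_left ((m : ℂ) * N)).add
    ((((h.pd 0).hasSum p).mul_left (coordX p)).mul_left (m : ℂ))).add
    ((h.hasSum p).mul_left (2 * m : ℂ))).add
    ((((h.pd 1).pd 0).hasSum p).mul_left (Complex.I * Real.pi * n))).add
    (((h.pd 0).hasSum p).mul_left 0)
  -- Both sides are sums over s, and the equation holds term by term.
  refine hL.unique (hR.congr_fun fun s => ?_)
  exact congrFun ((swEq_iff _ _ _).1 (swEq_quantumTerm hm φt k s) N) p

theorem coeff_zero_quantumTerm (hm : m ≠ 0) (φt : Fin m.natAbs → SchwartzMap ℝ ℂ) (k : Fin n)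
    (s : ℤ) : PowerSeries.coeff 0 (quantumTerm n m φt k s) = classicalTerm n m φt k s := by
  have hα := two_pi_mul_slope_coordA (m := m) k.pos
  funext p
  rw [quantumTerm, map_sum, Finset.sum_apply, classicalTerm]
  refine Finset.sum_congr rfl fun j _ => ?_
  rw [coeff_zero_moyal, coeff_zero_normalOrdered k.pos hα (isYLinear_coordA hm k j s),
    coeff_orderedExp, PowerSeries.coeff_zero_C, Pi.mul_apply, Pi.smul_apply]
  simp [polyExp, lagPoly]

theorem coeff_zero_quantumSection (hm : m ≠ 0) (φt : Fin m.natAbs → SchwartzMap ℝ ℂ) (k : Fin n) :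
    PowerSeries.coeff 0 (quantumSection n m φt k) = classicalSection n m φt k := by
  rw [coeff_quantumSection]
  simp only [coeff_zero_quantumTerm hm]
  rfl

theorem isSWFund_quantumSection (hn : 0 < n) (hm : m ≠ 0) (φt : Fin m.natAbs → SchwartzMap ℝ ℂ) :
    IsSWFund (Aθ n m) (classicalSection n m φt) (quantumSection n m φt) := by
  refine (isSWFund_iff hn _ _).2 ⟨fun k N => ?_, coeff_zero_quantumSection hm φt,
    swEq_quantumSection hm φt⟩
  rw [coeff_quantumSection]
  exact (isRapid_coeff_quantumTerm hm φt k N).contDiff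

theorem sectionSeriesConverge (hm : m ≠ 0) (φt : Fin m.natAbs → SchwartzMap ℝ ℂ) :
    SectionSeriesConverge n m φt := by
  refine ⟨fun k p => ?_, fun k j s N p => ?_, fun k N p => ?_⟩
  · simp only [← coeff_zero_quantumTerm hm]
    exact (isRapid_coeff_quantumTerm hm φt k 0).summable p
  · exact (hasSum_orderedTerm (isYLinear_coordA hm k j s) isXLinear_coordB N p).summable
  · exact (isRapid_coeff_quantumTerm hm φt k N).summable p

/-! ### Quasi-periodicity of the classical sections -/

theorem coordA_translate_zero (k : Fin n) (j : Fin m.natAbs) (s : ℤ) (p : Plane) :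
    coordA n m k j s (translate 0 p) = coordA n m k j s p := by
  simp [coordA, translate]

theorem classicalTerm_translate_zero (φt : Fin m.natAbs → SchwartzMap ℝ ℂ) (k : Fin n) (s : ℤ)
    (p : Plane) : classicalTerm n m φt k s (translate 0 p) =
      Complex.exp (Complex.I * m * (p 1 : ℂ) / n) * clockEntry n m k *
        classicalTerm n m φt k s p := by
  have hn' : (n : ℂ) ≠ 0 := by exact_mod_cast k.pos.ne'
  have hpi : (Real.pi : ℂ) ≠ 0 := by exact_mod_cast Real.pi_ne_zero
  rw [classicalTerm, classicalTerm, Finset.mul_sum]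
  refine Finset.sum_congr rfl fun j _ => ?_
  have hprof : profile n m φt k j s (translate 0 p) = profile n m φt k j s p := by
    rw [profile, profile, coordA_translate_zero]
  rw [hprof, coordA_translate_zero, clockEntry, ← mul_assoc, ← Complex.exp_add, ← Complex.exp_add]
  congr 1
  rw [Complex.exp_eq_exp_iff_exists_int]
  -- Translating σ¹ multiplies the exponential by e^{2πiA}; this integer is the part ms + j of A,
  -- which drops out, leaving the phase and the clock entry.
  refine ⟨m * s + ((j : ℕ) + 1), ?_⟩
  have hB : coordB (translate 0 p) = coordB p + 2 * Real.pi * Complex.I := by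
    simp only [coordB, translate, Pi.add_apply, Pi.single_eq_same]
    push_cast
    ring
  rw [hB, coordA]
  push_cast
  field_simp
  ring

/-- Translation of σ² raises k by one; at k = n the index wraps to 1 and s increases by one. The
shift d depends on k only, so the sum over s can be reindexed. -/
theorem exists_coordA_translate_one (k : Fin n) : ∃ d : ℤ, ∀ (j : Fin m.natAbs) (s : ℤ) (p : Plane),
    coordA n m k j s (translate 1 p) = coordA n m (cycSucc k) j (s + d) p := by
  have hk := k.2
  have hT : ∀ p : Plane, translate 1 p 1 / (2 * Real.pi) = p 1 / (2 * Real.pi) + 1 := fun p => by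
    simp only [translate, Pi.add_apply, Pi.single_eq_same]
    rw [add_div, div_self (by positivity)]
  rcases Nat.lt_or_ge ((k : ℕ) + 1) n with h | h
  · refine ⟨0, fun j s p => ?_⟩
    have h2 : ((cycSucc k : Fin n) : ℕ) = k + 1 := Nat.mod_eq_of_lt h
    rw [coordA, coordA, h2, hT]
    push_cast
    ring
  · have h1 : (k : ℕ) + 1 = n := by omega
    have h2 : ((cycSucc k : Fin n) : ℕ) = 0 := by
      change ((k : ℕ) + 1) % n = 0
      rw [h1, Nat.mod_self]
    have h3 : ((k : ℕ) : ℝ) + 1 = n := by exact_mod_cast h1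
    refine ⟨1, fun j s p => ?_⟩
    rw [coordA, coordA, h2, hT, h3]
    push_cast
    ring

theorem classicalSection_translate_one (φt : Fin m.natAbs → SchwartzMap ℝ ℂ) (k : Fin n)
    (p : Plane) : classicalSection n m φt k (translate 1 p) =
      classicalSection n m φt (cycSucc k) p := by
  obtain ⟨d, hd⟩ := exists_coordA_translate_one (m := m) k
  have hB : coordB (translate 1 p) = coordB p := by simp [coordB, translate]
  rw [classicalSection, classicalSection,
    ← (Equiv.addRight d).tsum_eq fun s => classicalTerm n m φt (cycSucc k) s p]
  refine tsum_congr fun s => Finset.sum_congr rfl fun j _ => ?_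
  rw [hB, profile, hd, Equiv.coe_addRight, profile]

/-- Smoothness is inherited from order zero of the quantum section. In the two directions the
transition matrix is diagonal or a permutation, so its sum has a single term. -/
theorem classicalSection_mem_Ecl (hn : 0 < n) (hm : m ≠ 0) (φt : Fin m.natAbs → SchwartzMap ℝ ℂ) :
    classicalSection n m φt ∈ Ecl n m := by
  refine ⟨fun k => ?_, fun α p k => ?_⟩
  · rw [← coeff_zero_quantumSection hm]
    exact (isSWFund_quantumSection hn hm φt).1 k 0
  · fin_cases α
    · have h : ∀ l, Ωcl n m 0 p k l = Complex.exp (Complex.I * m * (p 1 : ℂ) / n) *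
          if k = l then clockEntry n m k else 0 := fun l => by
        change (Complex.exp (Complex.I * m * (p 1 : ℂ) / n) • clock n m) k l = _
        rw [clock_eq, Matrix.smul_apply, smul_eq_mul, Matrix.diagonal_apply]
      simp only [Fin.zero_eta, h, mul_ite, mul_zero, ite_mul, zero_mul, Finset.sum_ite_eq,
        Finset.mem_univ, if_true]
      simp only [classicalSection, classicalTerm_translate_zero]
      exact tsum_mul_left
    · have h : ∀ l, Ωcl n m 1 p k l = if l = cycSucc k then 1 else 0 := fun l =>
        shiftMat_apply k l
      simp only [Fin.mk_one, h, ite_mul, one_mul, zero_mul, Finset.sum_ite_eq', Finset.mem_univ,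
        if_true]
      exact classicalSection_translate_one φt k p

end NCTorus

end

/-! ### The main theorem -/

theorem theorem4p3 (n : ℕ) (hn : 0 < n) (m : ℤ) (hm : m ≠ 0) :
    -- the bundle with connection is quantized to the quantum bundle with its connection
    (∀ (Eh : Set (Vec n)) (Ah : Fin 2 → Mat n),
      IsInducedQuantization (Ωcl n m) (Acl n m) Eh Ah ↔ Eh = Eθ n m ∧ Ah = Aθ n m) ∧
    -- the map is well defined on fields on the plane, and restricts to the bundles on the torus
    (∀ φ : Fin n → Plane → ℂ, (∀ k, ContDiff ℝ ∞ (φ k)) → ∃! φh, IsSWFund (Aθ n m) φ φh) ∧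
    (∀ φ ∈ Ecl n m, ∀ φh, IsSWFund (Aθ n m) φ φh → φh ∈ Eθ n m) ∧
    (∀ Ψ : Plane → Matrix (Fin n) (Fin n) ℂ, (∀ k l, ContDiff ℝ ∞ fun p => Ψ p k l) →
      ∃! Ψh, IsSWAdj (Aθ n m) Ψ Ψh) ∧
    (∀ Ψ ∈ Endcl n m, ∀ Ψh, IsSWAdj (Aθ n m) Ψ Ψh → Ψh ∈ Endθ n m) ∧
    -- explicit sections
    (∀ φt : Fin m.natAbs → SchwartzMap ℝ ℂ,
      SectionSeriesConverge n m φt ∧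
      classicalSection n m φt ∈ Ecl n m ∧
      quantumSection n m φt ∈ Eθ n m ∧
      IsSWFund (Aθ n m) (classicalSection n m φt) (quantumSection n m φt)) ∧
    -- ordered monomials
    (∀ a b : ℤ, a * n - b * m = 1 →
      (∀ μ, IsStarUnitary (Zθ n m b μ)) ∧
      ∀ p q : ℤ,
        (fun x => Zcl n m b 0 x ^ p * Zcl n m b 1 x ^ q) ∈ Endcl n m ∧
        mstar (starZPow (Zθ n m b 0) p) (starZPow (Zθ n m b 1) q) ∈ Endθ n m ∧
        IsSWAdj (Aθ n m) (fun x => Zcl n m b 0 x ^ p * Zcl n m b 1 x ^ q)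
          (mstar (starZPow (Zθ n m b 0) p) (starZPow (Zθ n m b 1) q))) := by
  refine ⟨isInducedQuantization_iff hn, fun φ hφ => exists_unique_isSWFund hn hφ,
    fun φ hφ φh h => mem_Eθ_of_isSWFund hn hφ h, fun Ψ hΨ => exists_unique_isSWAdj hn hΨ,
    fun Ψ hΨ Ψh h => mem_Endθ_of_isSWAdj hn hΨ h, fun φt => ?_, fun a b hab => ?_⟩
  · have h := isSWFund_quantumSection hn hm φt
    have hcl := classicalSection_mem_Ecl hn hm φt
    exact ⟨sectionSeriesConverge hm φt, hcl, mem_Eθ_of_isSWFund hn hcl h, h⟩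
  · refine ⟨isStarUnitary_Zθ hn b, fun p q => ?_⟩
    have h := isSWAdj_monomial (m := m) hn b p q
    have hcl := monomial_mem_Endcl hn hab p q
    exact ⟨hcl, mem_Endθ_of_isSWAdj hn hcl h, h⟩
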